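/- Conventions. For a finite group $X$, $\operatorname{Irr}(X)$ is the set of complex irreducible characters and $\mathrm{cd}(S)=\{\chi(1)\mid\chi\in S\}$ for $S\subseteq\operatorname{Irr}(X)$; $\mathrm{cd}(X)=\mathrm{cd}(\operatorname{Irr}(X))$, and $\mathrm{dl}(X)$ is the derived length of a solvable group $X$. For a $p$-block $B$, $\mathrm{cd}(B)=\mathrm{cd}(\operatorname{Irr}(B))$, and $\mathrm{ht}(B)$ is the set of heights of the characters in $\operatorname{Irr}(B)$, where $\chi\in\operatorname{Irr}(B)$ has height $h$ if the $p$-part of $\chi(1)$ is $p^{h}$ times the smallest $p$-part of a degree in $B$. $B_0(X)$ is the principal block and $\mathbf{O}_{p'}(X)$ is the largest normal subgroup of $X$ of order prime to $p$. The Feng--Liu--Zhang conjecture for a prime $p$ asserts: if $B$ is a $p$-block of a finite group with defect group $D$, $p^a$ is the largest element of $\mathrm{cd}(D)$ and $b$ is the largest height of a character in $B$, then $a\le b$. Let $G$ be the group of order $729$ with underlying set $\mathbb F_3^3\times\mathbb F_3^3$ and multiplication $(v,a)(w,b)=(v+w,\;a+b+v\times w)$, where $\times$ is the cross product. Let $A=\operatorname{Aut}(G)$,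 $Q\in\operatorname{Syl}_{13}(A)$, $D\in\operatorname{Syl}_3(\mathbf{N}_A(Q))$, $R=\langle D,Q\rangle\le A$, and $H=G\rtimes R$. (1) For every such choice of $Q$ and $D$, $H$ is a solvable group of order $28431=3^7\cdot 13$ with $\mathbf{O}_{3'}(H)=1$. For $p=3$ we have $\operatorname{Irr}(H)=\operatorname{Irr}(B_0(H))$, $\mathrm{cd}(B_0(H))=\{1,3,13,39\}$ and $\mathrm{ht}(B_0(H))=\{0,1\}$. Every Sylow $3$-subgroup $P$ of $H$ is a defect group of $B_0(H)$ and satisfies $\mathrm{cd}(P)=\{1,3,9\}$ and $\mathrm{dl}(P)=3$. Hence $H$ is a counterexample to the Feng--Liu--Zhang conjecture for $p=3$ (here $a=2$ and $b=1$), and $\mathrm{dl}(P)=3>2=|\mathrm{ht}(B_0(H))|$. (2) For every odd prime $p$ the Feng--Liu--Zhang conjecture for $p$ is false. (3) The inequality $\mathrm{dl}(D)\le|\mathrm{ht}(B)|$, for a $p$-block $B$ of a finite group with defect group $D$, does not hold in general, not even for solvable groups: it fails for $p=3$ and some block of a finite solvable group. -/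

import Mathlib

open scoped Matrix

noncomputable section

namespace BlockDegrees

/-! ### Complex irreducible characters and their degrees -/

/-- `Irr(G)`: the set of complex irreducible characters of `G`, as functions on `G`. -/
def Irr (G : Type*) [Group G] : Set (G → ℂ) :=
  {χ | ∃ (n : ℕ) (ρ : Representation ℂ G (Fin n → ℂ)), ρ.IsIrreducible ∧ ρ.character = χ}

/-- `cd(S) = {χ(1) | χ ∈ S}` for a set `S` of characters. -/
def cd {G : Type*} [Group G] (S : Set (G → ℂ)) : Set ℕ :=
  {n | ∃ χ ∈ S, χ 1 = (n : ℂ)}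

/-! ### Blocks

`integralClosure ℤ ℂ` is the ring of algebraic integers, and `M` is a maximal ideal of it that
contains the prime `p`. Blocks are the classes of the irreducible characters under equality of
the central characters modulo `M`. -/

/-- `z` lies in the maximal ideal of the localization at `M` of the ring of algebraic integers.
For an algebraic integer `z` and a maximal ideal `M` this just says `z ∈ M`. -/
def IsZeroMod (M : Ideal (integralClosure ℤ ℂ)) (z : ℂ) : Prop :=
  ∃ r s : integralClosure ℤ ℂ, r ∈ M ∧ s ∉ M ∧ z * (s : ℂ) = (r : ℂ)

/-- The value `|K| χ(g) / χ(1)` of the central character of `χ` at the class sum of the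
conjugacy class `K` of `g`. -/
def centralChar {G : Type*} [Group G] (χ : G → ℂ) (g : G) : ℂ :=
  ({x : G | IsConj g x}.ncard : ℂ) * χ g / χ 1

/-- Two irreducible characters lie in the same block. -/
def SameBlock {G : Type*} [Group G] (M : Ideal (integralClosure ℤ ℂ)) (χ ψ : G → ℂ) : Prop :=
  ∀ g : G, IsZeroMod M (centralChar χ g - centralChar ψ g)

/-- `B` is the set `Irr(B)` of irreducible characters of a block of `G`. -/
def IsBlock {G : Type*} [Group G] (M : Ideal (integralClosure ℤ ℂ)) (B : Set (G → ℂ)) : Prop :=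
  ∃ χ ∈ Irr G, B = {ψ | ψ ∈ Irr G ∧ SameBlock M χ ψ}

/-- `Irr(B₀(G))`: the irreducible characters in the block of the trivial character. -/
def principalBlock (G : Type*) [Group G] (M : Ideal (integralClosure ℤ ℂ)) : Set (G → ℂ) :=
  {ψ | ψ ∈ Irr G ∧ SameBlock M (fun _ => 1) ψ}

/-- The coefficient at `g` of the sum of the primitive central idempotents of `ℂG` that belong to
the characters in `B`. Modulo `M` it is the coefficient of the block idempotent. -/
def idempotentCoeff {G : Type*} [Group G] (B : Set (G → ℂ)) (g : G) : ℂ :=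
  (∑ᶠ χ ∈ B, χ 1 * χ g⁻¹) / (Nat.card G : ℂ)

/-- `D` is a defect group of the block `B`: a Sylow `p`-subgroup of the centralizer of an element
of a defect class of `B`, that is, of a class at which neither the central character nor the block
idempotent of `B` vanishes modulo `M`. -/
def IsDefectGroup {G : Type*} [Group G] (p : ℕ) (M : Ideal (integralClosure ℤ ℂ))
    (B : Set (G → ℂ)) (D : Subgroup G) : Prop :=
  ∃ g : G, (∃ χ ∈ B, ¬ IsZeroMod M (centralChar χ g)) ∧ ¬ IsZeroMod M (idempotentCoeff B g) ∧
    ∃ P : Sylow p (Subgroup.centralizer {g}),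
      D = (P : Subgroup (Subgroup.centralizer {g})).map (Subgroup.centralizer {g}).subtype

/-- `ht(B)`: the set of heights of the characters in `B`. The `p`-part of `χ(1)` is `p ^ (m + h)`,
where `p ^ m` is the smallest `p`-part of a degree in `B` and `h` is the height of `χ`. -/
def heights {G : Type*} [Group G] (p : ℕ) (B : Set (G → ℂ)) : Set ℕ :=
  {h | ∃ m : ℕ, IsLeast (padicValNat p '' cd B) m ∧ ∃ n ∈ cd B, padicValNat p n = m + h}

/-! ### Group theory -/

/-- The derived length of a solvable group. -/
def derivedLength (G : Type*) [Group G] : ℕ :=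
  sInf {n | derivedSeries G n = ⊥}

/-- `O_{p'}(G)`, for a finite group `G`: the subgroup generated by all the normal subgroups of
order prime to `p` (the largest such normal subgroup). -/
def pPrimeCore (p : ℕ) (G : Type*) [Group G] : Subgroup G :=
  sSup {N | N.Normal ∧ (Nat.card N).Coprime p}

/-! ### The two statements to be refuted -/

/-- The Feng--Liu--Zhang conjecture for the prime `p`: if `p ^ a` is the largest irreducible
character degree of a defect group `D` of a `p`-block `B` of a finite group, and `b` is the largest
height in `B`, then `a ≤ b`. -/
def FengLiuZhang (p : ℕ) (M : Ideal (integralClosure ℤ ℂ)) : Prop :=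
  ∀ (G : Type) [Group G] [Finite G] (B : Set (G → ℂ)), IsBlock M B →
    ∀ D : Subgroup G, IsDefectGroup p M B D →
      ∀ a b : ℕ, IsGreatest (cd (Irr D)) (p ^ a) → IsGreatest (heights p B) b → a ≤ b

/-- The bound `dl(D) ≤ |ht(B)|` for all `p`-blocks `B` of finite solvable groups and their defect
groups `D`. -/
def DerivedLengthLeHeights (p : ℕ) (M : Ideal (integralClosure ℤ ℂ)) : Prop :=
  ∀ (G : Type) [Group G] [Finite G], Group.IsSolvable G → ∀ B : Set (G → ℂ), IsBlock M B →
    ∀ D : Subgroup G, IsDefectGroup p M B D → derivedLength D ≤ (heights p B).ncard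

/-! ### The group of order 729 and the group `H` -/

/-- The group of order `3 ^ 6` on `𝔽₃³ × 𝔽₃³` with multiplication
`(v, a) (w, b) = (v + w, a + b + v × w)`, where `v × w` is the cross product. It is the relatively
free group of rank three, class two and exponent three. -/
@[ext] structure G729 where
  /-- the component in the abelianization -/
  v : Fin 3 → ZMod 3
  /-- the component in the centre -/
  a : Fin 3 → ZMod 3

namespace G729

instance : Mul G729 := ⟨fun x y => ⟨x.v + y.v, x.a + y.a + x.v ⨯₃ y.v⟩⟩
instance : One G729 := ⟨⟨0, 0⟩⟩
instance : Inv G729 := ⟨fun x => ⟨-x.v, -x.a⟩⟩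

@[simp] theorem mul_v (x y : G729) : (x * y).v = x.v + y.v := rfl
@[simp] theorem mul_a (x y : G729) : (x * y).a = x.a + y.a + x.v ⨯₃ y.v := rfl
@[simp] theorem one_v : (1 : G729).v = 0 := rfl
@[simp] theorem one_a : (1 : G729).a = 0 := rfl
@[simp] theorem inv_v (x : G729) : (x⁻¹).v = -x.v := rfl
@[simp] theorem inv_a (x : G729) : (x⁻¹).a = -x.a := rfl

instance : Group G729 :=
  Group.ofLeftAxioms
    (fun x y z => by
      ext1
      · simp [add_assoc]
      · simp only [mul_v, mul_a, map_add, LinearMap.add_apply]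
        abel)
    (fun x => by ext1 <;> simp)
    (fun x => by ext1 <;> simp)

end G729

/-- The subgroup `R = ⟨D, Q⟩` of `Aut(G)`, where `Q` is a Sylow 13-subgroup of `Aut(G)` and `D` is
a Sylow 3-subgroup of its normalizer. -/
def groupR (Q : Sylow 13 (MulAut G729))
    (D : Sylow 3 (Subgroup.normalizer (Q : Set (MulAut G729)))) : Subgroup (MulAut G729) :=
  (D : Subgroup (Subgroup.normalizer (Q : Set (MulAut G729)))).map (Subgroup.subtype _) ⊔
    (Q : Subgroup (MulAut G729))

/-- The semidirect product `H = G ⋊ R`. -/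
abbrev GroupH (Q : Sylow 13 (MulAut G729))
    (D : Sylow 3 (Subgroup.normalizer (Q : Set (MulAut G729)))) : Type :=
  G729 ⋊[(groupR Q D).subtype] (groupR Q D)

end BlockDegrees

end

/-! Everything takes place over the field `F` of order p^p, p odd. On `F × F` let `Heis p F` be the
class-two group whose commutator form is 2(x^p y - x y^p). The group T of elements of norm one acts
on it by t on the quotient and by t^(p+1) on the centre, and the Galois group, of order p, acts on
both coordinates. The counterexample is `Heis p F` extended by `semilinearGroup`, the product of T
and the Galois group; its Sylow p-subgroups are `Heis p F` extended by the Galois group alone.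

There is only one block because `Heis p F` is a normal p-subgroup containing its centralizer. Modulo
p, each class sum minus its augmentation is then nilpotent (`reducedClassSum_pow_eq_zero`), so all
central characters agree modulo `M`. Every Sylow p-subgroup is a defect group, the class of the
identity being a defect class.

The degrees come from Clifford theory. A character of the centre, or of the quotient by it, is z ↦
`traceChar` (c z) for some c in `F`. Every nonzero c is a norm-one element times a scalar of the
prime field. The order of T is 1 + p + ... + p^(p-1), which is prime to p, p - 1 and p + 1; so t ↦
t^(p+1) permutes T, and both actions of T carry each nonzero c into the prime field. There the
stabilizer in `semilinearGroup` is exactly the Galois group, so the orbit length is |T|, prime to p.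
For c ≠ 0 in the prime field the radical of the commutator form is the prime field itself, since `F`
has no quadratic subfield. The Galois group fixes this radical, hence radical and centre act by
scalars on the module of the stabilizer, whose degree is p^((p-1)/2), no more than for `Heis p F`
alone. The degrees of the whole group are therefore 1, p, |T| and |T| p^((p-1)/2).

In a Sylow p-subgroup the elements of T are missing. A central weight c outside the prime field
cannot be moved into it and has p conjugates under the Galois group, which gives the degree
p^((p+1)/2), one factor p more than any height allows. The derived length is 3, because the
commutators of the Frobenius map with `Heis p F` do not commute with one another.

It remains to recognize, for p = 3, the group given by the cross product. The cross product is the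
universal alternating map on a space of dimension three, so `G729` is isomorphic to `Heis 3 F`. In
the automorphism group the normalizer of T consists of the maps `act c τ` and has order 78 = 26 · 3.
So T is a Sylow 13-subgroup, the Galois group is a Sylow 3-subgroup of its normalizer, and Sylow's
theorem, applied twice, identifies every choice of `groupR` with `semilinearGroup`. -/

noncomputable section
set_option linter.unusedSectionVars false
namespace BlockDegrees

/-! ### Irreducible representations, Schur's lemma, integrality and degrees -/

section Reps

variable {K V : Type*} [Group K] [AddCommGroup V] [Module ℂ V]

open Module

theorem isIrreducible_iff (ρ : Representation ℂ K V) :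
    ρ.IsIrreducible ↔ Nontrivial V ∧
      ∀ p : Submodule ℂ V, (∀ g, ∀ v ∈ p, ρ g v ∈ p) → p = ⊥ ∨ p = ⊤ := by
  constructor
  · intro h
    refine ⟨?_, fun p hp => ?_⟩
    · by_contra hV
      rw [not_nontrivial_iff_subsingleton] at hV
      obtain ⟨a, b, hab⟩ := h.toNontrivial
      exact hab (Subrepresentation.toSubmodule_injective (Subsingleton.elim _ _))
    · rcases h.eq_bot_or_eq_top (⟨p, fun g v hv => hp g v hv⟩ : Subrepresentation ρ) with h | h
      · left; exact congrArg Subrepresentation.toSubmodule h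
      · right; exact congrArg Subrepresentation.toSubmodule h
  · rintro ⟨hV, h⟩
    refine { exists_pair_ne := ⟨⊥, ⊤, fun e => ?_⟩, eq_bot_or_eq_top := fun s => ?_ }
    · exact bot_ne_top (α := Submodule ℂ V) (congrArg Subrepresentation.toSubmodule e)
    · rcases h s.toSubmodule (fun g v hv => s.apply_mem_toSubmodule g hv) with h | h
      · left; exact Subrepresentation.toSubmodule_injective h
      · right; exact Subrepresentation.toSubmodule_injective h

/-- The restriction of a representation to an invariant submodule. -/
def subRep (ρ : Representation ℂ K V) (p : Submodule ℂ V) (hp : ∀ g, ∀ v ∈ p, ρ g v ∈ p) :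
    Representation ℂ K p :=
  (⟨p, fun g v hv => hp g v hv⟩ : Subrepresentation ρ).toRepresentation

theorem subRep_isIrreducible (ρ : Representation ℂ K V) (p : Submodule ℂ V)
    (hp : ∀ g, ∀ v ∈ p, ρ g v ∈ p) (hne : p ≠ ⊥)
    (hmin : ∀ q ≤ p, (∀ g, ∀ v ∈ q, ρ g v ∈ q) → q ≠ ⊥ → q = p) :
    (subRep ρ p hp).IsIrreducible := by
  rw [isIrreducible_iff]
  refine ⟨Submodule.nontrivial_iff_ne_bot.2 hne, fun q hq => ?_⟩
  by_cases hq0 : q = ⊥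
  · exact Or.inl hq0
  · right
    have h1 := hmin (q.map p.subtype) (Submodule.map_subtype_le _ _) (by
      rintro g _ ⟨v, hv, rfl⟩
      exact ⟨subRep ρ p hp g v, hq g v hv, rfl⟩) (by
      intro h
      exact hq0 (Submodule.map_injective_of_injective p.injective_subtype
        (h.trans (Submodule.map_bot _).symm)))
    apply Submodule.map_injective_of_injective p.injective_subtype
    rw [h1, Submodule.map_top, Submodule.range_subtype]

theorem exists_subRep_isIrreducible [FiniteDimensional ℂ V] (ρ : Representation ℂ K V)
    (X : Submodule ℂ V) (hX : ∀ g, ∀ v ∈ X, ρ g v ∈ X) (hne : X ≠ ⊥) :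
    ∃ (p : Submodule ℂ V) (hp : ∀ g, ∀ v ∈ p, ρ g v ∈ p), p ≤ X ∧ p ≠ ⊥ ∧
      (subRep ρ p hp).IsIrreducible := by
  obtain ⟨p, ⟨hp, hpX, hp0⟩, hmin⟩ := WellFounded.has_min (wellFounded_lt (α := Submodule ℂ V))
    {p | (∀ g, ∀ v ∈ p, ρ g v ∈ p) ∧ p ≤ X ∧ p ≠ ⊥} ⟨X, hX, le_rfl, hne⟩
  refine ⟨p, hp, hpX, hp0, subRep_isIrreducible ρ p hp hp0 fun q hqp hq hq0 => ?_⟩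
  by_contra h
  exact hmin q ⟨hq, hqp.trans hpX, hq0⟩ (lt_of_le_of_ne hqp h)

/-- Schur's lemma. -/
theorem exists_eq_smul_of_commute [FiniteDimensional ℂ V] (ρ : Representation ℂ K V)
    [hρ : ρ.IsIrreducible] (f : End ℂ V) (hf : ∀ g, f * ρ g = ρ g * f) :
    ∃ z : ℂ, ∀ v, f v = z • v := by
  obtain ⟨hV, h⟩ := (isIrreducible_iff ρ).1 hρ
  obtain ⟨z, hz⟩ := End.exists_eigenvalue f
  refine ⟨z, fun v => ?_⟩
  have := h (f.eigenspace z) (fun g v hv => by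
    rw [End.mem_eigenspace_iff] at hv ⊢
    have := LinearMap.congr_fun (hf g) v
    simp only [Module.End.mul_apply] at this
    rw [this, hv, map_smul])
  rcases this with h | h
  · exact absurd h hz
  · exact End.mem_eigenspace_iff.1 (h ▸ Submodule.mem_top)

theorem isIrreducible_comp {L : Type*} [Group L] (ρ : Representation ℂ K V)
    (hρ : ρ.IsIrreducible) (f : L →* K) (hf : Function.Surjective f) :
    Representation.IsIrreducible (ρ.comp f : Representation ℂ L V) := by
  rw [isIrreducible_iff] at hρ ⊢
  refine ⟨hρ.1, fun p hp => hρ.2 p fun g v hv => ?_⟩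
  obtain ⟨l, rfl⟩ := hf g
  exact hp l v hv

theorem exists_fin_of_isIrreducible [FiniteDimensional ℂ V] (ρ : Representation ℂ K V)
    (hρ : ρ.IsIrreducible) :
    ∃ σ : Representation ℂ K (Fin (finrank ℂ V) → ℂ), σ.IsIrreducible ∧
      σ.character = ρ.character := by
  let e : V ≃ₗ[ℂ] (Fin (finrank ℂ V) → ℂ) := (finBasis ℂ V).equivFun
  let σ : Representation ℂ K (Fin (finrank ℂ V) → ℂ) :=
    { toFun := fun g => e.conj (ρ g)
      map_one' := by ext; simp
      map_mul' := fun a b => by rw [map_mul]; ext; simp [LinearEquiv.conj_apply] }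
  have hσ : ∀ g v, σ g (e v) = e (ρ g v) := fun g v => by
    simp [σ, LinearEquiv.conj_apply]
  refine ⟨σ, ?_, ?_⟩
  · rw [isIrreducible_iff] at hρ ⊢
    obtain ⟨hV, h⟩ := hρ
    refine ⟨e.symm.toEquiv.nontrivial, fun p hp => ?_⟩
    rcases h (p.comap e.toLinearMap) (fun g v hv => by
      have := hp g _ hv
      rw [LinearEquiv.coe_coe, hσ] at this
      exact this) with h | h
    · left
      rw [eq_bot_iff]
      intro x hx
      have : e.symm x ∈ p.comap e.toLinearMap := by simpa using hx
      rw [h, Submodule.mem_bot] at this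
      simpa using this
    · right
      rw [eq_top_iff]
      intro x _
      have : e.symm x ∈ p.comap e.toLinearMap := by rw [h]; trivial
      simpa using this
  · ext g
    exact LinearMap.trace_conj' (ρ g) e

theorem character_mem_Irr [FiniteDimensional ℂ V] (ρ : Representation ℂ K V)
    (hρ : ρ.IsIrreducible) : ρ.character ∈ Irr K := by
  obtain ⟨σ, hσ, h⟩ := exists_fin_of_isIrreducible ρ hρ
  exact ⟨_, σ, hσ, h⟩

theorem finrank_mem_cd [FiniteDimensional ℂ V] (ρ : Representation ℂ K V)
    (hρ : ρ.IsIrreducible) : finrank ℂ V ∈ cd (Irr K) :=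
  ⟨_, character_mem_Irr ρ hρ, Representation.char_one ρ⟩

theorem mem_cd_Irr {n : ℕ} : n ∈ cd (Irr K) ↔
    ∃ ρ : Representation ℂ K (Fin n → ℂ), ρ.IsIrreducible := by
  constructor
  · rintro ⟨_, ⟨m, ρ, hρ, rfl⟩, h⟩
    rw [Representation.char_one, finrank_fin_fun] at h
    obtain rfl : m = n := by exact_mod_cast h
    exact ⟨ρ, hρ⟩
  · rintro ⟨ρ, hρ⟩
    have := finrank_mem_cd ρ hρ
    rwa [finrank_fin_fun] at this

theorem cd_Irr_congr {L : Type*} [Group L] (e : K ≃* L) : cd (Irr K) = cd (Irr L) := by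
  ext n
  rw [mem_cd_Irr, mem_cd_Irr]
  exact ⟨fun ⟨ρ, hρ⟩ => ⟨_, isIrreducible_comp ρ hρ e.symm.toMonoidHom e.symm.surjective⟩,
    fun ⟨ρ, hρ⟩ => ⟨_, isIrreducible_comp ρ hρ e.toMonoidHom e.surjective⟩⟩

theorem one_mem_cd : 1 ∈ cd (Irr K) := by
  have h : (Representation.trivial ℂ K ℂ).IsIrreducible := by
    rw [isIrreducible_iff]
    exact ⟨inferInstance, fun p _ => eq_bot_or_eq_top p⟩
  simpa using finrank_mem_cd _ h

section Finite

variable [Finite K] [FiniteDimensional ℂ V]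

theorem sum_character_mul_character_inv [Fintype K] (ρ : Representation ℂ K V)
    [ρ.IsIrreducible] : ∑ g : K, ρ.character g * ρ.character g⁻¹ = (Nat.card K : ℂ) := by
  have hne : (Nat.card K : ℂ) ≠ 0 := by exact_mod_cast Nat.card_pos.ne'
  have : Invertible (Nat.card K : ℂ) := invertibleOfNonzero hne
  have h := Representation.char_orthonormal ρ ρ
  rw [if_pos ⟨Representation.Equiv.refl ρ⟩] at h
  field_simp at h
  exact h

/-- A class function gives a central element of the group algebra, which acts on an irreducible
representation as a scalar. -/
theorem sum_smul_apply_eq_of_class [Fintype K] (ρ : Representation ℂ K V) [hρ : ρ.IsIrreducible]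
    (f : K → ℂ) (hf : ∀ g h, f (h * g * h⁻¹) = f g) (v : V) :
    ∑ g, f g • ρ g v = ((∑ g, f g * ρ.character g) / finrank ℂ V) • v := by
  have hV := ((isIrreducible_iff ρ).1 hρ).1
  obtain ⟨z, hz⟩ := exists_eq_smul_of_commute ρ (∑ g, f g • ρ g) (fun h => by
    rw [Finset.sum_mul, Finset.mul_sum, ← (MulAut.conj h).toEquiv.sum_comp (fun g => f g • ρ g * ρ h)]
    refine Finset.sum_congr rfl fun g _ => ?_
    simp only [MulEquiv.toEquiv_eq_coe, EquivLike.coe_coe, MulAut.conj_apply, hf, smul_mul_assoc,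
      mul_smul_comm, ← map_mul, inv_mul_cancel_right])
  have hd : (finrank ℂ V : ℂ) ≠ 0 := by exact_mod_cast finrank_pos.ne'
  have htr : LinearMap.trace ℂ V (∑ g, f g • ρ g) = z * finrank ℂ V := by
    have : (∑ g, f g • ρ g) = z • (1 : End ℂ V) := LinearMap.ext fun v => by
      rw [hz]; simp
    rw [this, map_smul, LinearMap.trace_one, smul_eq_mul]
  have htr2 : LinearMap.trace ℂ V (∑ g, f g • ρ g) = ∑ g, f g * ρ.character g := by
    simp [map_sum, Representation.character]
  rw [← htr2, htr, mul_div_cancel_right₀ _ hd, ← hz, LinearMap.sum_apply]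
  rfl

theorem trace_asAlgebraHom [Fintype K] (ρ : Representation ℂ K V) (x : MonoidAlgebra ℂ K) :
    LinearMap.trace ℂ V (ρ.asAlgebraHom x) = ∑ g, x.coeff g * ρ.character g := by
  rw [Representation.asAlgebraHom_def, MonoidAlgebra.lift_apply,
    Finsupp.sum_fintype _ _ (by simp), map_sum]
  simp [Representation.character]

section Integrality

variable {O : Type*} [CommRing O] [Algebra O ℂ] [Module O V] [IsScalarTower O ℂ V]

/-- The group ring over `O` is finite over `O`, so each of its elements is integral, and so is a
scalar by which one of them acts. With algebraic integers as coefficients this gives the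
divisibility of |K| by the degrees; with `ℤ` it gives the congruence of central characters. -/
theorem isIntegral_of_sum_smul_apply_eq_smul [Fintype K] [Nontrivial V]
    (ρ : Representation ℂ K V) (f : K → O) (c : ℂ)
    (h : ∀ v, ∑ g, algebraMap O ℂ (f g) • ρ g v = c • v) : IsIntegral O c := by
  have h1 : IsIntegral O (∑ g, MonoidAlgebra.single g (f g)) := IsIntegral.of_finite O _
  have h2 := h1.map (MonoidAlgebra.lift O (End ℂ V) K ρ)
  have h3 : MonoidAlgebra.lift O (End ℂ V) K ρ (∑ g, MonoidAlgebra.single g (f g)) =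
      algebraMap ℂ (End ℂ V) c := LinearMap.ext fun v => by
    rw [Module.algebraMap_end_apply, ← h, map_sum, LinearMap.sum_apply]
    refine Finset.sum_congr rfl fun g _ => ?_
    rw [MonoidAlgebra.lift_single, algebraMap_smul]; rfl
  rw [h3] at h2
  exact (isIntegral_algebraMap_iff (FaithfulSMul.algebraMap_injective ℂ (End ℂ V))).1 h2

end Integrality

theorem eq_one_of_smul_eq_self {v : V} (hv : v ≠ 0) {z : ℂ} (h : z • v = v) : z = 1 := by
  have : (z - 1) • v = 0 := by rw [sub_smul, h, one_smul, sub_self]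
  exact sub_eq_zero.1 ((smul_eq_zero.1 this).resolve_right hv)

theorem isIntegral_character (ρ : Representation ℂ K V) (g : K) :
    IsIntegral ℤ (ρ.character g) := by
  rw [Representation.character,
    Module.End.trace_eq_sum_roots_charpoly_of_splits (IsAlgClosed.splits _)]
  refine IsIntegral.multiset_sum fun z hz => ?_
  have hz := (End.hasEigenvalue_iff_isRoot_charpoly _ _).2
    (Polynomial.isRoot_of_mem_roots hz)
  obtain ⟨v, hv⟩ := hz.exists_hasEigenvector
  have h := hv.pow_apply (Nat.card K)
  rw [← map_pow, pow_card_eq_one', map_one, Module.End.one_apply] at h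
  refine ⟨Polynomial.X ^ Nat.card K - 1, Polynomial.monic_X_pow_sub_C 1 Nat.card_pos.ne', ?_⟩
  simp [eq_one_of_smul_eq_self hv.2 h.symm]

/-- The element ∑ χ(g⁻¹) g acts as the scalar |K| / χ(1). This is thus an algebraic integer, and
being rational it is an integer. -/
theorem finrank_dvd_card (ρ : Representation ℂ K V) [hρ : ρ.IsIrreducible] :
    finrank ℂ V ∣ Nat.card K := by
  have := Fintype.ofFinite K
  have hV := ((isIrreducible_iff ρ).1 hρ).1
  have hd : (finrank ℂ V : ℂ) ≠ 0 := by exact_mod_cast finrank_pos.ne'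
  let f : K → integralClosure ℤ ℂ := fun g => ⟨ρ.character g⁻¹, isIntegral_character ρ _⟩
  have h1 : IsIntegral (integralClosure ℤ ℂ) ((Nat.card K : ℂ) / finrank ℂ V) := by
    refine isIntegral_of_sum_smul_apply_eq_smul ρ f _ fun v => ?_
    have := sum_smul_apply_eq_of_class ρ (fun g => ρ.character g⁻¹) (fun g h => by
      rw [← Representation.char_conj ρ g⁻¹ h]
      group) v
    simp_rw [mul_comm (ρ.character _⁻¹)] at this
    rw [sum_character_mul_character_inv] at this
    exact this
  have h2 : IsIntegral ℤ ((Nat.card K : ℂ) / finrank ℂ V) := isIntegral_trans _ h1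
  obtain ⟨z, hz⟩ := (IsIntegrallyClosed.isIntegral_iff (R := ℤ) (K := ℚ)
    (x := (Nat.card K : ℚ) / finrank ℂ V)).1
    ((isIntegral_algebraMap_iff (algebraMap ℚ ℂ).injective).1 (by simpa using h2))
  rw [eq_div_iff (by exact_mod_cast hd)] at hz
  have : (finrank ℂ V : ℤ) ∣ (Nat.card K : ℤ) := ⟨z, by
    
    rw [eq_intCast] at hz
    rw [mul_comm]
    exact_mod_cast hz.symm⟩
  exact_mod_cast this

end Finite
end Reps
end BlockDegrees
end

/-! ### Wedderburn decomposition and its consequences -/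

noncomputable section
set_option linter.unusedSectionVars false
namespace BlockDegrees

open Module

section Wedderburn

variable {K V : Type*} [Group K] [AddCommGroup V] [Module ℂ V]

theorem isIrreducible_of_asAlgebraHom_surjective [Nontrivial V] (ρ : Representation ℂ K V)
    (h : Function.Surjective ρ.asAlgebraHom) : ρ.IsIrreducible := by
  rw [isIrreducible_iff]
  refine ⟨inferInstance, fun p hp => ?_⟩
  by_cases hp0 : p = ⊥
  · exact Or.inl hp0
  right
  obtain ⟨v, hv, hv0⟩ := p.ne_bot_iff.1 hp0
  have hall : ∀ x : MonoidAlgebra ℂ K, ρ.asAlgebraHom x v ∈ p := fun x => by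
    induction x using MonoidAlgebra.induction_linear with
    | zero => simp
    | add x y hx hy => rw [map_add]; exact p.add_mem hx hy
    | single g a =>
      rw [Representation.asAlgebraHom_single]
      exact p.smul_mem a (hp g v hv)
  obtain ⟨φ, hφ⟩ : ∃ φ : Dual ℂ V, φ v ≠ 0 := by
    by_contra! hc
    exact hv0 ((forall_dual_apply_eq_zero_iff ℂ v).1 hc)
  rw [eq_top_iff]
  intro w _
  -- A rank-one endomorphism that sends `v` to `w`; it lies in the image of the group algebra.
  obtain ⟨x, hx⟩ := h (φ.smulRight ((φ v)⁻¹ • w))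
  have := hall x
  rwa [hx, LinearMap.smulRight_apply, smul_smul, mul_inv_cancel₀ hφ, one_smul] at this

/-- The Wedderburn decomposition of `ℂK`, in terms of representations. -/
theorem exists_wedderburn (K : Type*) [Group K] [Finite K] :
    ∃ (n : ℕ) (d : Fin n → ℕ) (ρ : ∀ i, Representation ℂ K (Fin (d i) → ℂ)),
      (∀ i, (ρ i).IsIrreducible) ∧
      (∀ x : MonoidAlgebra ℂ K, (∀ i, (ρ i).asAlgebraHom x = 0) → x = 0) ∧
      (∀ i (f : End ℂ (Fin (d i) → ℂ)), ∃ x, (ρ i).asAlgebraHom x = f ∧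
        ∀ j, j ≠ i → (ρ j).asAlgebraHom x = 0) ∧
      ∑ i, d i ^ 2 = Nat.card K := by
  have := Fintype.ofFinite K
  have : NeZero (Nat.card K : ℂ) := ⟨by exact_mod_cast Nat.card_pos.ne'⟩
  obtain ⟨n, d, hd, ⟨φ⟩⟩ :=
    IsSemisimpleRing.exists_algEquiv_pi_matrix_of_isAlgClosed ℂ (MonoidAlgebra ℂ K)
  let F (i : Fin n) : MonoidAlgebra ℂ K →ₐ[ℂ] End ℂ (Fin (d i) → ℂ) :=
    (Matrix.toLinAlgEquiv' (R := ℂ) (n := Fin (d i))).toAlgHom.comp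
      ((Pi.evalAlgHom ℂ (fun i => Matrix (Fin (d i)) (Fin (d i)) ℂ) i).comp φ.toAlgHom)
  let ρ (i : Fin n) : Representation ℂ K (Fin (d i) → ℂ) := (MonoidAlgebra.lift ℂ _ K).symm (F i)
  have hρ : ∀ i, (ρ i).asAlgebraHom = F i := fun i => Equiv.apply_symm_apply _ _
  have hex : ∀ i (f : End ℂ (Fin (d i) → ℂ)), ∃ x, (ρ i).asAlgebraHom x = f ∧
        ∀ j, j ≠ i → (ρ j).asAlgebraHom x = 0 := fun i f => by
    refine ⟨φ.symm (Pi.single i (Matrix.toLinAlgEquiv'.symm f)), ?_, fun j hj => ?_⟩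
    · simp [hρ, F]
    · simp [hρ, F, hj]
  refine ⟨n, d, ρ, fun i => ?_, fun x hx => ?_, hex, ?_⟩
  · have := hd i
    exact isIrreducible_of_asAlgebraHom_surjective _ fun f => (hex i f).imp fun x hx => hx.1
  · apply φ.injective
    rw [map_zero]
    funext i
    have := hx i
    rw [hρ] at this
    simpa [F] using this
  · have h := φ.toLinearEquiv.finrank_eq
    rw [finrank_pi_fintype] at h
    simp only [finrank_matrix, finrank_self, mul_one, Fintype.card_fin] at h
    have h2 : finrank ℂ (MonoidAlgebra ℂ K) = Nat.card K := by
      rw [Nat.card_eq_fintype_card]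
      exact finrank_eq_card_basis (MonoidAlgebra.basis K ℂ)
    rw [← h2, h]
    exact Finset.sum_congr rfl fun i _ => sq _

variable [Finite K] [FiniteDimensional ℂ V]

theorem asAlgebraHom_sum_single [Fintype K] (ρ : Representation ℂ K V) (f : K → ℂ) (v : V) :
    ρ.asAlgebraHom (∑ g, MonoidAlgebra.single g (f g)) v = ∑ g, f g • ρ g v := by
  simp [map_sum, LinearMap.sum_apply]

/-- If σ were isomorphic to no `ρ i`, orthogonality of characters would make ∑ χ_σ(g⁻¹) g act as
zero in all of them. Faithfulness would make this element zero, but its coefficient at 1 is the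
degree of σ. -/
theorem exists_equiv_of_faithful {ι : Type*} {d : ι → ℕ}
    (ρ : ∀ i, Representation ℂ K (Fin (d i) → ℂ)) (hirr : ∀ i, (ρ i).IsIrreducible)
    (hfaith : ∀ x : MonoidAlgebra ℂ K, (∀ i, (ρ i).asAlgebraHom x = 0) → x = 0)
    (σ : Representation ℂ K V) (hσ : σ.IsIrreducible) : ∃ i, Nonempty ((ρ i).Equiv σ) := by
  have := Fintype.ofFinite K
  by_contra! hcon
  have hne : (Nat.card K : ℂ) ≠ 0 := by exact_mod_cast Nat.card_pos.ne'
  have : Invertible (Nat.card K : ℂ) := invertibleOfNonzero hne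
  have h0 : (∑ g, MonoidAlgebra.single g (σ.character g⁻¹) : MonoidAlgebra ℂ K) = 0 := by
    refine hfaith _ fun i => LinearMap.ext fun v => ?_
    rw [asAlgebraHom_sum_single, sum_smul_apply_eq_of_class _ (fun g => σ.character g⁻¹)
      (fun g h => by rw [← Representation.char_conj σ g⁻¹ h]; group)]
    have h := Representation.char_orthonormal σ (ρ i)
    have hno : ¬ Nonempty ((ρ i).Equiv σ) := not_nonempty_iff.2 (hcon i)
    rw [if_neg hno] at h
    have h := (mul_eq_zero.1 h).resolve_left (inv_ne_zero hne)
    rw [← Equiv.sum_comp (Equiv.inv K)] at h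
    simp only [Equiv.inv_apply, inv_inv] at h
    rw [h]
    simp
  have h1 := congrArg (fun x => MonoidAlgebra.coeff x 1) h0
  have hV := ((isIrreducible_iff σ).1 hσ).1
  have hd : (finrank ℂ V : ℂ) ≠ 0 := by exact_mod_cast finrank_pos.ne'
  apply hd
  classical
  simpa [MonoidAlgebra.coeff_sum, Finsupp.single_apply] using h1

/-- If the subgroup `U` acts by scalars on an irreducible representation, then the square of the
degree is at most the index of `U`. -/
theorem finrank_sq_le_index (ρ : Representation ℂ K V) (hρ : ρ.IsIrreducible) (U : Subgroup K)
    (hU : ∀ u ∈ U, ∃ z : ℂ, ∀ v, ρ u v = z • v) : finrank ℂ V ^ 2 ≤ U.index := by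
  obtain ⟨n, d, τ, hirr, hfaith, hex, -⟩ := exists_wedderburn K
  obtain ⟨i, ⟨e⟩⟩ := exists_equiv_of_faithful τ hirr hfaith ρ hρ
  have hsurj : Function.Surjective ρ.asAlgebraHom := fun f => by
    obtain ⟨x, hx, -⟩ := hex i (e.toLinearEquiv.symm.conj f)
    refine ⟨x, ?_⟩
    have key : ∀ x, ρ.asAlgebraHom x = e.toLinearEquiv.conj ((τ i).asAlgebraHom x) := fun x => by
      induction x using MonoidAlgebra.induction_linear with
      | zero => simp
      | add x y hx hy => rw [map_add, map_add, map_add, hx, hy]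
      | single g a =>
        rw [Representation.asAlgebraHom_single, Representation.asAlgebraHom_single, map_smul,
          ← e.conj_apply_self]
    rw [key, hx]
    exact e.toLinearEquiv.conj.apply_symm_apply f
  -- The image of the group algebra is the full endomorphism ring. As `U` acts by scalars, one
  -- representative of each coset of `U` suffices to span it.
  have hspan : ⊤ ≤ Submodule.span ℂ (Set.range fun q : K ⧸ U => ρ q.out) := by
    rintro f -
    obtain ⟨x, rfl⟩ := hsurj f
    induction x using MonoidAlgebra.induction_linear with
    | zero => simp
    | add x y hx hy => rw [map_add]; exact Submodule.add_mem _ hx hy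
    | single g a =>
      rw [Representation.asAlgebraHom_single]
      refine Submodule.smul_mem _ _ ?_
      obtain ⟨u, hu⟩ := QuotientGroup.mk_out_eq_mul U g
      obtain ⟨z, hz⟩ := hU _ (U.inv_mem u.2)
      have : ρ g = z • ρ (g : K ⧸ U).out := LinearMap.ext fun v => by
        rw [LinearMap.smul_apply, ← map_smul, ← hz, ← Module.End.mul_apply, ← map_mul, hu,
          mul_inv_cancel_right]
      rw [this]
      exact Submodule.smul_mem _ _ (Submodule.subset_span ⟨_, rfl⟩)
  have := Fintype.ofFinite (K ⧸ U)
  have h := finrank_range_le_card (R := ℂ) (fun q : K ⧸ U => ρ q.out)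
  rw [Set.finrank, top_le_iff.1 hspan, finrank_top, finrank_linearMap, ← Nat.card_eq_fintype_card] at h
  rw [sq]
  exact h

/-- A linear character of a subgroup occurs in some irreducible representation. -/
theorem exists_isIrreducible_apply_eq_smul (N : Subgroup K) (lam : N →* ℂ) :
    ∃ (d : ℕ) (ρ : Representation ℂ K (Fin d → ℂ)) (v : Fin d → ℂ), ρ.IsIrreducible ∧ v ≠ 0 ∧
      ∀ n : N, ρ n v = lam n • v := by
  have := Fintype.ofFinite N
  obtain ⟨n, d, τ, hirr, hfaith, -⟩ := exists_wedderburn K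
  -- A multiple of the idempotent of `lam`: every vector in its image is an eigenvector with
  -- eigenvalue `lam`. Its coefficient at 1 is nonzero, so it acts nontrivially somewhere.
  let x : MonoidAlgebra ℂ K := ∑ n : N, MonoidAlgebra.single (n : K) (lam n⁻¹)
  have hx : x ≠ 0 := fun h => by
    have h1 := congrArg (fun x => MonoidAlgebra.coeff x 1) h
    classical
    simp [x, MonoidAlgebra.coeff_sum, Finsupp.single_apply] at h1
  obtain ⟨i, hi⟩ : ∃ i, (τ i).asAlgebraHom x ≠ 0 := by
    by_contra! h
    exact hx (hfaith x h)
  obtain ⟨w, hw⟩ : ∃ w, (τ i).asAlgebraHom x w ≠ 0 := by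
    by_contra! h
    exact hi (LinearMap.ext h)
  refine ⟨d i, τ i, _, hirr i, hw, fun n => ?_⟩
  simp only [x, map_sum, LinearMap.sum_apply, Representation.asAlgebraHom_single,
    LinearMap.smul_apply, Finset.smul_sum]
  rw [← Equiv.sum_comp (Equiv.mulLeft n) (fun m : N => lam n • lam m⁻¹ • τ i m w)]
  refine Finset.sum_congr rfl fun m _ => ?_
  rw [map_smul, smul_smul, Equiv.coe_mulLeft, mul_inv_rev, map_mul lam, mul_comm (lam m⁻¹), ← mul_assoc,
    ← map_mul lam, mul_inv_cancel, map_one, one_mul, Subgroup.coe_mul, map_mul]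
  rfl

/-- Written with `1⁻¹` to match `idempotentCoeff` at the identity, which is therefore 1 for the set
of all irreducible characters. -/
theorem finsum_Irr_degree_sq (K : Type*) [Group K] [Finite K] :
    ∑ᶠ χ ∈ Irr K, χ 1 * χ 1⁻¹ = (Nat.card K : ℂ) := by
  have := Fintype.ofFinite K
  obtain ⟨n, d, τ, hirr, hfaith, hex, hsum⟩ := exists_wedderburn K
  -- An element acting as the identity in `τ i` and as zero in `τ j` separates the two traces.
  have hinj : Function.Injective fun i => (τ i).character := fun i j hij => by
    by_contra hne
    obtain ⟨x, hx, hx'⟩ := hex i 1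
    have h1 := trace_asAlgebraHom (τ i) x
    have h2 := trace_asAlgebraHom (τ j) x
    simp only at hij
    rw [hx' j (Ne.symm hne), map_zero, ← hij, ← h1, hx, LinearMap.trace_one] at h2
    have := ((isIrreducible_iff _).1 (hirr i)).1
    exact (Nat.cast_ne_zero (R := ℂ)).2 (finrank_pos (R := ℂ) (M := Fin (d i) → ℂ)).ne' h2.symm
  have hrange : Irr K = Set.range fun i => (τ i).character := by
    ext χ
    constructor
    · rintro ⟨m, σ, hσ, rfl⟩
      obtain ⟨i, ⟨e⟩⟩ := exists_equiv_of_faithful τ hirr hfaith σ hσ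
      exact ⟨i, Representation.char_iso e⟩
    · rintro ⟨i, rfl⟩
      exact ⟨_, τ i, hirr i, rfl⟩
  rw [hrange, finsum_mem_range hinj, finsum_eq_sum_of_fintype, ← hsum]
  push_cast
  refine Finset.sum_congr rfl fun i _ => ?_
  rw [inv_one, Representation.char_one, finrank_fin_fun, sq]

end Wedderburn
end BlockDegrees
end

/-! ### Clifford theory with weight spaces -/

noncomputable section
set_option linter.unusedSectionVars false
namespace BlockDegrees

open Module

section Clifford

variable {K V ι : Type*} [Group K] [AddCommGroup V] [Module ℂ V]

/-- The simultaneous eigenvectors, with eigenvalues `lam`, of a family of elements of `K`. -/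
def weightSpace (ρ : Representation ℂ K V) (j : ι → K) (lam : ι → ℂ) : Submodule ℂ V :=
  ⨅ i, End.eigenspace (ρ (j i)) (lam i)

theorem mem_weightSpace {ρ : Representation ℂ K V} {j : ι → K} {lam : ι → ℂ} {v : V} :
    v ∈ weightSpace ρ j lam ↔ ∀ i, ρ (j i) v = lam i • v := by
  simp [weightSpace, Submodule.mem_iInf]

theorem iSupIndep_weightSpace (ρ : Representation ℂ K V) (j : ι → K)
    (hcomm : ∀ i i', Commute (ρ (j i)) (ρ (j i'))) : iSupIndep (weightSpace ρ j) := by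
  refine (End.independent_iInf_maxGenEigenspace_of_forall_mapsTo (fun i => ρ (j i))
    fun i i' φ => End.mapsTo_maxGenEigenspace_of_comm (hcomm i' i) φ).mono fun lam => ?_
  exact iInf_mono fun i => (End.genEigenspace (ρ (j i)) (lam i)).monotone le_top

/-- On a minimal nonzero subspace invariant under the commuting family, every eigenspace of a member
is again invariant, so each member acts as a scalar. -/
theorem exists_weightSpace_ne_bot [FiniteDimensional ℂ V] [Nontrivial V]
    (ρ : Representation ℂ K V) (j : ι → K)
    (hcomm : ∀ i i', Commute (ρ (j i)) (ρ (j i'))) :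
    ∃ (lam : ι → ℂ) (v : V), v ≠ 0 ∧ ∀ i, ρ (j i) v = lam i • v := by
  obtain ⟨p, ⟨hp, hp0⟩, hmin⟩ := WellFounded.has_min (wellFounded_lt (α := Submodule ℂ V))
    {p | (∀ i, ∀ v ∈ p, ρ (j i) v ∈ p) ∧ p ≠ ⊥} ⟨⊤, by simp, top_ne_bot⟩
  have key : ∀ i, ∃ z : ℂ, ∀ v ∈ p, ρ (j i) v = z • v := fun i => by
    have : Nontrivial p := Submodule.nontrivial_iff_ne_bot.2 hp0
    obtain ⟨z, hz⟩ := End.exists_eigenvalue ((ρ (j i)).restrict (hp i))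
    obtain ⟨w, hw⟩ := hz.exists_hasEigenvector
    have hw1 : ρ (j i) w = z • (w : V) := congrArg Subtype.val hw.apply_eq_smul
    refine ⟨z, fun v hv => ?_⟩
    have h1 : ¬ (p ⊓ End.eigenspace (ρ (j i)) z < p) := hmin _ ⟨fun i' v hv => ⟨hp i' v hv.1, by
      have hv2 := End.mem_eigenspace_iff.1 hv.2
      rw [SetLike.mem_coe, End.mem_eigenspace_iff, ← Module.End.mul_apply, hcomm i i', Module.End.mul_apply,
        hv2, map_smul]⟩, fun h => by
      have : (w : V) ∈ p ⊓ End.eigenspace (ρ (j i)) z := ⟨w.2, End.mem_eigenspace_iff.2 hw1⟩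
      rw [h, Submodule.mem_bot, Submodule.coe_eq_zero] at this
      exact hw.2 this⟩
    have h2 : p ⊓ End.eigenspace (ρ (j i)) z = p := by
      by_contra h
      exact h1 (lt_of_le_of_ne inf_le_left h)
    rw [← h2] at hv
    exact End.mem_eigenspace_iff.1 hv.2
  choose lam hlam using key
  obtain ⟨v, hv, hv0⟩ := p.ne_bot_iff.1 hp0
  exact ⟨lam, v, hv0, fun i => hlam i v hv⟩

theorem apply_mem_weightSpace (ρ : Representation ℂ K V) (j : ι → K) (c : K → ι → ι)
    (hc : ∀ k i, k * j i * k⁻¹ = j (c k i)) (lam : ι → ℂ) (k : K) {v : V}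
    (hv : v ∈ weightSpace ρ j lam) : ρ k v ∈ weightSpace ρ j fun i => lam (c k⁻¹ i) := by
  rw [mem_weightSpace] at hv ⊢
  intro i
  rw [← map_smul, ← hv, ← hc, ← Module.End.mul_apply, ← Module.End.mul_apply, ← map_mul, ← map_mul]
  group

/-- The counting part of Clifford theory: a nonzero submodule of a weight space that is invariant
under the stabilizer of the weight. -/
theorem finrank_eq_index_mul_finrank [Finite K] [FiniteDimensional ℂ V] (ρ : Representation ℂ K V)
    (hρ : ρ.IsIrreducible) (j : ι → K) (hcomm : ∀ i i', Commute (ρ (j i)) (ρ (j i')))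
    (c : K → ι → ι) (hc : ∀ k i, k * j i * k⁻¹ = j (c k i)) (hcmul : ∀ k l i, c (k * l) i = c k (c l i)) 
    (hc1 : ∀ i, c 1 i = i)
    (lam : ι → ℂ) (S : Subgroup K)
    (hS : ∀ s, (∀ i, lam (c s i) = lam i) → s ∈ S) (X : Submodule ℂ V) (hX0 : X ≠ ⊥)
    (hX : X ≤ weightSpace ρ j lam) (hXS : ∀ s ∈ S, ∀ v ∈ X, ρ s v ∈ X) :
    finrank ℂ V = S.index * finrank ℂ X := by
  classical
  have := Fintype.ofFinite (K ⧸ S)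
  let Y : K ⧸ S → Submodule ℂ V := fun q => X.map (ρ q.out)
  have hYle : ∀ q, Y q ≤ weightSpace ρ j fun i => lam (c q.out⁻¹ i) := by
    rintro q _ ⟨v, hv, rfl⟩
    exact apply_mem_weightSpace ρ j c hc lam _ (hX hv)
  -- Different cosets give different translated weights, so the translates of `X` are independent.
  -- Their sum is invariant, hence all of `V`, and counting dimensions gives the formula.
  have hwt : Function.Injective fun (q : K ⧸ S) i => lam (c q.out⁻¹ i) := fun q q' h => by
    rw [← Quotient.out_eq' q, ← Quotient.out_eq' q']
    refine QuotientGroup.eq.2 (hS _ fun i => ?_)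
    have := congrFun h (c q'.out i)
    simp only [← hcmul] at this
    rw [this, inv_mul_cancel, hc1]
  have hind : iSupIndep Y := ((iSupIndep_weightSpace ρ j hcomm).comp hwt).mono hYle
  have hYmem : ∀ k : K, ∀ v ∈ X, ρ k v ∈ Y (k : K ⧸ S) := fun k v hv => by
    obtain ⟨s, hs⟩ := QuotientGroup.mk_out_eq_mul S k
    refine ⟨ρ (s : K)⁻¹ v, hXS _ (S.inv_mem s.2) v hv, ?_⟩
    rw [hs, ← Module.End.mul_apply, ← map_mul, mul_inv_cancel_right]
  have htop : ⨆ q, Y q = ⊤ := by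
    refine (((isIrreducible_iff ρ).1 hρ).2 _ fun g v hv => ?_).resolve_left fun h => hX0 ?_
    · induction hv using Submodule.iSup_induction' with
      | mem q v hv =>
        obtain ⟨w, hw, rfl⟩ := hv
        rw [← Module.End.mul_apply, ← map_mul]
        exact Submodule.mem_iSup_of_mem _ (hYmem _ w hw)
      | zero => simp
      | add x y _ _ hx hy => rw [map_add]; exact Submodule.add_mem _ hx hy
    · rw [eq_bot_iff, ← h]
      intro v hv
      have := hYmem 1 v hv
      rw [map_one, Module.End.one_apply] at this
      exact Submodule.mem_iSup_of_mem _ this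
  have hint := DirectSum.isInternal_submodule_of_iSupIndep_of_iSup_eq_top hind htop
  have h1 := (LinearEquiv.ofBijective (DirectSum.coeLinearMap Y) hint).finrank_eq
  rw [← h1, finrank_directSum]
  have h2 : ∀ q, finrank ℂ (Y q) = finrank ℂ X := fun q =>
    (Submodule.equivMapOfInjective (ρ q.out) (Representation.apply_bijective ρ _).1 X).finrank_eq.symm
  simp [h2, Subgroup.index, Nat.card_eq_fintype_card]

/-- Clifford correspondence: the weight space is an irreducible representation of the stabilizer of
the weight. -/
theorem exists_isIrreducible_stabilizer [Finite K] [FiniteDimensional ℂ V] (ρ : Representation ℂ K V)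
    (hρ : ρ.IsIrreducible) (j : ι → K) (hcomm : ∀ i i', Commute (ρ (j i)) (ρ (j i')))
    (c : K → ι → ι) (hc : ∀ k i, k * j i * k⁻¹ = j (c k i)) (hcmul : ∀ k l i, c (k * l) i = c k (c l i))
    (hc1 : ∀ i, c 1 i = i) (lam : ι → ℂ) (S : Subgroup K)
    (hS : ∀ s, s ∈ S ↔ ∀ i, lam (c s i) = lam i) {v : V} (hv0 : v ≠ 0)
    (hv : ∀ i, ρ (j i) v = lam i • v) :
    ∃ (X : Submodule ℂ V) (σ : Representation ℂ S X), σ.IsIrreducible ∧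
      (∀ s x, (σ s x : V) = ρ s x) ∧ (∀ i, ∀ x ∈ X, ρ (j i) x = lam i • x) ∧
      finrank ℂ V = S.index * finrank ℂ X := by
  set X := weightSpace ρ j lam with hXdef
  have hX0 : X ≠ ⊥ := fun h => hv0 (by
    rw [← Submodule.mem_bot ℂ, ← h, hXdef, mem_weightSpace]; exact hv)
  have hXS : ∀ s : S, ∀ v ∈ X, (ρ.comp S.subtype : Representation ℂ S V) s v ∈ X := fun s v hv => by
    have := apply_mem_weightSpace ρ j c hc lam s hv
    have h2 : (fun i => lam (c (s : K)⁻¹ i)) = lam := funext ((hS _).1 (S.inv_mem s.2))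
    rwa [h2] at this
  have hdim := fun (p : Submodule ℂ V) (hp0 : p ≠ ⊥) (hpX : p ≤ X)
    (hpS : ∀ s ∈ S, ∀ v ∈ p, ρ s v ∈ p) =>
    finrank_eq_index_mul_finrank ρ hρ j hcomm c hc hcmul hc1 lam S (fun s => (hS s).2) p hp0 hpX hpS
  refine ⟨X, subRep _ X hXS, subRep_isIrreducible _ X hXS hX0 fun q hqX hq hq0 => ?_,
    fun s x => rfl, fun i x hx => mem_weightSpace.1 hx i, hdim X hX0 le_rfl fun s hs => hXS ⟨s, hs⟩⟩
  -- The dimension formula holds for the weight space and for any nonzero invariant subspace `q` of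
  -- it, so the two have equal dimension.
  have h1 := hdim X hX0 le_rfl fun s hs => hXS ⟨s, hs⟩
  rw [hdim q hq0 hqX fun s hs => hq ⟨s, hs⟩] at h1
  exact Submodule.eq_of_le_of_finrank_eq hqX
    (Nat.eq_of_mul_eq_mul_left (Nat.pos_of_ne_zero S.index_ne_zero_of_finite) h1)

end Clifford
end BlockDegrees
end

/-! ### Nilpotency of reduced class sums modulo p -/

noncomputable section
set_option linter.unusedSectionVars false
namespace BlockDegrees

open Module

section Blocks

/-- A sum over a set with fixed-point-free action of a `p`-group, of an invariant function with
values in a group of exponent `p`. -/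
theorem sum_eq_zero_of_fixedPoints_eq_empty {p : ℕ} [Fact p.Prime] {N α A : Type*} [Group N]
    [Finite N] (hN : IsPGroup p N) [MulAction N α] [Fintype α] [AddCommGroup A]
    (hA : ∀ a : A, p • a = 0) (F : α → A) (hF : ∀ (n : N) x, F (n • x) = F x)
    (hfix : ∀ x : α, ∃ n : N, n • x ≠ x) : ∑ x, F x = 0 := by
  classical
  have h := Finset.sum_comp (s := (Finset.univ : Finset α)) (fun a : A => a) F
  rw [h]
  refine Finset.sum_eq_zero fun y _ => ?_
  -- Each fibre of `F` is stable without fixed points, so its size is a multiple of p and its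
  -- contribution vanishes.
  let T : SubMulAction N α := ⟨{x | F x = y}, fun n x hx => (hF n x).trans hx⟩
  have h1 := hN.card_modEq_card_fixedPoints T
  have h2 : Nat.card (MulAction.fixedPoints N T) = 0 := by
    rw [Nat.card_eq_zero]
    left
    refine ⟨fun ⟨x, hx⟩ => ?_⟩
    obtain ⟨n, hn⟩ := hfix x
    exact hn (congrArg Subtype.val (hx n))
  rw [h2] at h1
  obtain ⟨k, hk⟩ := (Nat.modEq_zero_iff_dvd).1 h1
  have h3 : (Finset.univ.filter fun a => F a = y).card = Nat.card T := by
    rw [← Fintype.card_subtype, Nat.card_eq_fintype_card]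
    rfl
  rw [h3, hk, mul_comm, mul_smul, hA, smul_zero]

variable {K : Type*} [Group K] [Finite K]

/-- The central element `∑ x ∈ C, x - |C|` of `ℤK`, for the conjugacy class `C` of `g`. -/
def reducedClassSum (R : Type*) [CommRing R] (g : K) : MonoidAlgebra R K :=
  ∑ᶠ x : {x : K // IsConj g x}, (MonoidAlgebra.single (x : K) 1 - 1)

theorem reducedClassSum_eq [Fintype K] [DecidableEq K] (R : Type*) [CommRing R] (g : K) 
    [Fintype {x : K // IsConj g x}] :
    reducedClassSum R g = ∑ x : {x : K // IsConj g x}, (MonoidAlgebra.single (x : K) 1 - 1) :=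
  finsum_eq_sum_of_fintype _

theorem single_mul_reducedClassSum (R : Type*) [CommRing R] (g h : K) :
    MonoidAlgebra.single h 1 * reducedClassSum R g =
      reducedClassSum R g * MonoidAlgebra.single h 1 := by
  classical
  have := Fintype.ofFinite K
  have := Fintype.ofFinite {x : K // IsConj g x}
  let e : {x : K // IsConj g x} ≃ {x : K // IsConj g x} :=
    (MulAut.conj h).toEquiv.subtypeEquiv fun x => by
      refine ⟨fun hx => hx.trans (isConj_iff.2 ⟨h, rfl⟩), fun hx => hx.trans (isConj_iff.2 ⟨h⁻¹, ?_⟩)⟩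
      simp [mul_assoc]
  rw [reducedClassSum_eq, Finset.mul_sum, Finset.sum_mul, ← Equiv.sum_comp e (fun x => (MonoidAlgebra.single (x : K) 1 - 1) * MonoidAlgebra.single h (1 : R))]
  refine Finset.sum_congr rfl fun x _ => ?_
  simp [e, mul_sub, sub_mul, MonoidAlgebra.single_mul_single]

/-- The elements fixed by a normal self-centralizing `p`-subgroup are killed by `∑ x ∈ C, x - |C|`
modulo `p`. -/
theorem reducedClassSum_mul_eq_zero {p : ℕ} [Fact p.Prime] (N : Subgroup K) [N.Normal]
    (hN : IsPGroup p N) (hC : Subgroup.centralizer (N : Set K) ≤ N) (g : K)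
    (m : MonoidAlgebra (ZMod p) K) (hm : ∀ n : N, MonoidAlgebra.single (n : K) 1 * m = m) :
    reducedClassSum (ZMod p) g * m = 0 := by
  classical
  have := Fintype.ofFinite K
  have := Fintype.ofFinite {x : K // IsConj g x}
  have hexp : ∀ a : MonoidAlgebra (ZMod p) K, p • a = 0 := fun a => by
    rw [← Nat.cast_smul_eq_nsmul (ZMod p), ZMod.natCast_self, zero_smul]
  rw [reducedClassSum_eq, Finset.sum_mul]
  by_cases hg : g ∈ N
  -- If `g` lies in `N`, so does its whole class, and every single term x - 1 kills `m`.
  · refine Finset.sum_eq_zero fun x _ => ?_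
    obtain ⟨k, hk⟩ := isConj_iff.1 x.2
    have hx : (x : K) ∈ N := hk ▸ Subgroup.Normal.conj_mem inferInstance g hg k
    rw [sub_mul, hm ⟨x, hx⟩, one_mul, sub_self]
  · let act : MulAction N {x : K // IsConj g x} :=
      { smul := fun n x => ⟨n * x * (n : K)⁻¹, x.2.trans (isConj_iff.2 ⟨n, rfl⟩)⟩
        one_smul := fun x => Subtype.ext (show ((1 : N) : K) * x * ((1 : N) : K)⁻¹ = x by simp)
        mul_smul := fun a b x => Subtype.ext
          (show ((a * b : N) : K) * x * ((a * b : N) : K)⁻¹ =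
            a * (b * x * (b : K)⁻¹) * (a : K)⁻¹ by simp [mul_assoc]) }
    have hact : ∀ (n : N) (x : {x : K // IsConj g x}), ((n • x : {x : K // IsConj g x}) : K) =
      n * x * (n : K)⁻¹ := fun n x => rfl
    -- Here `N` acts on the class by conjugation. The term (x - 1) m is constant on orbits because
    -- `m` is fixed by `N` and `N` is normal. A fixed point would centralize `N`, hence lie in `N`,
    -- and so would `g`.
    refine sum_eq_zero_of_fixedPoints_eq_empty hN hexp _ (fun n x => ?_) fun x => ?_
    · rw [sub_mul, sub_mul, hact]
      congr 1
      have h1 : ((x : K)⁻¹ * n * x) ∈ N := by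
        simpa using Subgroup.Normal.conj_mem (H := N) inferInstance n n.2 (x : K)⁻¹
      have h2 : (n : K) * x * (n : K)⁻¹ = x * ((x : K)⁻¹ * n * x) * (n : K)⁻¹ := by group
      rw [h2, ← one_mul (1 : ZMod p), ← MonoidAlgebra.single_mul_single, one_mul (1 : ZMod p),
        mul_assoc, ← Subgroup.coe_inv, hm, ← one_mul (1 : ZMod p), ← MonoidAlgebra.single_mul_single,
        one_mul (1 : ZMod p), mul_assoc, hm ⟨_, h1⟩]
    · by_contra! hx
      refine hg ?_
      have hxN : (x : K) ∈ N := hC (Subgroup.mem_centralizer_iff.2 fun n hn => by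
        have := congrArg Subtype.val (hx ⟨n, hn⟩)
        rw [hact] at this
        exact mul_inv_eq_iff_eq_mul.1 this)
      obtain ⟨k, hk⟩ := isConj_iff.1 x.2
      have := Subgroup.Normal.conj_mem (H := N) inferInstance _ hxN k⁻¹
      rw [← hk] at this
      simpa [mul_assoc] using this

/-- The powers of the element Z in question repeat, since the group algebra over `ZMod p` is finite.
If Z were not nilpotent, the elements fixed by a suitable power Z^d would form a nonzero p-group on
which `N` acts. It would contain a nonzero point fixed by `N`; but such points are killed by Z. -/
theorem reducedClassSum_pow_eq_zero {p : ℕ} [Fact p.Prime] (N : Subgroup K) [N.Normal]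
    (hN : IsPGroup p N) (hC : Subgroup.centralizer (N : Set K) ≤ N) (g : K) :
    ∃ n, reducedClassSum (ZMod p) g ^ n = 0 := by
  set Z := reducedClassSum (ZMod p) g with hZdef
  have hfin : Finite (MonoidAlgebra (ZMod p) K) :=
    Finite.of_injective (fun x g => x.coeff g) fun x y h => by ext g; exact congrFun h g
  have hexp : ∀ a : MonoidAlgebra (ZMod p) K, p • a = 0 := fun a => by
    rw [← Nat.cast_smul_eq_nsmul (ZMod p), ZMod.natCast_self, zero_smul]
  obtain ⟨i, d, hd, hid⟩ : ∃ i d, 0 < d ∧ Z ^ (i + d) = Z ^ i := by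
    obtain ⟨i, j, hij, h⟩ := Finite.exists_ne_map_eq_of_infinite (fun n : ℕ => Z ^ n)
    rcases lt_or_gt_of_ne hij with h' | h'
    · exact ⟨i, j - i, by omega, by rw [show i + (j - i) = j by omega]; exact h.symm⟩
    · exact ⟨j, i - j, by omega, by rw [show j + (i - j) = i by omega]; exact h⟩
  refine ⟨i, ?_⟩
  by_contra hne
  let Mp : AddSubgroup (MonoidAlgebra (ZMod p) K) :=
    { carrier := {m | Z ^ d * m = m}
      zero_mem' := mul_zero _
      add_mem' := fun {a b} ha hb => by
        simp only [Set.mem_ofPred_eq] at ha hb ⊢; rw [mul_add, ha, hb]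
      neg_mem' := fun {a} ha => by simp only [Set.mem_ofPred_eq] at ha ⊢; rw [mul_neg, ha] }
  have hcomm : ∀ n : N, Commute (MonoidAlgebra.single (n : K) (1 : ZMod p)) (Z ^ d) := fun n =>
    Commute.pow_right (single_mul_reducedClassSum _ g n) d
  let act : MulAction N Mp :=
    { smul := fun n m => ⟨MonoidAlgebra.single (n : K) 1 * (m : MonoidAlgebra (ZMod p) K), by
        have hm : Z ^ d * (m : MonoidAlgebra (ZMod p) K) = m := m.2
        change Z ^ d * (_ * _) = _
        rw [← mul_assoc, ← (hcomm n).eq, mul_assoc, hm]⟩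
      one_smul := fun m => Subtype.ext (one_mul (m : MonoidAlgebra (ZMod p) K))
      mul_smul := fun a b m => Subtype.ext
        (show MonoidAlgebra.single ((a * b : N) : K) 1 * (m : MonoidAlgebra (ZMod p) K) =
          MonoidAlgebra.single (a : K) 1 * (MonoidAlgebra.single (b : K) 1 * (m : MonoidAlgebra (ZMod p) K)) by
          rw [← mul_assoc, MonoidAlgebra.single_mul_single, one_mul, Subgroup.coe_mul]) }
  have hdvd : p ∣ Nat.card Mp := by
    have hmem : Z ^ i ∈ Mp := by
      change Z ^ d * Z ^ i = Z ^ i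
      rw [← pow_add, add_comm, hid]
    have h1 : addOrderOf (⟨Z ^ i, hmem⟩ : Mp) = p := by
      refine addOrderOf_eq_prime (Subtype.ext (hexp _)) fun h => hne (congrArg Subtype.val h)
    have h2 := addOrderOf_dvd_natCard (⟨Z ^ i, hmem⟩ : Mp)
    rwa [h1] at h2
  obtain ⟨m, hm, hm0⟩ := hN.exists_fixed_point_of_prime_dvd_card_of_fixed_point Mp hdvd
    (a := 0) (fun n => Subtype.ext (mul_zero _))
  apply hm0
  have hZm := reducedClassSum_mul_eq_zero N hN hC g m fun n => congrArg Subtype.val (hm n)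
  have h1 : Z ^ d * (m : MonoidAlgebra (ZMod p) K) = m := m.2
  obtain ⟨d', rfl⟩ := Nat.exists_eq_succ_of_ne_zero hd.ne'
  rw [pow_succ, mul_assoc, hZm, mul_zero] at h1
  exact Subtype.ext h1

end Blocks
end BlockDegrees
end

/-! ### The principal block, defect groups and heights -/

noncomputable section
set_option linter.unusedSectionVars false
namespace BlockDegrees

open Module

section Blocks

variable {K V : Type*} [Group K] [Finite K] [AddCommGroup V] [Module ℂ V] [FiniteDimensional ℂ V]

theorem sum_conj_apply (ρ : Representation ℂ K V) [ρ.IsIrreducible] (g : K)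
    [Fintype {x : K // IsConj g x}] (v : V) :
    ∑ x : {x : K // IsConj g x}, ρ x v = centralChar ρ.character g • v := by
  classical
  have := Fintype.ofFinite K
  have h := sum_smul_apply_eq_of_class ρ (fun x => if IsConj g x then 1 else 0) (fun x h => by
    have : IsConj g (h * x * h⁻¹) ↔ IsConj g x :=
      ⟨fun hx => hx.trans (isConj_iff.2 ⟨h⁻¹, by group⟩), fun hx => hx.trans (isConj_iff.2 ⟨h, rfl⟩)⟩
    simp only [this]) v
  have hcl : ∀ x, IsConj g x → ρ.character x = ρ.character g := fun x hx => by
    obtain ⟨k, rfl⟩ := isConj_iff.1 hx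
    exact Representation.char_conj ρ g k
  have hcard : ({x : K | IsConj g x}.ncard : ℂ) = ∑ x : K, if IsConj g x then 1 else 0 := by
    rw [Finset.sum_boole, Set.ncard_eq_toFinset_card']
    congr 2
    ext x; simp
  have hsum : ∑ x, (if IsConj g x then (1 : ℂ) else 0) * ρ.character x =
      {x : K | IsConj g x}.ncard * ρ.character g := by
    rw [hcard, Finset.sum_mul]
    refine Finset.sum_congr rfl fun x _ => ?_
    split_ifs with hx
    · rw [hcl x hx]
    · simp
  rw [hsum] at h
  rw [centralChar, Representation.char_one, ← h]
  simp only [ite_smul, one_smul, zero_smul]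
  rw [← Finset.sum_filter]
  exact (Finset.sum_subtype _ (by simp) (fun x => ρ x v)).symm

theorem isZeroMod_of_mem {M : Ideal (integralClosure ℤ ℂ)} (hM : M.IsMaximal) {z : ℂ}
    (hz : IsIntegral ℤ z) (h : (⟨z, hz⟩ : integralClosure ℤ ℂ) ∈ M) : IsZeroMod M z :=
  ⟨_, 1, h, fun h1 => hM.ne_top ((Ideal.eq_top_iff_one M).2 h1), by simp⟩

theorem not_isZeroMod_one {M : Ideal (integralClosure ℤ ℂ)} : ¬ IsZeroMod M 1 := by
  rintro ⟨r, s, hr, hs, h⟩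
  rw [one_mul] at h
  exact hs (Subtype.ext h ▸ hr)

/-- If a normal `p`-subgroup of `K` contains its centralizer, then all irreducible characters of `K`
lie in the principal `p`-block. -/
theorem sameBlock_one_of_centralizer_le {p : ℕ} [Fact p.Prime] (N : Subgroup K) [N.Normal]
    (hN : IsPGroup p N) (hC : Subgroup.centralizer (N : Set K) ≤ N)
    {M : Ideal (integralClosure ℤ ℂ)} (hM : M.IsMaximal) (hp : (p : integralClosure ℤ ℂ) ∈ M)
    {ψ : K → ℂ} (hψ : ψ ∈ Irr K) : SameBlock M (fun _ => 1) ψ := by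
  classical
  have := Fintype.ofFinite K
  obtain ⟨d, ρ, hρ, rfl⟩ := hψ
  intro g
  have := Fintype.ofFinite {x : K // IsConj g x}
  obtain ⟨n, hn, hn0⟩ : ∃ n, reducedClassSum (ZMod p) g ^ n = 0 ∧ 0 < n := by
    obtain ⟨n, hn⟩ := reducedClassSum_pow_eq_zero (p := p) N hN hC g
    exact ⟨n + 1, by rw [pow_succ, hn, zero_mul], n.succ_pos⟩
  have hVne := ((isIrreducible_iff ρ).1 hρ).1
  have hp0 : (p : ℂ) ≠ 0 := by exact_mod_cast (Fact.out : p.Prime).ne_zero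
  set w : ℂ := centralChar ρ.character g - {x : K | IsConj g x}.ncard with hw
  -- the action of the class sum
  let Φ := MonoidAlgebra.lift ℤ (End ℂ (Fin d → ℂ)) K ρ
  have hΦ : Φ (reducedClassSum ℤ g) = algebraMap ℂ _ w := LinearMap.ext fun v => by
    rw [reducedClassSum_eq, map_sum, LinearMap.sum_apply, Module.algebraMap_end_apply, hw, sub_smul,
      ← sum_conj_apply ρ g v]
    simp only [Φ, map_sub, MonoidAlgebra.lift_single, one_smul, map_one, LinearMap.sub_apply,
      Module.End.one_apply, Finset.sum_sub_distrib, Finset.sum_const, Finset.card_univ]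
    rw [Nat.cast_smul_eq_nsmul, ← Nat.card_eq_fintype_card]
    rfl
  have hdvd : ∀ k, (p : ℤ) ∣ (reducedClassSum ℤ g ^ n).coeff k := fun k => by
    have h1 : MonoidAlgebra.mapRingHom K (Int.castRingHom (ZMod p)) (reducedClassSum ℤ g) =
        reducedClassSum (ZMod p) g := by
      rw [reducedClassSum_eq, reducedClassSum_eq, map_sum]
      simp
    have h2 : MonoidAlgebra.mapRingHom K (Int.castRingHom (ZMod p)) (reducedClassSum ℤ g ^ n) = 0 := by
      rw [map_pow, h1, hn]
    have h3 := congrArg (fun x => MonoidAlgebra.coeff x k) h2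
    rw [← ZMod.intCast_zmod_eq_zero_iff_dvd]
    simpa only [MonoidAlgebra.coeff_mapRingHom, eq_intCast, MonoidAlgebra.coeff_zero,
      Finsupp.zero_apply] using h3
  choose y hy using hdvd
  -- The n-th power of the reduced class sum over `ℤ` is p times an integral element, and it acts as
  -- w^n. Hence w^n lies in the ideal generated by p, so in `M`, and then so does w.
  have hint : IsIntegral ℤ (w ^ n / p) := by
    refine isIntegral_of_sum_smul_apply_eq_smul ρ y _ fun v => ?_
    have h1 := LinearMap.congr_fun (congrArg (fun f => f ^ n) hΦ) v
    simp only [← map_pow, Module.algebraMap_end_apply] at h1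
    have h2 : Φ (reducedClassSum ℤ g ^ n) v =
        (p : ℂ) • ∑ k, algebraMap ℤ ℂ (y k) • ρ k v := by
      rw [MonoidAlgebra.lift_apply, Finsupp.sum_fintype _ _ (by simp), LinearMap.sum_apply,
        Finset.smul_sum]
      refine Finset.sum_congr rfl fun k _ => ?_
      rw [hy, LinearMap.smul_apply, ← Int.cast_smul_eq_zsmul ℂ, smul_smul]
      simp
    rw [div_eq_inv_mul, mul_smul, ← h1, h2, smul_smul, inv_mul_cancel₀ hp0, one_smul]
  have hwn : IsIntegral ℤ (w ^ n) := by
    have := hint.mul (isIntegral_algebraMap (R := ℤ) (A := ℂ) (x := (p : ℤ)))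
    simpa [div_mul_cancel₀ _ hp0] using this
  have hwint : IsIntegral ℤ w := IsIntegral.of_pow hn0 hwn
  have hmem : (⟨w, hwint⟩ : integralClosure ℤ ℂ) ∈ M := by
    refine hM.isPrime.mem_of_pow_mem n ?_
    have : (⟨w, hwint⟩ : integralClosure ℤ ℂ) ^ n = ⟨w ^ n / p, hint⟩ * p :=
      Subtype.ext (by simp [div_mul_cancel₀ _ hp0])
    rw [this]
    exact M.mul_mem_left _ hp
  have heq : centralChar (fun _ => 1) g - centralChar ρ.character g = -w := by
    simp [centralChar, hw]
  rw [heq]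
  exact isZeroMod_of_mem hM hwint.neg (M.neg_mem hmem)

theorem one_mem_Irr (K : Type*) [Group K] : (fun _ => 1) ∈ Irr K := by
  have h : (Representation.trivial ℂ K ℂ).IsIrreducible := by
    rw [isIrreducible_iff]
    exact ⟨inferInstance, fun p _ => eq_bot_or_eq_top p⟩
  have h2 := character_mem_Irr _ h
  have h3 : (Representation.trivial ℂ K ℂ).character = fun _ => 1 := by
    ext g
    have : Representation.trivial ℂ K ℂ g = 1 := LinearMap.ext fun v => rfl
    rw [Representation.character, this, LinearMap.trace_one, finrank_self, Nat.cast_one]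
  rwa [h3] at h2

theorem isBlock_principalBlock (K : Type*) [Group K] (M : Ideal (integralClosure ℤ ℂ)) :
    IsBlock M (principalBlock K M) :=
  ⟨_, one_mem_Irr K, rfl⟩

theorem Irr_eq_principalBlock_of_centralizer_le {p : ℕ} [Fact p.Prime] (N : Subgroup K) [N.Normal]
    (hN : IsPGroup p N) (hC : Subgroup.centralizer (N : Set K) ≤ N)
    {M : Ideal (integralClosure ℤ ℂ)} (hM : M.IsMaximal) (hp : (p : integralClosure ℤ ℂ) ∈ M) :
    Irr K = principalBlock K M :=
  Set.Subset.antisymm (fun _ hψ => ⟨hψ, sameBlock_one_of_centralizer_le N hN hC hM hp hψ⟩)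
    fun _ hψ => hψ.1

/-- If there is only one block, then its defect groups include the Sylow subgroups. -/
theorem isDefectGroup_Irr {p : ℕ} (M : Ideal (integralClosure ℤ ℂ))
    (P : Sylow p K) : IsDefectGroup p M (Irr K) (P : Subgroup K) := by
  refine ⟨1, ⟨_, one_mem_Irr K, ?_⟩, ?_, ?_⟩
  · have : centralChar (fun _ : K => (1 : ℂ)) 1 = 1 := by
      simp [centralChar]
    rw [this]
    exact not_isZeroMod_one
  · have : idempotentCoeff (Irr K) (1 : K) = 1 := by
      rw [idempotentCoeff, finsum_Irr_degree_sq, div_self]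
      exact_mod_cast Nat.card_pos.ne'
    rw [this]
    exact not_isZeroMod_one
  · have hle : (P : Subgroup K) ≤ Subgroup.centralizer {1} := fun x _ => by
      simp [Subgroup.mem_centralizer_iff]
    refine ⟨P.subtype hle, ?_⟩
    rw [Sylow.coe_subtype, Subgroup.subgroupOf_map_subtype, inf_eq_left.2 hle]

/-- A degree 1 makes the smallest p-part trivial, so heights are just p-adic valuations of degrees.
-/
theorem heights_eq_image {p : ℕ} {B : Set (K → ℂ)} (h1 : 1 ∈ cd B) :
    heights p B = padicValNat p '' cd B := by
  have hl : ∀ m, IsLeast (padicValNat p '' cd B) m ↔ m = 0 := fun m =>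
    ⟨fun h => Nat.le_zero.1 (h.2 ⟨1, h1, by simp⟩), fun h => h ▸ ⟨⟨1, h1, by simp⟩, fun _ _ => Nat.zero_le _⟩⟩
  ext h
  simp only [heights, hl, Set.mem_ofPred_eq, Set.mem_image]
  simp


end Blocks
end BlockDegrees
end

/-! ### Trace characters and norm-one elements of the field of order p^p -/

noncomputable section
set_option linter.unusedSectionVars false
namespace BlockDegrees

open Module

section FieldFacts

variable (p : ℕ) [Fact p.Prime] (F : Type*) [Field F] [Finite F] [Algebra (ZMod p) F]

/-- The additive character `z ↦ exp (2πi Tr(z) / p)` of a finite field of characteristic `p`. -/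
def traceChar : AddChar F ℂ :=
  (ZMod.stdAddChar (N := p)).compAddMonoidHom (Algebra.trace (ZMod p) F).toAddMonoidHom

/-- The elements of norm one. -/
def normOne : Subgroup Fˣ := (Units.map (Algebra.norm (ZMod p) : F →* ZMod p)).ker

variable {p F}

theorem traceChar_apply (z : F) :
    traceChar p F z = ZMod.stdAddChar (Algebra.trace (ZMod p) F z) := rfl

theorem mem_normOne {t : Fˣ} : t ∈ normOne p F ↔ Algebra.norm (ZMod p) (t : F) = 1 := by
  rw [normOne, MonoidHom.mem_ker, Units.ext_iff]
  rfl

theorem traceChar_algEquiv (τ : F ≃ₐ[ZMod p] F) (z : F) :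
    traceChar p F (τ z) = traceChar p F z := by
  rw [traceChar_apply, traceChar_apply, Algebra.trace_eq_of_algEquiv]

theorem traceChar_pow (z : F) : traceChar p F (z ^ p) = traceChar p F z := by
  have := traceChar_algEquiv (FiniteField.frobeniusAlgEquivOfAlgebraic (ZMod p) F) z
  rwa [FiniteField.frobeniusAlgEquivOfAlgebraic_apply, ZMod.card] at this

theorem traceChar_isPrimitive : (traceChar p F).IsPrimitive := by
  refine AddChar.IsPrimitive.of_ne_one ?_
  obtain ⟨z, hz⟩ := Algebra.trace_surjective (ZMod p) F 1
  rw [AddChar.ne_one_iff]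
  refine ⟨z, ?_⟩
  rw [traceChar_apply, hz]
  intro h
  rw [← AddChar.map_zero_eq_one (ZMod.stdAddChar (N := p))] at h
  exact one_ne_zero (ZMod.injective_stdAddChar h)

theorem traceChar_mul_injective {c c' : F}
    (h : ∀ z, traceChar p F (c * z) = traceChar p F (c' * z)) : c = c' :=
  AddChar.to_mulShift_inj_of_isPrimitive (traceChar_isPrimitive (p := p) (F := F))
    (AddChar.ext _ _ fun z => by simpa using h z)

theorem eq_zero_of_traceChar_mul {c : F} (h : ∀ z, traceChar p F (c * z) = 1) : c = 0 :=
  traceChar_mul_injective (p := p) fun z => by rw [h, zero_mul, AddChar.map_zero_eq_one]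

/-- Primitivity makes c ↦ `traceChar` (c ·) injective, and a finite field has as many additive
characters as elements. -/
theorem exists_eq_traceChar_mul (χ : AddChar F ℂ) : ∃ c, ∀ z, χ z = traceChar p F (c * z) := by
  have := Fintype.ofFinite F
  have h := (Fintype.bijective_iff_injective_and_card (traceChar p F).mulShift).2
    ⟨AddChar.to_mulShift_inj_of_isPrimitive traceChar_isPrimitive, AddChar.card_eq.symm⟩
  obtain ⟨c, hc⟩ := h.2 χ
  exact ⟨c, fun z => by rw [← hc]; rfl⟩

theorem mem_range_of_forall_fixed {c : F} (h : ∀ τ : F ≃ₐ[ZMod p] F, τ c = c) :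
    ∃ n : ZMod p, algebraMap (ZMod p) F n = c :=
  (IsGalois.mem_range_algebraMap_iff_fixed c).2 h

theorem norm_algEquiv_mem (τ : F ≃ₐ[ZMod p] F) {t : Fˣ} (ht : t ∈ normOne p F) :
    Units.map (τ : F →* F) t ∈ normOne p F := by
  rw [mem_normOne] at ht ⊢
  rw [← ht]
  exact Algebra.norm_eq_of_algEquiv τ (t : F)

variable (hF : finrank (ZMod p) F = p)
include hF

theorem card_field : Nat.card F = p ^ p := by
  rw [natCard_eq_pow_finrank (K := ZMod p), hF, Nat.card_zmod]

theorem card_algEquiv : Nat.card (F ≃ₐ[ZMod p] F) = p := by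
  rw [IsGalois.card_aut_eq_finrank, hF]

theorem norm_algebraMap_eq (n : ZMod p) : Algebra.norm (ZMod p) (algebraMap (ZMod p) F n) = n := by
  rw [Algebra.norm_algebraMap, hF, ZMod.pow_card]

theorem card_normOne_mul : Nat.card (normOne p F) * (p - 1) = p ^ p - 1 := by
  have h := (normOne p F).card_mul_index
  rw [normOne, Subgroup.index_ker, MonoidHom.range_eq_top.2
    (FiniteField.unitsMap_norm_surjective (ZMod p) F), Subgroup.card_top,
    Nat.card_units, Nat.card_units, card_field hF, Nat.card_zmod] at h
  exact h

theorem card_normOne : Nat.card (normOne p F) = ∑ i ∈ Finset.range p, p ^ i := by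
  have hp := (Fact.out : p.Prime).two_le
  rw [Nat.geomSum_eq hp, ← card_normOne_mul hF, Nat.mul_div_cancel _ (by omega)]

theorem card_normOne_modEq : Nat.card (normOne p F) ≡ 1 [MOD p] := by
  have hp := (Fact.out : p.Prime).pos
  rw [card_normOne hF, ← Nat.sub_add_cancel hp, Finset.sum_range_succ']
  simp only [pow_succ, ← Finset.sum_mul, pow_zero, Nat.sub_add_cancel hp]
  exact (Nat.modEq_iff_dvd' (by omega)).2 (by simp) |>.symm

theorem card_normOne_coprime_self : (Nat.card (normOne p F)).Coprime p := by
  rw [Nat.Coprime, (card_normOne_modEq hF).gcd_eq, Nat.gcd_one_left]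

/-- Modulo p - 1 each of the p terms of 1 + p + ... + p^(p-1) is 1, so the order is congruent to p,
hence to 1. It follows that no nontrivial linear character of the norm-one group is invariant under
Frobenius. -/
theorem card_normOne_coprime_pred : (Nat.card (normOne p F)).Coprime (p - 1) := by
  have hp := (Fact.out : p.Prime).two_le
  have h1 : Nat.card (normOne p F) ≡ p [MOD (p - 1)] := by
    have h2 : ∀ n, ∑ i ∈ Finset.range n, p ^ i ≡ n [MOD (p - 1)] := fun n => by
      induction n with
      | zero => rfl
      | succ n ih =>
        rw [Finset.sum_range_succ]
        refine ih.add ?_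
        have h3 : p ≡ 1 [MOD (p - 1)] := ((Nat.modEq_iff_dvd' (by omega)).2 dvd_rfl).symm
        simpa using h3.pow n
    rw [card_normOne hF]
    exact h2 p
  rw [Nat.Coprime, h1.gcd_eq]
  have := Nat.coprime_self_sub_right (m := 1) (n := p) (by omega)
  simpa using this

/-- Modulo p + 1 the terms of 1 + p + ... + p^(p-1) alternate between 1 and -1, and their number p
is odd. So t ↦ t^(p+1), the action on the centre, is a bijection of the norm-one group. -/
theorem card_normOne_coprime_succ (hp2 : p ≠ 2) : (Nat.card (normOne p F)).Coprime (p + 1) := by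
  have h2 : ∀ k, ∑ i ∈ Finset.range (2 * k + 1), p ^ i ≡ 1 [MOD (p + 1)] := fun k => by
    induction k with
    | zero => simp [Nat.ModEq.refl]
    | succ k ih =>
      rw [show 2 * (k + 1) + 1 = (2 * k + 1) + 1 + 1 by ring, Finset.sum_range_succ,
        Finset.sum_range_succ, add_assoc]
      have : p ^ (2 * k + 1) + p ^ (2 * k + 1 + 1) ≡ 0 [MOD (p + 1)] :=
        Nat.modEq_zero_iff_dvd.2 ⟨p ^ (2 * k + 1), by ring⟩
      simpa using ih.add this
  obtain ⟨k, hk⟩ := (Fact.out : p.Prime).odd_of_ne_two hp2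
  have h3 := h2 k
  rw [← hk, ← card_normOne hF] at h3
  rw [Nat.Coprime, h3.gcd_eq, Nat.gcd_one_left]

theorem eq_one_of_pow_succ_eq_one (hp2 : p ≠ 2) {t : Fˣ} (ht : t ∈ normOne p F)
    (h : (t : F) ^ (p + 1) = 1) : t = 1 := by
  have h1 : (⟨t, ht⟩ : normOne p F) ^ (p + 1) = 1 := by
    ext; simpa using h
  have h2 := (powCoprime (card_normOne_coprime_succ hF hp2)).injective
    (a₁ := ⟨t, ht⟩) (a₂ := 1) (by simpa using h1)
  exact congrArg Subtype.val h2

/-- Take t = N(c) / c. Because the degree of the extension is p, a scalar n of the prime field has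
norm n^p = n, so t has norm one. Thus the units of `F` are prime-field units times norm-one
elements. -/
theorem exists_mul_eq_algebraMap {c : F} (hc : c ≠ 0) :
    ∃ t ∈ normOne p F, ∃ n : ZMod p, n ≠ 0 ∧ c * t = algebraMap (ZMod p) F n := by
  have hn : Algebra.norm (ZMod p) c ≠ 0 := by
    rwa [Ne, Algebra.norm_eq_zero_iff]
  have hn' : algebraMap (ZMod p) F (Algebra.norm (ZMod p) c) ≠ 0 := by
    rwa [Ne, map_eq_zero]
  refine ⟨Units.mk0 (algebraMap (ZMod p) F (Algebra.norm (ZMod p) c) * c⁻¹)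
    (mul_ne_zero hn' (inv_ne_zero hc)), ?_, _, hn, ?_⟩
  · rw [mem_normOne, Units.val_mk0, map_mul, norm_algebraMap_eq hF, ← map_mul, mul_inv_cancel₀ hc,
      map_one]
  · rw [Units.val_mk0]
    field_simp

theorem exists_mul_pow_eq_algebraMap (hp2 : p ≠ 2) {c : F} (hc : c ≠ 0) :
    ∃ t ∈ normOne p F, ∃ n : ZMod p, n ≠ 0 ∧ c * (t : F) ^ (p + 1) = algebraMap (ZMod p) F n := by
  obtain ⟨t, ht, n, hn, h⟩ := exists_mul_eq_algebraMap hF hc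
  obtain ⟨s, hs⟩ := (powCoprime (card_normOne_coprime_succ hF hp2)).surjective ⟨t, ht⟩
  refine ⟨s, s.2, n, hn, ?_⟩
  have h1 : ((s : Fˣ) : F) ^ (p + 1) = t := by
    have := congrArg (fun x : normOne p F => ((x : Fˣ) : F)) hs
    simpa using this
  rw [h1, h]

/-- An element outside the prime field is fixed only by the trivial automorphism. -/
theorem algEquiv_eq_one_of_apply_eq {c : F} (hc : c ∉ Set.range (algebraMap (ZMod p) F))
    {τ : F ≃ₐ[ZMod p] F} (h : τ c = c) : τ = 1 := by
  have : Fact (Nat.card (F ≃ₐ[ZMod p] F)).Prime := ⟨by rw [card_algEquiv hF]; exact Fact.out⟩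
  by_contra hτ
  refine hc (mem_range_of_forall_fixed fun σ => ?_)
  have h1 : σ ∈ Subgroup.zpowers τ := by
    rw [zpowers_eq_top_of_prime_card rfl hτ]
    trivial
  have h2 : Subgroup.zpowers τ ≤ MulAction.stabilizer (F ≃ₐ[ZMod p] F) c :=
    Subgroup.zpowers_le.2 h
  exact h2 h1

end FieldFacts
end BlockDegrees
end

/-! ### The group `Heis p F` and its semilinear automorphisms -/

noncomputable section
set_option linter.unusedSectionVars false
namespace BlockDegrees

open Module

/-- The group on `F × F`, for a field `F` of characteristic `p`, with multiplication
`(x, a) (y, b) = (x + y, a + b + x ^ p * y - x * y ^ p)`. -/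
@[ext] structure Heis (p : ℕ) (F : Type*) where
  /-- the component in the abelianization -/
  x : F
  /-- the component in the centre -/
  a : F

namespace Heis

variable {p : ℕ} [Fact p.Prime] {F : Type*} [Field F]

instance : Mul (Heis p F) := ⟨fun g h => ⟨g.x + h.x, g.a + h.a + (g.x ^ p * h.x - g.x * h.x ^ p)⟩⟩
instance : One (Heis p F) := ⟨⟨0, 0⟩⟩
instance : Inv (Heis p F) := ⟨fun g => ⟨-g.x, -g.a⟩⟩

@[simp] theorem mul_x (g h : Heis p F) : (g * h).x = g.x + h.x := rfl
@[simp] theorem mul_a (g h : Heis p F) :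
    (g * h).a = g.a + h.a + (g.x ^ p * h.x - g.x * h.x ^ p) := rfl
@[simp] theorem one_x : (1 : Heis p F).x = 0 := rfl
@[simp] theorem one_a : (1 : Heis p F).a = 0 := rfl
@[simp] theorem inv_x (g : Heis p F) : (g⁻¹).x = -g.x := rfl
@[simp] theorem inv_a (g : Heis p F) : (g⁻¹).a = -g.a := rfl

variable [CharP F p]

theorem neg_pow_prime (z : F) : (-z) ^ p = -z ^ p := by
  have := map_neg (frobenius F p) z
  simpa [frobenius_def] using this

instance : Group (Heis p F) :=
  have hp := (Fact.out : p.Prime).ne_zero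
  Group.ofLeftAxioms
    (fun g h k => by
      ext
      · simp [add_assoc]
      · simp only [mul_x, mul_a, add_pow_char]
        ring)
    (fun g => by ext <;> simp [hp])
    (fun g => by
      ext
      · simp
      · simp only [mul_a, inv_a, inv_x, neg_pow_prime, one_a]
        ring)

omit [Fact p.Prime] [Field F] [CharP F p] in
theorem card_eq : Nat.card (Heis p F) = Nat.card F * Nat.card F := by
  rw [← Nat.card_prod]
  exact Nat.card_congr ⟨fun g => (g.x, g.a), fun z => ⟨z.1, z.2⟩, fun _ => rfl, fun _ => rfl⟩

instance [Finite F] : Finite (Heis p F) :=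
  Finite.of_injective (fun g => (g.x, g.a)) fun g h e => by
    ext
    exacts [congrArg Prod.fst e, congrArg Prod.snd e]

theorem conj_eq (g h : Heis p F) :
    g * h * g⁻¹ = ⟨h.x, h.a + 2 * (g.x ^ p * h.x - g.x * h.x ^ p)⟩ := by
  ext
  · simp
  · simp only [mul_a, mul_x, inv_x, inv_a, neg_pow_prime, add_pow_char]
    ring

omit [CharP F p] in
theorem mk_zero_mul (a b : F) : (⟨0, a⟩ : Heis p F) * ⟨0, b⟩ = ⟨0, a + b⟩ := by
  ext <;> simp

theorem eq_mul_mk_zero (g : Heis p F) : g = ⟨g.x, 0⟩ * ⟨0, g.a⟩ := by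
  ext <;> simp [(Fact.out : p.Prime).ne_zero]

theorem isPGroup [Finite F] : IsPGroup p (Heis p F) := fun g => ⟨2, by
  have key : ∀ n : ℕ, g ^ n = ⟨n * g.x, n * g.a⟩ := fun n => by
    induction n with
    | zero => ext <;> simp
    | succ n ih =>
      rw [pow_succ, ih]
      have hn : (n : F) ^ p = n := by rw [← frobenius_def, map_natCast]
      ext
      · simp only [mul_x]; push_cast; ring
      · simp only [mul_a, mul_pow, hn]; push_cast; ring
  rw [key]
  ext <;> simp⟩

variable [Algebra (ZMod p) F]

/-- The automorphism `(x, a) ↦ (t τ(x), t ^ (p + 1) τ(a))`. -/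
def act (t : Fˣ) (τ : F ≃ₐ[ZMod p] F) : MulAut (Heis p F) :=
  { toFun := fun g => ⟨t * τ g.x, (t : F) ^ (p + 1) * τ g.a⟩
    invFun := fun g => ⟨τ.symm ((t⁻¹ : Fˣ) * g.x), τ.symm (((t⁻¹ : Fˣ) : F) ^ (p + 1) * g.a)⟩
    left_inv := fun g => by
      ext
      · simp
      · simp
    right_inv := fun g => by
      ext
      · simp
      · simp
    map_mul' := fun g h => by
      ext
      · simp [mul_add]
      · simp only [mul_a, map_add, map_sub, map_mul, map_pow]
        ring }

@[simp] theorem act_x (t : Fˣ) (τ : F ≃ₐ[ZMod p] F) (g : Heis p F) :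
    (act t τ g).x = t * τ g.x := rfl

@[simp] theorem act_a (t : Fˣ) (τ : F ≃ₐ[ZMod p] F) (g : Heis p F) :
    (act t τ g).a = (t : F) ^ (p + 1) * τ g.a := rfl

theorem act_mul_act (t s : Fˣ) (τ σ : F ≃ₐ[ZMod p] F) :
    act (p := p) t τ * act s σ = act (t * Units.map (τ : F →* F) s) (τ * σ) := by
  refine MulEquiv.ext fun g => ?_
  rw [MulAut.mul_apply]
  ext <;> simp <;> ring

theorem act_one_one : act (p := p) (1 : Fˣ) (1 : F ≃ₐ[ZMod p] F) = 1 := by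
  refine MulEquiv.ext fun g => ?_
  ext <;> simp

theorem act_injective {t s : Fˣ} {τ σ : F ≃ₐ[ZMod p] F} (h : act (p := p) t τ = act s σ) :
    t = s ∧ τ = σ := by
  have h1 : ∀ z, t * τ z = s * σ z := fun z => 
    congrArg Heis.x (DFunLike.congr_fun h (⟨z, 0⟩ : Heis p F))
  have h2 : t = s := by ext; simpa using h1 1
  subst h2
  exact ⟨rfl, AlgEquiv.ext fun z => by simpa using h1 z⟩

/-- The Galois group, as a group of automorphisms. -/
def galGroup (p : ℕ) [Fact p.Prime] (F : Type*) [Field F] [CharP F p] [Algebra (ZMod p) F] :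
    Subgroup (MulAut (Heis p F)) :=
  MonoidHom.range
    { toFun := fun τ : F ≃ₐ[ZMod p] F => act 1 τ
      map_one' := act_one_one
      map_mul' := fun τ σ => by rw [act_mul_act]; simp }

/-- The elements of norm one, as a group of automorphisms. -/
def normOneGroup (p : ℕ) [Fact p.Prime] (F : Type*) [Field F] [CharP F p] [Algebra (ZMod p) F] :
    Subgroup (MulAut (Heis p F)) :=
  Subgroup.map
    { toFun := fun t : Fˣ => act t 1
      map_one' := act_one_one
      map_mul' := fun t s => by
        rw [act_mul_act]
        congr 1 } (normOne p F)

variable [Finite F]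

/-- The semidirect product of the elements of norm one with the Galois group, as a group of
automorphisms. -/
def semilinearGroup (p : ℕ) [Fact p.Prime] (F : Type*) [Field F] [CharP F p] [Algebra (ZMod p) F]
    [Finite F] : Subgroup (MulAut (Heis p F)) where
  carrier := {f | ∃ t ∈ normOne p F, ∃ τ, act t τ = f}
  one_mem' := ⟨1, one_mem _, 1, act_one_one⟩
  mul_mem' := by
    rintro _ _ ⟨t, ht, τ, rfl⟩ ⟨s, hs, σ, rfl⟩
    exact ⟨_, mul_mem ht (norm_algEquiv_mem τ hs), _, (act_mul_act ..).symm⟩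
  inv_mem' := by
    rintro _ ⟨t, ht, τ, rfl⟩
    refine ⟨_, norm_algEquiv_mem τ⁻¹ (inv_mem ht), τ⁻¹, eq_inv_of_mul_eq_one_left ?_⟩
    rw [act_mul_act, ← map_mul, inv_mul_cancel, inv_mul_cancel, map_one, act_one_one]

theorem galGroup_le : galGroup p F ≤ semilinearGroup p F := by
  rintro _ ⟨τ, rfl⟩
  exact ⟨1, one_mem _, τ, rfl⟩

theorem normOneGroup_le : normOneGroup p F ≤ semilinearGroup p F := by
  rintro _ ⟨t, ht, rfl⟩
  exact ⟨t, ht, 1, rfl⟩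

variable (hF : finrank (ZMod p) F = p)
include hF

theorem card_galGroup : Nat.card (galGroup p F) = p := by
  refine Eq.trans ?_ (card_algEquiv hF)
  refine (Nat.card_congr (Equiv.ofBijective (fun τ => ⟨act 1 τ, τ, rfl⟩) ⟨fun τ σ h => ?_, ?_⟩)).symm
  · exact (act_injective (congrArg Subtype.val h)).2
  · rintro ⟨_, τ, rfl⟩
    exact ⟨τ, rfl⟩

theorem card_semilinearGroup :
    Nat.card (semilinearGroup p F) = Nat.card (normOne p F) * p := by
  refine Eq.trans ?_ (congrArg (Nat.card (normOne p F) * ·) (card_algEquiv hF))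
  rw [← Nat.card_prod]
  refine (Nat.card_congr (Equiv.ofBijective
    (fun z : normOne p F × (F ≃ₐ[ZMod p] F) => ⟨act z.1 z.2, z.1, z.1.2, z.2, rfl⟩)
    ⟨fun z w h => ?_, ?_⟩)).symm
  · obtain ⟨h1, h2⟩ := act_injective (congrArg Subtype.val h)
    exact Prod.ext (Subtype.ext h1) h2
  · rintro ⟨_, t, ht, τ, rfl⟩
    exact ⟨(⟨t, ht⟩, τ), rfl⟩

theorem card_heis : Nat.card (Heis p F) = p ^ (2 * p) := by
  rw [card_eq, card_field hF, ← pow_add, two_mul]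

end Heis

end BlockDegrees
end

/-! ### The radical of the commutator form -/

noncomputable section
set_option linter.unusedSectionVars false
namespace BlockDegrees

open Module

namespace Heis

variable {p : ℕ} [Fact p.Prime] {F : Type*} [Field F] [CharP F p] [Algebra (ZMod p) F] [Finite F]

/-- The radical of the alternating form that the commutator map induces for the character
`z ↦ traceChar (c * z)` of the centre. -/
def radical (p : ℕ) [Fact p.Prime] (F : Type*) [Field F] [Algebra (ZMod p) F] (c : F) : Set F :=
  {x | ∀ y, traceChar p F (c * (2 * (y ^ p * x - y * x ^ p))) = 1}

theorem two_ne_zero_of_charP (hp2 : p ≠ 2) : (2 : F) ≠ 0 := by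
  have := CharP.cast_eq_zero_iff F p 2
  intro h
  have h1 := this.1 (by exact_mod_cast h)
  exact hp2 ((Nat.prime_dvd_prime_iff_eq Fact.out Nat.prime_two).1 h1)

theorem frobenius_surjective' (y : F) : ∃ z : F, z ^ p = y :=
  (bijective_frobenius (R := F) (p := p)).2 y

/-- Since the trace is invariant under Frobenius, c y x^p may be replaced by its p-th power. The
form then becomes a multiple of y^p, whose coefficient has to vanish. -/
theorem mem_radical (hp2 : p ≠ 2) {c x : F} :
    x ∈ radical p F c ↔ c ^ p * x ^ p ^ 2 = c * x := by
  have h2 : (2 : F) ^ p = 2 := by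
    have := map_natCast (frobenius F p) 2
    rwa [frobenius_def, Nat.cast_ofNat] at this
  have key : ∀ y : F, traceChar p F (c * (2 * (y ^ p * x - y * x ^ p))) =
      traceChar p F (-2 * (c ^ p * x ^ p ^ 2 - c * x) * y ^ p) := fun y => by
    have e1 : c * (2 * (y ^ p * x - y * x ^ p)) = 2 * c * x * y ^ p + -(2 * c * y * x ^ p) := by ring
    have e2 : -2 * (c ^ p * x ^ p ^ 2 - c * x) * y ^ p =
        2 * c * x * y ^ p + -(2 * c ^ p * y ^ p * x ^ p ^ 2) := by ring
    rw [e1, e2, AddChar.map_add_eq_mul, AddChar.map_add_eq_mul, AddChar.map_neg_eq_inv,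
      AddChar.map_neg_eq_inv, ← traceChar_pow (2 * c * y * x ^ p)]
    simp only [mul_pow, h2, ← pow_mul, sq]
  simp only [radical, Set.mem_ofPred_eq, key]
  constructor
  · intro h
    have h1 : -2 * (c ^ p * x ^ p ^ 2 - c * x) = 0 := eq_zero_of_traceChar_mul (p := p) fun z => by
      obtain ⟨y, rfl⟩ := frobenius_surjective' (p := p) z
      exact h y
    have h3 := (mul_eq_zero.1 h1).resolve_left (neg_ne_zero.2 (two_ne_zero_of_charP hp2))
    exact sub_eq_zero.1 h3
  · intro h y
    rw [h, sub_self, mul_zero, zero_mul, AddChar.map_zero_eq_one]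

variable (hF : finrank (ZMod p) F = p)
include hF

theorem pow_card_field (y : F) : y ^ p ^ p = y := by
  have := Fintype.ofFinite F
  have h := FiniteField.pow_card y
  rwa [← Nat.card_eq_fintype_card, card_field hF] at h

/-- The extension has odd degree p = 2k + 1, so `F` contains no quadratic extension of the prime
field: y^(p^2) = y gives y = y^(p^p) = y^p. -/
theorem pow_sq_eq_self_iff (hp2 : p ≠ 2) {y : F} :
    y ^ p ^ 2 = y ↔ ∃ n : ZMod p, algebraMap (ZMod p) F n = y := by
  constructor
  · intro h
    obtain ⟨k, hk⟩ := (Fact.out : p.Prime).odd_of_ne_two hp2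
    have h1 : ∀ k, y ^ p ^ (2 * k) = y := fun k => by
      induction k with
      | zero => simp
      | succ k ih => rw [mul_add, pow_add, pow_mul, ih, mul_one, h]
    have h2 : y ^ p = y := by
      have h3 := pow_card_field hF y
      have h4 : p ^ p = p ^ (2 * k) * p := by
        rw [← pow_succ, ← hk]
      rwa [h4, pow_mul, h1] at h3
    have h5 := (Subfield.mem_bot_iff_pow_eq_self (F := F) (p := p)).2 h2
    exact (bot_le : (⊥ : Subfield F) ≤ (algebraMap (ZMod p) F).fieldRange) h5
  · rintro ⟨n, rfl⟩
    rw [← map_pow, sq, pow_mul, ZMod.pow_card, ZMod.pow_card]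

theorem mem_radical_algebraMap (hp2 : p ≠ 2) {n : ZMod p} (hn : n ≠ 0) {x : F} :
    x ∈ radical p F (algebraMap (ZMod p) F n) ↔ ∃ m : ZMod p, algebraMap (ZMod p) F m = x := by
  have hn' : algebraMap (ZMod p) F n ≠ 0 := by rwa [Ne, map_eq_zero]
  rw [mem_radical hp2, ← map_pow, ZMod.pow_card, mul_right_inj' hn', pow_sq_eq_self_iff hF hp2]

/-- If c s^(p+1) is in the prime field, the radical is s times the prime field. -/
theorem card_radical (hp2 : p ≠ 2) {c : F} (hc : c ≠ 0) : Nat.card (radical p F c) = p := by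
  obtain ⟨s, -, n, hn, hs⟩ := exists_mul_pow_eq_algebraMap hF hp2 hc
  have hn' : algebraMap (ZMod p) F n ≠ 0 := by rwa [Ne, map_eq_zero]
  have hs0 := s.ne_zero
  have key : ∀ y : F, (s : F) * y ∈ radical p F c ↔
      ∃ m : ZMod p, algebraMap (ZMod p) F m = y := fun y => by
    rw [mem_radical hp2, ← pow_sq_eq_self_iff hF hp2, ← mul_right_inj' (pow_ne_zero p hs0)]
    have e1 : (s : F) ^ p * (c ^ p * (s * y) ^ p ^ 2) = (c * (s : F) ^ (p + 1)) ^ p * y ^ p ^ 2 := by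
      ring
    have e2 : (s : F) ^ p * (c * (s * y)) = c * (s : F) ^ (p + 1) * y := by ring
    rw [e1, e2, hs, ← map_pow, ZMod.pow_card, mul_right_inj' hn']
  have h : Nat.card (ZMod p) = Nat.card (radical p F c) :=
    Nat.card_congr (Equiv.ofBijective (fun m => ⟨s * algebraMap (ZMod p) F m, (key _).2 ⟨m, rfl⟩⟩)
      ⟨fun m m' h => (algebraMap (ZMod p) F).injective
        (mul_left_cancel₀ hs0 (congrArg Subtype.val h)), fun ⟨x, hx⟩ => by
        obtain ⟨m, hm⟩ := (key ((s : F)⁻¹ * x)).1 (by rwa [mul_inv_cancel_left₀ hs0])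
        exact ⟨m, Subtype.ext (by simp only [hm, mul_inv_cancel_left₀ hs0])⟩⟩)
  rw [← h, Nat.card_zmod]

end Heis

end BlockDegrees
end

/-! ### Degrees over a nontrivial central character -/

noncomputable section
set_option linter.unusedSectionVars false
namespace BlockDegrees

open Module

theorem exists_finrank_eq_pow {p : ℕ} [Fact p.Prime] {S X : Type*} [Group S] [Finite S]
    [AddCommGroup X] [Module ℂ X] [FiniteDimensional ℂ X] (ρ : Representation ℂ S X)
    (hρ : ρ.IsIrreducible) {N M : ℕ} (hS : Nat.card S = p ^ N) (U : Subgroup S)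
    (hU : ∀ u ∈ U, ∃ z : ℂ, ∀ v, ρ u v = z • v) (hM : p ^ M ≤ Nat.card U) :
    ∃ k, finrank ℂ X = p ^ k ∧ 2 * k + M ≤ N := by
  have hp := (Fact.out : p.Prime)
  have h1 := finrank_dvd_card ρ
  rw [hS, Nat.dvd_prime_pow hp] at h1
  obtain ⟨k, -, hk⟩ := h1
  refine ⟨k, hk, ?_⟩
  have h2 := finrank_sq_le_index ρ hρ U hU
  have h3 : p ^ (2 * k + M) ≤ p ^ N := by
    rw [← hS, ← U.index_mul_card, pow_add, mul_comm 2 k, pow_mul, ← hk]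
    exact Nat.mul_le_mul h2 hM
  exact (Nat.pow_le_pow_iff_right hp.one_lt).1 h3

theorem map_mul_map_eq_of_conj {S X : Type*} [Group S] [AddCommGroup X] [Module ℂ X]
    (ρ : Representation ℂ S X) {s g : S} (h : ρ (s * g * s⁻¹) = ρ g) : ρ g * ρ s = ρ s * ρ g := by
  rw [← h, ← map_mul, inv_mul_cancel_right, map_mul]
  rw [h]

/-- The elements that act as scalars. -/
def scalarSubgroup {S X : Type*} [Group S] [AddCommGroup X] [Module ℂ X]
    (ρ : Representation ℂ S X) : Subgroup S where
  carrier := {s | ∃ z : ℂ, ∀ v, ρ s v = z • v}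
  one_mem' := ⟨1, by simp⟩
  mul_mem' := by
    rintro s t ⟨z, hz⟩ ⟨w, hw⟩
    exact ⟨z * w, fun v => by rw [map_mul, Module.End.mul_apply, hw, hz, mul_smul]⟩
  inv_mem' := by
    rintro s ⟨z, hz⟩
    have h : ∀ v, z • ρ s⁻¹ v = v := fun v => by
      rw [← hz, ← Module.End.mul_apply, ← map_mul, mul_inv_cancel, map_one, Module.End.one_apply]
    refine ⟨z⁻¹, fun v => ?_⟩
    by_cases hz0 : z = 0
    · have h0 : ∀ w : X, w = 0 := fun w => by rw [← h w, hz0, zero_smul]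
      rw [h0 (ρ s⁻¹ v), h0 (z⁻¹ • v)]
    · conv_rhs => rw [← h v]
      rw [smul_smul, inv_mul_cancel₀ hz0, one_smul]

theorem character_eq_of_apply_eq_smul {S X : Type*} [Group S] [AddCommGroup X] [Module ℂ X]
    [FiniteDimensional ℂ X] (ρ : Representation ℂ S X) {s : S} {z : ℂ} (h : ∀ v, ρ s v = z • v) :
    ρ.character s = z * finrank ℂ X := by
  have : ρ s = z • (1 : End ℂ X) := LinearMap.ext fun v => by rw [h]; simp
  rw [Representation.character, this, map_smul, LinearMap.trace_one, smul_eq_mul]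

namespace Heis

variable {p : ℕ} [Fact p.Prime] {F : Type*} [Field F] [CharP F p] [Algebra (ZMod p) F] [Finite F]
variable (hF : finrank (ZMod p) F = p) (hp2 : p ≠ 2)
include hF hp2

/-- The degree of an irreducible representation with nontrivial central character. -/
theorem finrank_sq_mul {X : Type*} [AddCommGroup X] [Module ℂ X] [FiniteDimensional ℂ X]
    (ρ : Representation ℂ (Heis p F) X) (hρ : ρ.IsIrreducible) {c : F} (hc : c ≠ 0)
    (hZ : ∀ a v, ρ ⟨0, a⟩ v = traceChar p F (c * a) • v) :
    finrank ℂ X ^ 2 * p ^ (p + 1) = p ^ (2 * p) := by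
  classical
  have := Fintype.ofFinite (Heis p F)
  have hcomm : ∀ g h : Heis p F, ρ (g * h * g⁻¹) =
      traceChar p F (c * (2 * (g.x ^ p * h.x - g.x * h.x ^ p))) • ρ h := fun g h => by
    have e : g * h * g⁻¹ = ⟨0, 2 * (g.x ^ p * h.x - g.x * h.x ^ p)⟩ * h := by
      rw [conj_eq]
      ext
      · simp
      · simp [(Fact.out : p.Prime).ne_zero, add_comm]
    rw [e, map_mul]
    exact LinearMap.ext fun v => hZ _ _
  -- Outside the radical a suitable conjugation multiplies the operator by a scalar other than 1, so
  -- its trace is zero; over the radical the operator is a scalar by Schur. The orthogonality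
  -- relation then determines the degree, as p · p^p elements contribute.
  have h0 : ∀ h : Heis p F, h.x ∉ radical p F c → ρ.character h = 0 := fun h hh => by
    simp only [radical, Set.mem_ofPred_eq, not_forall] at hh
    obtain ⟨y, hy⟩ := hh
    have h1 := Representation.char_conj ρ h ⟨y, 0⟩
    rw [Representation.character, hcomm, map_smul, smul_eq_mul] at h1
    by_contra hne
    exact hy (mul_right_cancel₀ hne (h1.trans (one_mul _).symm))
  have h1 : ∀ h : Heis p F, h.x ∈ radical p F c →
      ρ.character h * ρ.character h⁻¹ = (finrank ℂ X : ℂ) ^ 2 := fun h hh => by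
    obtain ⟨z, hz⟩ := exists_eq_smul_of_commute ρ (ρ h) fun g =>
      map_mul_map_eq_of_conj ρ (by rw [hcomm, hh g.x, one_smul])
    obtain ⟨w, hw⟩ := (scalarSubgroup ρ).inv_mem ⟨z, hz⟩
    have := ((isIrreducible_iff ρ).1 hρ).1
    obtain ⟨v, hv⟩ := exists_ne (0 : X)
    have hzw : z * w = 1 := eq_one_of_smul_eq_self hv (by
      rw [mul_smul, ← hw, ← hz, ← Module.End.mul_apply, ← map_mul, mul_inv_cancel, map_one,
        Module.End.one_apply])
    rw [character_eq_of_apply_eq_smul ρ hz, character_eq_of_apply_eq_smul ρ hw]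
    linear_combination (finrank ℂ X : ℂ) ^ 2 * hzw
  have h2 := sum_character_mul_character_inv ρ
  have h3 : ∑ h : Heis p F, ρ.character h * ρ.character h⁻¹ =
      ∑ h : Heis p F, if h.x ∈ radical p F c then (finrank ℂ X : ℂ) ^ 2 else 0 :=
    Finset.sum_congr rfl fun h _ => by
      split_ifs with hh
      · exact h1 h hh
      · rw [h0 h hh, zero_mul]
  have h4 : (Finset.univ.filter fun h : Heis p F => h.x ∈ radical p F c).card = p ^ (p + 1) := by
    rw [← Fintype.card_subtype, ← Nat.card_eq_fintype_card]
    have e : {h : Heis p F // h.x ∈ radical p F c} ≃ radical p F c × F :=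
      ⟨fun h => (⟨h.1.x, h.2⟩, h.1.a), fun z => ⟨⟨z.1, z.2⟩, z.1.2⟩, fun _ => rfl, fun _ => rfl⟩
    rw [Nat.card_congr e, Nat.card_prod, card_field hF, card_radical hF hp2 hc, pow_succ, mul_comm]
  rw [h3, ← Finset.sum_filter, Finset.sum_const, h4, card_heis hF, nsmul_eq_mul] at h2
  rw [mul_comm]
  exact_mod_cast h2

/-- The degree of an irreducible representation, with nontrivial central character, of an
extension of the group by at most one automorphism of order `p` that acts trivially on the
radical. -/
theorem finrank_eq_of_central {S X : Type*} [Group S] [Finite S] [AddCommGroup X] [Module ℂ X]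
    [FiniteDimensional ℂ X] (ρ : Representation ℂ S X) (hρ : ρ.IsIrreducible)
    (j : Heis p F →* S) (hj : Function.Injective j) {e : ℕ} (he : e ≤ 1)
    (hS : Nat.card S = p ^ (2 * p + e)) {c : F} (hc : c ≠ 0)
    (hZ : ∀ a v, ρ (j ⟨0, a⟩) v = traceChar p F (c * a) • v)
    (hrad : ∀ s, ∀ x ∈ radical p F c, ∃ a, s * j ⟨x, 0⟩ * s⁻¹ = j ⟨x, a⟩ ∧
      traceChar p F (c * a) = 1) :
    finrank ℂ X = p ^ ((p - 1) / 2) := by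
  have hp := (Fact.out : p.Prime)
  have hXn := ((isIrreducible_iff ρ).1 hρ).1
  obtain ⟨r, hr⟩ := hp.odd_of_ne_two hp2
  have hr' : (p - 1) / 2 = r := by omega
  rw [hr']
  -- the lower bound
  obtain ⟨Y, hY, -, hY0, hYirr⟩ := exists_subRep_isIrreducible
    (ρ.comp j : Representation ℂ (Heis p F) X) ⊤ (by simp) top_ne_bot
  have hlow := finrank_sq_mul hF hp2 _ hYirr hc fun a v => Subtype.ext (hZ a v)
  have hYd : finrank ℂ Y = p ^ r := by
    have h1 : finrank ℂ Y ^ 2 = (p ^ r) ^ 2 := by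
      refine Nat.eq_of_mul_eq_mul_right (pow_pos hp.pos (p + 1)) ?_
      rw [hlow, ← pow_mul, ← pow_add]
      congr 1
      omega
    exact Nat.pow_left_injective (n := 2) (by omega) h1
  have hle : p ^ r ≤ finrank ℂ X := hYd ▸ Submodule.finrank_le Y
  -- the upper bound
  set U := scalarSubgroup ρ
  have hmem : ∀ x ∈ radical p F c, ∀ a, j ⟨x, a⟩ ∈ U := fun x hx a => by
    have e : (⟨x, a⟩ : Heis p F) = ⟨x, 0⟩ * ⟨0, a⟩ := eq_mul_mk_zero _
    rw [e, map_mul]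
    refine mul_mem ?_ ⟨_, hZ a⟩
    refine exists_eq_smul_of_commute ρ _ fun s => ?_
    obtain ⟨b, hb, hb1⟩ := hrad s x hx
    have h1 : ρ (j ⟨x, b⟩) = ρ (j ⟨x, 0⟩) := LinearMap.ext fun v => by
      have e : (⟨x, b⟩ : Heis p F) = ⟨x, 0⟩ * ⟨0, b⟩ := eq_mul_mk_zero _
      rw [e, map_mul, map_mul, Module.End.mul_apply, hZ, hb1, one_smul]
    exact map_mul_map_eq_of_conj ρ (by rw [hb, h1])
  have hU : p ^ (p + 1) ≤ Nat.card U := by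
    have h1 : Nat.card (radical p F c × F) = p ^ (p + 1) := by
      rw [Nat.card_prod, card_field hF, card_radical hF hp2 hc, pow_succ, mul_comm]
    rw [← h1]
    refine Nat.card_le_card_of_injective (fun z => (⟨j ⟨z.1, z.2⟩, hmem _ z.1.2 _⟩ : U)) ?_
    rintro ⟨⟨x, hx⟩, a⟩ ⟨⟨x', hx'⟩, a'⟩ h
    have := hj (congrArg Subtype.val h)
    simp only [Heis.mk.injEq] at this
    simp [this]
  -- Here 2k + (p + 1) ≤ 2p + e with e ≤ 1, so 2k ≤ p. As p is odd, k ≤ (p - 1) / 2 even if e = 1: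
  -- parity absorbs the extra automorphism.
  obtain ⟨k, hk, hk2⟩ := exists_finrank_eq_pow ρ hρ hS U (fun u hu => hu) hU
  rw [hk] at hle ⊢
  have := (Nat.pow_le_pow_iff_right hp.one_lt).1 hle
  congr 1
  omega

end Heis

end BlockDegrees
end

/-! ### General tools: fixed vectors and abelian normal subgroups of prime index -/

noncomputable section
set_option linter.unusedSectionVars false
namespace BlockDegrees

open Module

section General

variable {K V : Type*} [Group K] [Finite K] [AddCommGroup V] [Module ℂ V] [FiniteDimensional ℂ V]

/-- If a family that is stable under conjugation has a common nonzero fixed vector, then it acts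
trivially. -/
theorem apply_eq_self_of_exists {ι : Type*} (ρ : Representation ℂ K V) (hρ : ρ.IsIrreducible)
    (j : ι → K) (hj : ∀ k i, ∃ i', k⁻¹ * j i * k = j i') {v : V} (hv0 : v ≠ 0)
    (hv : ∀ i, ρ (j i) v = v) (i : ι) (w : V) : ρ (j i) w = w := by
  let W : Submodule ℂ V := ⨅ i, End.eigenspace (ρ (j i)) 1
  have hW : ∀ w, w ∈ W ↔ ∀ i, ρ (j i) w = w := fun w => by
    simp [W, Submodule.mem_iInf]
  rcases ((isIrreducible_iff ρ).1 hρ).2 W (fun k w hw => by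
    rw [hW] at hw ⊢
    intro i
    obtain ⟨i', hi'⟩ := hj k i
    have e : j i * k = k * j i' := by rw [← hi']; group
    rw [← Module.End.mul_apply, ← map_mul, e, map_mul, Module.End.mul_apply, hw]) with h | h
  · exact absurd ((Submodule.mem_bot ℂ).1 (h ▸ (hW v).2 hv)) hv0
  · exact (hW w).1 (h ▸ Submodule.mem_top) i

theorem finrank_eq_one_of_forall_apply_mem_span (ρ : Representation ℂ K V)
    (hρ : ρ.IsIrreducible) {w : V} (hw : w ≠ 0) (h : ∀ k, ∃ z : ℂ, ρ k w = z • w) :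
    finrank ℂ V = 1 := by
  rcases ((isIrreducible_iff ρ).1 hρ).2 (Submodule.span ℂ {w}) (fun k v hv => by
    obtain ⟨z, rfl⟩ := Submodule.mem_span_singleton.1 hv
    obtain ⟨y, hy⟩ := h k
    rw [map_smul, hy]
    exact Submodule.smul_mem _ _ (Submodule.smul_mem _ _ (Submodule.mem_span_singleton_self w)))
    with h | h
  · exact absurd (Submodule.span_singleton_eq_bot.1 h) hw
  · rw [← finrank_top, ← h, finrank_span_singleton hw]

/-- The degrees over a normal subgroup of prime index that acts through an abelian group. -/
theorem finrank_eq_one_or_eq_of_commute {p : ℕ} [hp : Fact p.Prime] (ρ : Representation ℂ K V)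
    (hρ : ρ.IsIrreducible) (N : Subgroup K) [hN : N.Normal] (hindex : N.index = p)
    (hcomm : ∀ m n : N, Commute (ρ m) (ρ n)) : finrank ℂ V = 1 ∨ finrank ℂ V = p := by
  have hV := ((isIrreducible_iff ρ).1 hρ).1
  obtain ⟨lam, v, hv0, hv⟩ := exists_weightSpace_ne_bot ρ (fun n : N => (n : K)) hcomm
  have hmul : ∀ m n : N, lam (m * n) = lam m * lam n := fun m n => by
    have h1 := hv (m * n)
    rw [Subgroup.coe_mul, map_mul, Module.End.mul_apply, hv, map_smul, hv, smul_smul] at h1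
    have h2 : (lam (m * n) - lam m * lam n) • v = 0 := by
      rw [sub_smul, ← h1, mul_comm, sub_self]
    exact sub_eq_zero.1 ((smul_eq_zero.1 h2).resolve_right hv0)
  have hcomm' : ∀ m n : N, lam (m * n) = lam (n * m) := fun m n => by
    rw [hmul, hmul, mul_comm]
  let c : K → N → N := fun k n => ⟨k * n * k⁻¹, hN.conj_mem n n.2 k⟩
  have hcmul : ∀ k l n, c (k * l) n = c k (c l n) := fun k l n => by
    ext; simp [c, mul_assoc]
  have hc1 : ∀ n, c 1 n = n := fun n => by ext; simp [c]
  -- The stabilizer of the weight contains `N`, whose index is prime, so it is `N` or the whole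
  -- group.
  let S : Subgroup K :=
    { carrier := {s | ∀ n, lam (c s n) = lam n}
      one_mem' := fun n => by rw [hc1]
      mul_mem' := fun {s t} hs ht n => by rw [hcmul, hs, ht]
      inv_mem' := fun {s} hs n => by rw [← hs (c s⁻¹ n), ← hcmul, mul_inv_cancel, hc1] }
  have hNS : N ≤ S := fun m hm n => by
    have e : c m n = ⟨m, hm⟩ * n * ⟨m, hm⟩⁻¹ := rfl
    rw [e, hcomm', inv_mul_cancel_left]
  obtain ⟨X, σ, hσ, hσρ, hX, hdim⟩ := exists_isIrreducible_stabilizer ρ hρ (fun n : N => (n : K))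
    hcomm c (fun k n => rfl) hcmul hc1 lam S (fun s => Iff.rfl) hv0 hv
  have hXn := ((isIrreducible_iff σ).1 hσ).1
  have hrel := Subgroup.relIndex_mul_index hNS
  rw [hindex] at hrel
  have hscalar : ∀ (n : N) (x : X), σ ⟨n, hNS n.2⟩ x = lam n • x := fun n x =>
    Subtype.ext (by rw [hσρ]; exact hX n x x.2)
  rcases (Nat.dvd_prime hp.out).1 (Dvd.intro _ hrel) with h1 | h1
  · -- the stabilizer is `N`
    right
    rw [h1, one_mul] at hrel
    have hSN := Subgroup.relIndex_eq_one.1 h1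
    obtain ⟨x, hx⟩ := exists_ne (0 : X)
    have := finrank_eq_one_of_forall_apply_mem_span σ hσ hx fun s =>
      ⟨lam ⟨s, hSN s.2⟩, hscalar ⟨s, hSN s.2⟩ x⟩
    rw [hdim, this, hrel, mul_one]
  · -- the stabilizer is the whole group
    left
    have hS1 : S.index = 1 := by
      rw [h1] at hrel
      exact Nat.eq_of_mul_eq_mul_left hp.out.pos (by rw [hrel, mul_one])
    have hStop := Subgroup.index_eq_one.1 hS1
    obtain ⟨k, hk⟩ : ∃ k, k ∉ N := by
      by_contra! h
      have : N = ⊤ := eq_top_iff.2 fun k _ => h k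
      rw [this, Subgroup.index_top] at hindex
      exact hp.out.one_lt.ne hindex
    obtain ⟨z, hz⟩ := End.exists_eigenvalue (σ ⟨k, hStop ▸ Subgroup.mem_top k⟩)
    obtain ⟨w, hw⟩ := hz.exists_hasEigenvector
    -- The stabilizer of the line spanned by `w`. It contains `N` and the element `k` outside `N`,
    -- hence is everything, and the degree is 1.
    let L : Subgroup K :=
      { carrier := {s | ∃ z : ℂˣ, ρ s w = z • (w : V)}
        one_mem' := ⟨1, by simp⟩
        mul_mem' := by
          rintro s t ⟨z, hz⟩ ⟨y, hy⟩
          exact ⟨z * y, by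
            rw [map_mul, Module.End.mul_apply, hy, Units.smul_def, map_smul, hz, mul_comm, mul_smul]
            rfl⟩
        inv_mem' := by
          rintro s ⟨z, hz⟩
          refine ⟨z⁻¹, (Representation.apply_bijective ρ s).1 ?_⟩
          rw [Units.smul_def, map_smul, hz, ← Module.End.mul_apply, ← map_mul, mul_inv_cancel,
            map_one, Module.End.one_apply, ← Units.smul_def, smul_smul, inv_mul_cancel, one_smul] }
    have hunit : ∀ (s : K) (z : ℂ), ρ s w = z • (w : V) → s ∈ L := fun s z h => by
      have hz0 : z ≠ 0 := fun h0 => hw.2 (Subtype.ext ((Representation.apply_bijective ρ s).1 (by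
        rw [h, h0, zero_smul]; simp)))
      exact ⟨Units.mk0 z hz0, h⟩
    have hkL : k ∈ L := hunit k z (by
      have := congrArg Subtype.val hw.apply_eq_smul
      rwa [hσρ] at this)
    have hNL : N ≤ L := fun n hn => hunit n (lam ⟨n, hn⟩) (hX ⟨n, hn⟩ w w.2)
    have hL : L = ⊤ := by
      have h2 := Subgroup.relIndex_mul_index hNL
      rw [hindex] at h2
      rcases (Nat.dvd_prime hp.out).1 (Dvd.intro _ h2) with h3 | h3
      · exact absurd (Subgroup.relIndex_eq_one.1 h3 hkL) hk
      · rw [h3] at h2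
        exact Subgroup.index_eq_one.1 (Nat.eq_of_mul_eq_mul_left hp.out.pos (by rw [h2, mul_one]))
    refine finrank_eq_one_of_forall_apply_mem_span ρ hρ (w := w)
      (fun h => hw.2 (Subtype.ext h)) fun s => ?_
    obtain ⟨z, hz⟩ : s ∈ L := hL ▸ Subgroup.mem_top s
    exact ⟨z, hz⟩

theorem exists_isIrreducible_of_injective {A : Type*} [Group A] (f : A →* K)
    (hf : Function.Injective f) (lam : A →* ℂ) :
    ∃ (d : ℕ) (ρ : Representation ℂ K (Fin d → ℂ)) (v : Fin d → ℂ), ρ.IsIrreducible ∧ v ≠ 0 ∧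
      ∀ a, ρ (f a) v = lam a • v := by
  obtain ⟨d, ρ, v, hρ, hv0, hv⟩ := exists_isIrreducible_apply_eq_smul f.range
    (lam.comp (f.ofInjective hf).symm.toMonoidHom)
  refine ⟨d, ρ, v, hρ, hv0, fun a => ?_⟩
  have := hv (f.ofInjective hf a)
  rw [MonoidHom.ofInjective_apply] at this
  simpa using this

end General
end BlockDegrees
end

/-! ### Weights for `Heis p F` extended by a group of semilinear automorphisms -/

noncomputable section
set_option linter.unusedSectionVars false
namespace BlockDegrees

open Module SemidirectProduct

instance finite_semidirectProduct {N G : Type*} [Group N] [Group G] [Finite N] [Finite G]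
    {φ : G →* MulAut N} : Finite (N ⋊[φ] G) :=
  Finite.of_equiv _ SemidirectProduct.equivProd.symm

theorem conj_inl {N G : Type*} [Group N] [Group G] {φ : G →* MulAut N} (k : N ⋊[φ] G) (n : N) :
    k * inl n * k⁻¹ = inl (k.left * φ k.right n * k.left⁻¹) := by
  ext <;> simp [mul_assoc]

namespace Heis

variable {p : ℕ} [Fact p.Prime] {F : Type*} [Field F] [CharP F p] [Algebra (ZMod p) F] [Finite F]

variable {R : Subgroup (MulAut (Heis p F))} (hR : R ≤ semilinearGroup p F)
include hR

theorem apply_mk_zero {r : MulAut (Heis p F)} (hr : r ∈ R) (a : F) :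
    r ⟨0, a⟩ = ⟨0, (r ⟨0, a⟩).a⟩ := by
  obtain ⟨t, -, τ, rfl⟩ := hR hr
  ext <;> simp

theorem apply_x {r : MulAut (Heis p F)} (hr : r ∈ R) (h : Heis p F) :
    (r h).x = (r ⟨h.x, 0⟩).x := by
  obtain ⟨t, -, τ, rfl⟩ := hR hr
  simp

theorem card_comap_rightHom (hF : finrank (ZMod p) F = p) (R' : Subgroup R) :
    Nat.card (R'.comap (rightHom : Heis p F ⋊[R.subtype] R →* R)) = p ^ (2 * p) * Nat.card R' := by
  have h1 := (R'.comap (rightHom : Heis p F ⋊[R.subtype] R →* R)).index_mul_card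
  rw [Subgroup.index_comap_of_surjective _ rightHom_surjective, SemidirectProduct.card,
    card_heis hF, ← R'.index_mul_card] at h1
  refine Nat.eq_of_mul_eq_mul_left (Nat.pos_of_ne_zero R'.index_ne_zero_of_finite) ?_
  rw [h1]
  ring

/-- The degrees over a nontrivial character of the centre. -/
theorem finrank_of_center_weight (hF : finrank (ZMod p) F = p) (hp2 : p ≠ 2) {V : Type*}
    [AddCommGroup V] [Module ℂ V] [FiniteDimensional ℂ V]
    (ρ : Representation ℂ (Heis p F ⋊[R.subtype] R) V) (hρ : ρ.IsIrreducible) {c : F} (hc : c ≠ 0)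
    {v : V} (hv0 : v ≠ 0) (hv : ∀ a, ρ (inl ⟨0, a⟩) v = traceChar p F (c * a) • v)
    (R' : Subgroup R) (hR' : ∀ r : R, r ∈ R' ↔
      ∀ a, traceChar p F (c * ((r : MulAut (Heis p F)) ⟨0, a⟩).a) = traceChar p F (c * a))
    (hfix : ∀ r ∈ R', ∀ x ∈ radical p F c, (r : MulAut (Heis p F)) ⟨x, 0⟩ = ⟨x, 0⟩)
    {e : ℕ} (he : e ≤ 1) (hcard : Nat.card R' = p ^ e) :
    finrank ℂ V = R'.index * p ^ ((p - 1) / 2) := by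
  set H := Heis p F ⋊[R.subtype] R
  let c' : H → F → F := fun k a => ((k.right : MulAut (Heis p F)) ⟨0, a⟩).a
  have hc' : ∀ k a, k * inl ⟨0, a⟩ * k⁻¹ = (inl ⟨0, c' k a⟩ : H) := fun k a => by
    rw [conj_inl, Subgroup.subtype_apply, apply_mk_zero hR k.right.2, conj_eq]
    congr 1
    ext
    · simp
    · simp [(Fact.out : p.Prime).ne_zero, c']
  have hcomm : ∀ a b : F, Commute (ρ (inl ⟨0, a⟩)) (ρ (inl ⟨0, b⟩)) := fun a b => by
    rw [commute_iff_eq, ← map_mul, ← map_mul, ← map_mul, ← map_mul, mk_zero_mul, mk_zero_mul,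
      add_comm]
  obtain ⟨X, σ, hσ, hσρ, hX, hdim⟩ := exists_isIrreducible_stabilizer ρ hρ
    (fun a : F => (inl ⟨0, a⟩ : H)) hcomm c' hc'
    (fun k l a => by
      simp only [c', mul_right, Subgroup.coe_mul, MulAut.mul_apply]
      rw [← apply_mk_zero hR l.right.2])
    (fun a => by simp [c']) (fun a => traceChar p F (c * a)) (R'.comap rightHom)
    (fun s => hR' s.right) hv0 hv
  rw [hdim, Subgroup.index_comap_of_surjective _ rightHom_surjective]
  congr 1
  let j : Heis p F →* R'.comap (rightHom : H →* R) :=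
    (inl : Heis p F →* H).codRestrict _ fun g => by
      rw [Subgroup.mem_comap, rightHom_inl]; exact one_mem _
  refine finrank_eq_of_central hF hp2 σ hσ j (fun g h e => inl_injective (congrArg Subtype.val e)) he
    (by rw [card_comap_rightHom hR hF, hcard, pow_add]) hc
    (fun a v => Subtype.ext (by rw [hσρ]; exact hX a v v.2)) fun s x hx => ?_
  -- Since `R'` fixes the radical pointwise, conjugation changes the element only by a commutator
  -- with the `Heis` part of `s`, and on it the central character is 1 by definition of the radical.
  refine ⟨2 * ((s : H).left.x ^ p * x - (s : H).left.x * x ^ p), Subtype.ext ?_, hx _⟩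
  have e := conj_inl (s : H) ⟨x, 0⟩
  have hs : (s : H).right ∈ R' := s.2
  rw [Subgroup.subtype_apply, hfix _ hs x hx, conj_eq, zero_add] at e
  exact e

/-- The degrees over a character of the abelianization of the normal subgroup. -/
theorem finrank_of_linear_weight (hF : finrank (ZMod p) F = p) {V : Type*}
    [AddCommGroup V] [Module ℂ V] [FiniteDimensional ℂ V]
    (ρ : Representation ℂ (Heis p F ⋊[R.subtype] R) V) (hρ : ρ.IsIrreducible)
    (hZ : ∀ a w, ρ (inl ⟨0, a⟩) w = w) {c : F} {v : V} (hv0 : v ≠ 0)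
    (hv : ∀ g, ρ (inl g) v = traceChar p F (c * g.x) • v)
    (R' : Subgroup R) (hR' : ∀ r : R, r ∈ R' ↔
      ∀ x, traceChar p F (c * ((r : MulAut (Heis p F)) ⟨x, 0⟩).x) = traceChar p F (c * x))
    {e : ℕ} (he : e ≤ 1) (hcard : Nat.card R' = p ^ e) :
    finrank ℂ V = R'.index := by
  set H := Heis p F ⋊[R.subtype] R
  have hcomm : ∀ g h : Heis p F, Commute (ρ (inl g)) (ρ (inl h)) := fun g h =>
    (map_mul_map_eq_of_conj ρ (by
      have e : h * g * h⁻¹ = g * ⟨0, 2 * (h.x ^ p * g.x - h.x * g.x ^ p)⟩ := by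
        rw [conj_eq]
        ext <;> simp [(Fact.out : p.Prime).ne_zero]
      rw [← map_inv, ← map_mul, ← map_mul, e, map_mul, map_mul]
      exact LinearMap.ext fun w => by rw [Module.End.mul_apply, hZ]))
  obtain ⟨X, σ, hσ, hσρ, hX, hdim⟩ := exists_isIrreducible_stabilizer ρ hρ
    (fun g : Heis p F => (inl g : H)) hcomm
    (fun k g => k.left * (k.right : MulAut (Heis p F)) g * k.left⁻¹)
    (fun k g => conj_inl k g) (fun k l g => by simp [mul_assoc]) (fun g => by simp)
    (fun g => traceChar p F (c * g.x)) (R'.comap rightHom)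
    (fun s => by
      rw [Subgroup.mem_comap, rightHom_eq_right, hR']
      have e : ∀ g : Heis p F, (s.left * (s.right : MulAut (Heis p F)) g * s.left⁻¹).x =
          ((s.right : MulAut (Heis p F)) ⟨g.x, 0⟩).x := fun g => by
        rw [conj_eq, ← apply_x hR s.right.2]
      simp only [e]
      exact ⟨fun h g => h g.x, fun h x => h ⟨x, 0⟩⟩) hv0 hv
  rw [hdim, Subgroup.index_comap_of_surjective _ rightHom_surjective]
  let j : Heis p F →* R'.comap (rightHom : H →* R) :=
    (inl : Heis p F →* H).codRestrict _ fun g => by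
      rw [Subgroup.mem_comap, rightHom_inl]; exact one_mem _
  have hj : Function.Injective j := fun g h e => inl_injective (congrArg Subtype.val e)
  -- All of `Heis p F` acts by scalars, so 2k ≤ e ≤ 1 and the module of the stabilizer is
  -- one-dimensional.
  obtain ⟨k, hk, hk2⟩ := exists_finrank_eq_pow (p := p) (N := 2 * p + e) (M := 2 * p) σ hσ
    (by rw [card_comap_rightHom hR hF, hcard, pow_add]) j.range
    (by
      rintro _ ⟨g, rfl⟩
      exact ⟨_, fun w => Subtype.ext (by rw [hσρ]; exact hX g w w.2)⟩)
    (by rw [← card_heis hF, ← Nat.card_congr (j.ofInjective hj).toEquiv])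
  obtain rfl : k = 0 := by omega
  rw [hk, pow_zero, mul_one]

theorem apply_center_eq_self {V : Type*} [AddCommGroup V] [Module ℂ V] [FiniteDimensional ℂ V]
    (ρ : Representation ℂ (Heis p F ⋊[R.subtype] R) V) (hρ : ρ.IsIrreducible) {v : V} (hv0 : v ≠ 0)
    (hv : ∀ a, ρ (inl ⟨0, a⟩) v = v) (a : F) (w : V) : ρ (inl ⟨0, a⟩) w = w := by
  refine apply_eq_self_of_exists ρ hρ (fun a : F => (inl ⟨0, a⟩ : Heis p F ⋊[R.subtype] R))
    (fun k a => ?_) hv0 hv a w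
  have := conj_inl k⁻¹ (⟨0, a⟩ : Heis p F)
  rw [Subgroup.subtype_apply, apply_mk_zero hR (k⁻¹).right.2, inv_inv, conj_eq] at this
  exact ⟨(((k⁻¹).right : MulAut (Heis p F)) ⟨0, a⟩).a, this.trans (by
    congr 1
    ext <;> simp [(Fact.out : p.Prime).ne_zero])⟩

theorem exists_center_weight {V : Type*} [AddCommGroup V] [Module ℂ V] [FiniteDimensional ℂ V]
    (ρ : Representation ℂ (Heis p F ⋊[R.subtype] R) V) (hρ : ρ.IsIrreducible) :
    (∀ a w, ρ (inl ⟨0, a⟩) w = w) ∨ ∃ c : F, c ≠ 0 ∧ ∃ v : V, v ≠ 0 ∧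
      ∀ a, ρ (inl ⟨0, a⟩) v = traceChar p F (c * a) • v := by
  have hV := ((isIrreducible_iff ρ).1 hρ).1
  obtain ⟨lam, v, hv0, hv⟩ := exists_weightSpace_ne_bot ρ
    (fun a : F => (inl ⟨0, a⟩ : Heis p F ⋊[R.subtype] R)) (fun a b => by
      rw [commute_iff_eq, ← map_mul, ← map_mul, ← map_mul, ← map_mul, mk_zero_mul, mk_zero_mul,
        add_comm])
  let χ : AddChar F ℂ :=
    { toFun := lam
      map_zero_eq_one' := eq_one_of_smul_eq_self hv0 (by
        rw [← hv]
        have : (inl ⟨0, 0⟩ : Heis p F ⋊[R.subtype] R) = 1 := map_one _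
        rw [this, map_one, Module.End.one_apply])
      map_add_eq_mul' := fun a b => by
        have h1 := hv (a + b)
        rw [← mk_zero_mul, map_mul, map_mul, Module.End.mul_apply, hv, map_smul, hv,
          smul_smul] at h1
        have h2 : (lam (a + b) - lam a * lam b) • v = 0 := by
          rw [sub_smul, ← h1, mul_comm, sub_self]
        exact sub_eq_zero.1 ((smul_eq_zero.1 h2).resolve_right hv0) }
  obtain ⟨c, hc⟩ := exists_eq_traceChar_mul (p := p) χ
  have hv' : ∀ a, ρ (inl ⟨0, a⟩) v = traceChar p F (c * a) • v := fun a => by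
    rw [hv, ← hc]; rfl
  by_cases hc0 : c = 0
  · exact Or.inl (apply_center_eq_self hR ρ hρ hv0 fun a => by
      rw [hv', hc0, zero_mul, AddChar.map_zero_eq_one, one_smul])
  · exact Or.inr ⟨c, hc0, v, hv0, hv'⟩

theorem exists_linear_weight {V : Type*} [AddCommGroup V] [Module ℂ V] [FiniteDimensional ℂ V]
    (ρ : Representation ℂ (Heis p F ⋊[R.subtype] R) V) (hρ : ρ.IsIrreducible)
    (hZ : ∀ a w, ρ (inl ⟨0, a⟩) w = w) :
    (∀ g w, ρ (inl g) w = w) ∨ ∃ c : F, c ≠ 0 ∧ ∃ v : V, v ≠ 0 ∧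
      ∀ g, ρ (inl g) v = traceChar p F (c * g.x) • v := by
  have hV := ((isIrreducible_iff ρ).1 hρ).1
  have hx : ∀ g : Heis p F, ρ (inl g) = ρ (inl ⟨g.x, 0⟩) := fun g => LinearMap.ext fun w => by
    conv_lhs => rw [eq_mul_mk_zero g]
    rw [map_mul, map_mul, Module.End.mul_apply, hZ]
  have hadd : ∀ x y : F, ρ (inl ⟨x, 0⟩) * ρ (inl ⟨y, 0⟩) = ρ (inl ⟨x + y, 0⟩) := fun x y => by
    rw [← map_mul, ← map_mul, hx]
    rfl
  obtain ⟨lam, v, hv0, hv⟩ := exists_weightSpace_ne_bot ρ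
    (fun a : F => (inl ⟨a, 0⟩ : Heis p F ⋊[R.subtype] R)) (fun a b => by
      rw [commute_iff_eq, hadd, hadd, add_comm])
  let χ : AddChar F ℂ :=
    { toFun := lam
      map_zero_eq_one' := eq_one_of_smul_eq_self hv0 (by
        rw [← hv]
        have : (inl ⟨0, 0⟩ : Heis p F ⋊[R.subtype] R) = 1 := map_one _
        rw [this, map_one, Module.End.one_apply])
      map_add_eq_mul' := fun a b => by
        have h1 := hv (a + b)
        rw [← hadd, Module.End.mul_apply, hv, map_smul, hv, smul_smul] at h1
        have h2 : (lam (a + b) - lam a * lam b) • v = 0 := by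
          rw [sub_smul, ← h1, mul_comm, sub_self]
        exact sub_eq_zero.1 ((smul_eq_zero.1 h2).resolve_right hv0) }
  obtain ⟨c, hc⟩ := exists_eq_traceChar_mul (p := p) χ
  have hv' : ∀ g, ρ (inl g) v = traceChar p F (c * g.x) • v := fun g => by
    rw [hx, hv, ← hc]; rfl
  by_cases hc0 : c = 0
  · left
    refine apply_eq_self_of_exists ρ hρ (fun g : Heis p F => (inl g : Heis p F ⋊[R.subtype] R))
      (fun k g => ?_) hv0 fun a => by rw [hv', hc0, zero_mul, AddChar.map_zero_eq_one, one_smul]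
    have := conj_inl k⁻¹ g
    rw [inv_inv] at this
    exact ⟨_, this⟩
  · exact Or.inr ⟨c, hc0, v, hv0, hv'⟩

end Heis
end BlockDegrees
end

/-! ### Possible degrees of the full group and of its Sylow subgroup -/

noncomputable section
set_option linter.unusedSectionVars false
namespace BlockDegrees

open Module SemidirectProduct

theorem apply_inl_apply_inr {N G V : Type*} [Group N] [Group G] {φ : G →* MulAut N}
    [AddCommGroup V] [Module ℂ V] (ρ : Representation ℂ (N ⋊[φ] G) V) (n : N) (g : G) (v : V) :
    ρ (inl n) (ρ (inr g) v) = ρ (inr g) (ρ (inl (φ g⁻¹ n)) v) := by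
  rw [← Module.End.mul_apply, ← Module.End.mul_apply, ← map_mul, ← map_mul]
  congr 2
  rw [inl_aut, inv_inv, ← mul_assoc, ← mul_assoc, ← map_mul, mul_inv_cancel, map_one, one_mul]

theorem finrank_eq_of_apply_inl_eq_self {N G V : Type*} [Group N] [Group G] [Finite N] [Finite G]
    {φ : G →* MulAut N} {p : ℕ} [Fact p.Prime] [AddCommGroup V] [Module ℂ V]
    [FiniteDimensional ℂ V] (ρ : Representation ℂ (N ⋊[φ] G) V) (hρ : ρ.IsIrreducible)
    (h : ∀ n w, ρ (inl n) w = w) (A : Subgroup G) [A.Normal] (hA : A.index = p)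
    (hcomm : ∀ a ∈ A, ∀ b ∈ A, a * b = b * a) : finrank ℂ V = 1 ∨ finrank ℂ V = p := by
  refine finrank_eq_one_or_eq_of_commute ρ hρ (A.comap rightHom)
    (by rw [Subgroup.index_comap_of_surjective _ rightHom_surjective, hA]) fun m n => ?_
  have key : ∀ k : N ⋊[φ] G, ρ k = ρ (inr k.right) := fun k => LinearMap.ext fun w => by
    conv_lhs => rw [← inl_left_mul_inr_right k]
    rw [map_mul, Module.End.mul_apply, h]
  rw [commute_iff_eq, key m, key n, ← map_mul, ← map_mul, ← map_mul, ← map_mul,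
    show (m : N ⋊[φ] G).right * (n : N ⋊[φ] G).right = _ from hcomm _ m.2 _ n.2]
  rfl

section Field

variable {p : ℕ} [Fact p.Prime] {F : Type*} [Field F] [Algebra (ZMod p) F] [Finite F]

theorem traceChar_mul_algEquiv (c z : F) (τ : F ≃ₐ[ZMod p] F) :
    traceChar p F (c * τ z) = traceChar p F (τ.symm c * z) := by
  rw [← traceChar_algEquiv τ (τ.symm c * z), map_mul τ, AlgEquiv.apply_symm_apply]

/-- Prime-field weights are fixed by all Galois automorphisms, so τ drops out of the condition. This
identifies the stabilizer of such a weight in `semilinearGroup` with the Galois group. -/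
theorem forall_traceChar_mul_algEquiv_iff {n : ZMod p} (hn : n ≠ 0) {c : F}
    (τ : F ≃ₐ[ZMod p] F) :
    (∀ z, traceChar p F (algebraMap _ F n * (c * τ z)) = traceChar p F (algebraMap _ F n * z)) ↔
      c = 1 := by
  have hn' : algebraMap (ZMod p) F n ≠ 0 := by rwa [Ne, map_eq_zero]
  refine ⟨fun h => ?_, ?_⟩
  · refine mul_left_cancel₀ hn' ((traceChar_mul_injective (p := p) fun z => ?_).trans
      (mul_one _).symm)
    have := h (τ.symm z)
    rwa [AlgEquiv.apply_symm_apply, ← mul_assoc, ← traceChar_algEquiv τ (_ * τ.symm z), map_mul τ,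
      AlgEquiv.apply_symm_apply, AlgEquiv.commutes] at this
  · rintro rfl z
    rw [one_mul, traceChar_mul_algEquiv, AlgEquiv.commutes]

theorem forall_traceChar_mul_iff_eq_one (hF : finrank (ZMod p) F = p) {c : F}
    (hc : c ∉ Set.range (algebraMap (ZMod p) F)) (τ : F ≃ₐ[ZMod p] F) :
    (∀ z, traceChar p F (c * τ z) = traceChar p F (c * z)) ↔ τ = 1 := by
  refine ⟨fun h => algEquiv_eq_one_of_apply_eq hF hc ?_, fun h z => by rw [h, AlgEquiv.one_apply]⟩
  refine ((AlgEquiv.symm_apply_eq τ).1 (traceChar_mul_injective (p := p) fun z => ?_)).symm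
  rw [← traceChar_mul_algEquiv, h]

end Field

namespace Heis

variable {p : ℕ} [Fact p.Prime] {F : Type*} [Field F] [CharP F p] [Algebra (ZMod p) F] [Finite F]

theorem mul_comm_of_mem_normOneGroup {f g : MulAut (Heis p F)} (hf : f ∈ normOneGroup p F)
    (hg : g ∈ normOneGroup p F) : f * g = g * f := by
  obtain ⟨t, -, rfl⟩ := hf
  obtain ⟨s, -, rfl⟩ := hg
  change act t 1 * act s 1 = act s 1 * act t 1
  rw [act_mul_act, act_mul_act]
  congr 1
  exact mul_comm t s

variable (hF : finrank (ZMod p) F = p)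
include hF

theorem card_normOneGroup : Nat.card (normOneGroup p F) = Nat.card (normOne p F) := by
  refine (Nat.card_congr (Equiv.ofBijective
    (fun t : normOne p F => (⟨act t 1, t, t.2, rfl⟩ : normOneGroup p F)) ⟨fun t s h => ?_, ?_⟩)).symm
  · exact Subtype.ext (act_injective (congrArg Subtype.val h)).1
  · rintro ⟨_, t, ht, rfl⟩
    exact ⟨⟨t, ht⟩, rfl⟩

theorem index_galGroup :
    ((galGroup p F).subgroupOf (semilinearGroup p F)).index = Nat.card (normOne p F) := by
  have h := ((galGroup p F).subgroupOf (semilinearGroup p F)).index_mul_card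
  rw [Nat.card_congr (Subgroup.subgroupOfEquivOfLe galGroup_le).toEquiv, card_galGroup hF,
    card_semilinearGroup hF] at h
  exact Nat.eq_of_mul_eq_mul_right (Fact.out : p.Prime).pos h

theorem index_normOneGroup :
    ((normOneGroup p F).subgroupOf (semilinearGroup p F)).index = p := by
  have h := ((normOneGroup p F).subgroupOf (semilinearGroup p F)).index_mul_card
  rw [Nat.card_congr (Subgroup.subgroupOfEquivOfLe normOneGroup_le).toEquiv, card_normOneGroup hF,
    card_semilinearGroup hF, mul_comm] at h
  exact Nat.eq_of_mul_eq_mul_left Nat.card_pos h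

omit hF in
instance normal_normOneGroup : ((normOneGroup p F).subgroupOf (semilinearGroup p F)).Normal where
  conj_mem := by
    rintro ⟨_, h⟩ ⟨t, ht, rfl⟩ ⟨_, s, hs, τ, rfl⟩
    refine ⟨Units.map (τ : F →* F) t, norm_algEquiv_mem τ ht, ?_⟩
    refine eq_mul_inv_of_mul_eq ?_
    refine (act_mul_act _ _ _ _).trans (Eq.trans ?_ (act_mul_act _ _ _ _).symm)
    congr 1
    rw [mul_comm]
    rfl

theorem card_subgroupOf_galGroup :
    Nat.card ((galGroup p F).subgroupOf (semilinearGroup p F)) = p ^ 1 := by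
  rw [Nat.card_congr (Subgroup.subgroupOfEquivOfLe galGroup_le).toEquiv, card_galGroup hF, pow_one]

variable (hp2 : p ≠ 2) {V : Type*} [AddCommGroup V] [Module ℂ V] [FiniteDimensional ℂ V]

section Semilinear

variable (ρ : Representation ℂ (Heis p F ⋊[(semilinearGroup p F).subtype] semilinearGroup p F) V)
  (hρ : ρ.IsIrreducible) {v : V} (hv0 : v ≠ 0)
include hρ hv0

include hp2 in
theorem semilinear_finrank_of_center_weight {n : ZMod p} (hn : n ≠ 0)
    (hv : ∀ a, ρ (inl ⟨0, a⟩) v = traceChar p F (algebraMap _ F n * a) • v) :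
    finrank ℂ V = Nat.card (normOne p F) * p ^ ((p - 1) / 2) := by
  have hn' : algebraMap (ZMod p) F n ≠ 0 := by rwa [Ne, map_eq_zero]
  rw [← index_galGroup hF]
  refine finrank_of_center_weight le_rfl hF hp2 ρ hρ hn' hv0 hv _ ?_ ?_ le_rfl
    (card_subgroupOf_galGroup hF)
  · rintro ⟨_, t, ht, τ, rfl⟩
    simp only [act_a, forall_traceChar_mul_algEquiv_iff hn]
    refine ⟨fun h => ?_, fun h => ?_⟩
    · obtain ⟨σ, h⟩ := h
      rw [← (act_injective h).1, Units.val_one, one_pow]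
    · obtain rfl := eq_one_of_pow_succ_eq_one hF hp2 ht h
      exact ⟨τ, rfl⟩
  · rintro ⟨_, h⟩ ⟨τ, rfl⟩ x hx
    obtain ⟨m, rfl⟩ := (mem_radical_algebraMap hF hp2 hn).1 hx
    ext
    · exact (one_mul _).trans (τ.commutes m)
    · simp

theorem semilinear_finrank_of_linear_weight {n : ZMod p} (hn : n ≠ 0)
    (hv : ∀ g, ρ (inl g) v = traceChar p F (algebraMap _ F n * g.x) • v) :
    finrank ℂ V = Nat.card (normOne p F) := by
  rw [← index_galGroup hF]
  refine finrank_of_linear_weight le_rfl hF ρ hρ (apply_center_eq_self le_rfl ρ hρ hv0 fun a => by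
      simp [hv]) hv0 hv _ ?_ le_rfl (card_subgroupOf_galGroup hF)
  rintro ⟨_, t, ht, τ, rfl⟩
  simp only [act_x, forall_traceChar_mul_algEquiv_iff hn]
  refine ⟨fun h => ?_, fun h => ?_⟩
  · obtain ⟨σ, h⟩ := h
    rw [← (act_injective h).1, Units.val_one]
  · obtain rfl : t = 1 := Units.ext h
    exact ⟨τ, rfl⟩

end Semilinear

include hp2 in
theorem semilinear_finrank
    (ρ : Representation ℂ (Heis p F ⋊[(semilinearGroup p F).subtype] semilinearGroup p F) V)
    (hρ : ρ.IsIrreducible) :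
    finrank ℂ V = 1 ∨ finrank ℂ V = p ∨ finrank ℂ V = Nat.card (normOne p F) ∨
      finrank ℂ V = Nat.card (normOne p F) * p ^ ((p - 1) / 2) := by
  have hinj : ∀ r, Function.Injective (ρ r) := fun r =>
    Function.LeftInverse.injective (g := ρ r⁻¹) fun w => by simp
  have hmem : ∀ s : Fˣ, s ∈ normOne p F → act s 1 ∈ semilinearGroup p F := fun s hs =>
    ⟨s, hs, 1, rfl⟩
  rcases exists_center_weight le_rfl ρ hρ with hZ | ⟨c, hc, v, hv0, hv⟩
  · rcases exists_linear_weight le_rfl ρ hρ hZ with hG | ⟨c, hc, v, hv0, hv⟩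
    · rcases finrank_eq_of_apply_inl_eq_self ρ hρ hG _ (index_normOneGroup hF)
        (fun a ha b hb => Subtype.ext (mul_comm_of_mem_normOneGroup ha hb)) with h | h
      · exact Or.inl h
      · exact Or.inr (Or.inl h)
    -- Translating the weight vector by a norm-one automorphism moves its weight into the prime
    -- field. The same is done below for the centre, where the automorphism acts through s^(p+1).
    · obtain ⟨s, hs, n, hn, e⟩ := exists_mul_eq_algebraMap hF hc
      refine Or.inr (Or.inr (Or.inl (semilinear_finrank_of_linear_weight hF ρ hρ
        (v := ρ (inr (⟨act s 1, hmem s hs⟩ : semilinearGroup p F)⁻¹) v) ?_ hn fun g => ?_)))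
      · rwa [Ne, map_eq_zero_iff _ (hinj _)]
      · rw [apply_inl_apply_inr, hv, map_smul, ← e, inv_inv, Subgroup.subtype_apply, act_x,
          AlgEquiv.one_apply, mul_assoc]
  · obtain ⟨s, hs, n, hn, e⟩ := exists_mul_pow_eq_algebraMap hF hp2 hc
    refine Or.inr (Or.inr (Or.inr (semilinear_finrank_of_center_weight hF hp2 ρ hρ
      (v := ρ (inr (⟨act s 1, hmem s hs⟩ : semilinearGroup p F)⁻¹) v) ?_ hn fun a => ?_)))
    · rwa [Ne, map_eq_zero_iff _ (hinj _)]
    · have e2 : act s 1 (⟨0, a⟩ : Heis p F) = ⟨0, s ^ (p + 1) * a⟩ := by ext <;> simp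
      rw [apply_inl_apply_inr, inv_inv, Subgroup.subtype_apply, e2, hv, map_smul, ← e, mul_assoc]

omit [Finite F] hF in
theorem mk_mem_bot_iff {τ : F ≃ₐ[ZMod p] F} (h : act 1 τ ∈ galGroup p F) :
    (⟨act 1 τ, h⟩ : galGroup p F) ∈ (⊥ : Subgroup (galGroup p F)) ↔ τ = 1 := by
  rw [Subgroup.mem_bot, Subtype.ext_iff]
  exact ⟨fun e => (act_injective (e.trans act_one_one.symm)).2, fun e => e ▸ act_one_one⟩

section Gal

variable (ρ : Representation ℂ (Heis p F ⋊[(galGroup p F).subtype] galGroup p F) V)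
  (hρ : ρ.IsIrreducible) {v : V} (hv0 : v ≠ 0)
include hρ hv0

include hp2 in
theorem gal_finrank_of_center_weight {n : ZMod p} (hn : n ≠ 0)
    (hv : ∀ a, ρ (inl ⟨0, a⟩) v = traceChar p F (algebraMap _ F n * a) • v) :
    finrank ℂ V = p ^ ((p - 1) / 2) := by
  have hn' : algebraMap (ZMod p) F n ≠ 0 := by rwa [Ne, map_eq_zero]
  have h := finrank_of_center_weight galGroup_le hF hp2 ρ hρ hn' hv0 hv ⊤ ?_ ?_ le_rfl
    (by rw [Subgroup.card_top, card_galGroup hF, pow_one])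
  · rwa [Subgroup.index_top, one_mul] at h
  · rintro ⟨_, τ, rfl⟩
    simpa using (forall_traceChar_mul_algEquiv_iff (p := p) (F := F) hn (c := 1) τ).2 rfl
  · rintro ⟨_, τ, rfl⟩ - x hx
    obtain ⟨m, rfl⟩ := (mem_radical_algebraMap hF hp2 hn).1 hx
    ext
    · exact (one_mul _).trans (τ.commutes m)
    · exact (congrArg _ (map_zero τ)).trans (mul_zero _)

theorem gal_finrank_of_linear_weight {n : ZMod p} (hn : n ≠ 0)
    (hv : ∀ g, ρ (inl g) v = traceChar p F (algebraMap _ F n * g.x) • v) :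
    finrank ℂ V = 1 := by
  rw [finrank_of_linear_weight galGroup_le hF ρ hρ (apply_center_eq_self galGroup_le ρ hρ hv0
    fun a => by simp [hv]) hv0 hv ⊤ ?_ le_rfl
    (by rw [Subgroup.card_top, card_galGroup hF, pow_one]), Subgroup.index_top]
  rintro ⟨_, τ, rfl⟩
  simpa using (forall_traceChar_mul_algEquiv_iff (p := p) (F := F) hn (c := 1) τ).2 rfl

include hp2 in
-- The source of the excess degree: since the Galois group has prime order, a weight outside the
-- prime field has trivial stabilizer, so an orbit of length p multiplies the degree p^((p-1)/2)
-- from `Heis p F`.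
theorem gal_finrank_of_center_weight' {c : F} (hc : c ∉ Set.range (algebraMap (ZMod p) F))
    (hv : ∀ a, ρ (inl ⟨0, a⟩) v = traceChar p F (c * a) • v) :
    finrank ℂ V = p * p ^ ((p - 1) / 2) := by
  have hc0 : c ≠ 0 := by
    rintro rfl
    exact hc ⟨0, map_zero _⟩
  have h := finrank_of_center_weight galGroup_le hF hp2 ρ hρ hc0 hv0 hv ⊥ ?_ ?_ (Nat.zero_le 1)
    (by rw [Subgroup.card_bot, pow_zero])
  · rwa [Subgroup.index_bot, card_galGroup hF] at h
  · rintro ⟨_, τ, rfl⟩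
    refine (mk_mem_bot_iff ⟨τ, rfl⟩).trans ?_
    simpa using (forall_traceChar_mul_iff_eq_one hF hc τ).symm
  · rintro r hr x hx
    rw [Subgroup.mem_bot] at hr
    rw [hr]
    rfl

theorem gal_finrank_of_linear_weight' {c : F} (hc : c ∉ Set.range (algebraMap (ZMod p) F))
    (hv : ∀ g, ρ (inl g) v = traceChar p F (c * g.x) • v) :
    finrank ℂ V = p := by
  rw [finrank_of_linear_weight galGroup_le hF ρ hρ (apply_center_eq_self galGroup_le ρ hρ hv0
    fun a => by simp [hv]) hv0 hv ⊥ ?_ (Nat.zero_le 1)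
    (by rw [Subgroup.card_bot, pow_zero]), Subgroup.index_bot, card_galGroup hF]
  rintro ⟨_, τ, rfl⟩
  refine (mk_mem_bot_iff ⟨τ, rfl⟩).trans ?_
  simpa using (forall_traceChar_mul_iff_eq_one hF hc τ).symm

end Gal

include hp2 in
theorem gal_finrank
    (ρ : Representation ℂ (Heis p F ⋊[(galGroup p F).subtype] galGroup p F) V)
    (hρ : ρ.IsIrreducible) :
    finrank ℂ V = 1 ∨ finrank ℂ V = p ∨ finrank ℂ V = p ^ ((p - 1) / 2) ∨
      finrank ℂ V = p * p ^ ((p - 1) / 2) := by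
  rcases exists_center_weight galGroup_le ρ hρ with hZ | ⟨c, hc, v, hv0, hv⟩
  · rcases exists_linear_weight galGroup_le ρ hρ hZ with hG | ⟨c, hc, v, hv0, hv⟩
    · rcases finrank_eq_of_apply_inl_eq_self ρ hρ hG ⊥
        (by rw [Subgroup.index_bot, card_galGroup hF])
        (fun a ha b hb => by rw [Subgroup.mem_bot.1 ha, Subgroup.mem_bot.1 hb]) with h | h
      · exact Or.inl h
      · exact Or.inr (Or.inl h)
    · by_cases hc' : c ∈ Set.range (algebraMap (ZMod p) F)
      · obtain ⟨n, rfl⟩ := hc'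
        exact Or.inl (gal_finrank_of_linear_weight hF ρ hρ hv0 (by simpa using hc) hv)
      · exact Or.inr (Or.inl (gal_finrank_of_linear_weight' hF ρ hρ hv0 hc' hv))
  · by_cases hc' : c ∈ Set.range (algebraMap (ZMod p) F)
    · obtain ⟨n, rfl⟩ := hc'
      exact Or.inr (Or.inr (Or.inl
        (gal_finrank_of_center_weight hF hp2 ρ hρ hv0 (by simpa using hc) hv)))
    · exact Or.inr (Or.inr (Or.inr (gal_finrank_of_center_weight' hF hp2 ρ hρ hv0 hc' hv)))

end Heis
end BlockDegrees
end

/-! ### Realization of all the degrees -/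

noncomputable section
set_option linter.unusedSectionVars false
namespace BlockDegrees

open Module SemidirectProduct

namespace Heis

variable {p : ℕ} [Fact p.Prime] {F : Type*} [Field F] [CharP F p] [Algebra (ZMod p) F] [Finite F]

theorem exists_isIrreducible_center_weight (R : Subgroup (MulAut (Heis p F))) (c : F) :
    ∃ (d : ℕ) (ρ : Representation ℂ (Heis p F ⋊[R.subtype] R) (Fin d → ℂ)) (v : Fin d → ℂ),
      ρ.IsIrreducible ∧ v ≠ 0 ∧ ∀ a, ρ (inl ⟨0, a⟩) v = traceChar p F (c * a) • v := by
  let j : Multiplicative F →* Heis p F :=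
    { toFun := fun a => ⟨0, a.toAdd⟩
      map_one' := rfl
      map_mul' := fun a b => (mk_zero_mul _ _).symm }
  have hj : Function.Injective j := fun a b h => congrArg Heis.a h
  obtain ⟨d, ρ, v, hρ, hv0, hv⟩ := exists_isIrreducible_of_injective
    ((inl : _ →* Heis p F ⋊[R.subtype] R).comp j) (inl_injective.comp hj)
    ((traceChar p F).mulShift c).toMonoidHom
  exact ⟨d, ρ, v, hρ, hv0, fun a => hv (Multiplicative.ofAdd a)⟩

theorem exists_isIrreducible_linear_weight (R : Subgroup (MulAut (Heis p F))) (c : F) :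
    ∃ (d : ℕ) (ρ : Representation ℂ (Heis p F ⋊[R.subtype] R) (Fin d → ℂ)) (v : Fin d → ℂ),
      ρ.IsIrreducible ∧ v ≠ 0 ∧ ∀ g, ρ (inl g) v = traceChar p F (c * g.x) • v :=
  exists_isIrreducible_of_injective (inl : _ →* Heis p F ⋊[R.subtype] R) inl_injective
    { toFun := fun g => traceChar p F (c * g.x)
      map_one' := by simp
      map_mul' := fun g h => by rw [mul_x, mul_add, AddChar.map_add_eq_mul] }

variable (hF : finrank (ZMod p) F = p)
include hF

/-- The elements of norm one together with the Frobenius map have an irreducible representation of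
degree `p`. -/
theorem exists_isIrreducible_semilinearGroup :
    ∃ ρ : Representation ℂ (semilinearGroup p F) (Fin p → ℂ), ρ.IsIrreducible := by
  have hp := (Fact.out : p.Prime).two_le
  have hm : 1 < Nat.card (normOne p F) := by
    rw [card_normOne hF]
    calc 1 < p ^ 0 + p ^ 1 := by simp; omega
      _ = ∑ i ∈ Finset.range 2, p ^ i := by rw [Finset.sum_range_succ, Finset.sum_range_one]
      _ ≤ _ := Finset.sum_le_sum_of_subset (Finset.range_mono hp)
  have := Finite.one_lt_card_iff_nontrivial.1 hm
  obtain ⟨t, ht⟩ := exists_ne (1 : normOne p F)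
  obtain ⟨θ, hθ⟩ := CommGroup.exists_apply_ne_one_of_hasEnoughRootsOfUnity (normOne p F) ℂ ht
  let j : normOne p F →* semilinearGroup p F :=
    { toFun := fun t => ⟨act t 1, t, t.2, 1, rfl⟩
      map_one' := Subtype.ext act_one_one
      map_mul' := fun t s => Subtype.ext ((congrArg₂ act rfl (one_mul 1).symm).trans
        (act_mul_act (t : Fˣ) (s : Fˣ) 1 1).symm) }
  have hj : Function.Injective j := fun t s h =>
    Subtype.ext (act_injective (congrArg Subtype.val h)).1
  obtain ⟨d, ρ, v, hρ, hv0, hv⟩ := exists_isIrreducible_of_injective j hj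
    ((Units.coeHom ℂ).comp θ)
  rcases finrank_eq_one_or_eq_of_commute ρ hρ ((normOneGroup p F).subgroupOf (semilinearGroup p F))
    (index_normOneGroup hF) (fun m n => by
      rw [commute_iff_eq, ← map_mul, ← map_mul]
      congr 1
      exact Subtype.ext (mul_comm_of_mem_normOneGroup m.2 n.2)) with h | h
  · exfalso
    let f : semilinearGroup p F :=
      ⟨act 1 (FiniteField.frobeniusAlgEquivOfAlgebraic (ZMod p) F), 1, one_mem _, _, rfl⟩
    -- Frobenius conjugates t to t^p. In degree one this forces θ(t) = θ(t)^p, so the order of θ(t)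
    -- divides p - 1 as well as the order of the norm-one group, and these are coprime.
    have hf : f * j t = j (t ^ p) * f := by
      refine Subtype.ext ?_
      refine (act_mul_act _ _ _ _).trans (Eq.trans ?_ (act_mul_act _ _ _ _).symm)
      congr 1
      ext
      simp [FiniteField.frobeniusAlgEquivOfAlgebraic_apply]
    obtain ⟨z, hz⟩ := (finrank_eq_one_iff_of_nonzero' v hv0).1 h (ρ f v)
    have hz0 : z • v ≠ 0 := by
      rw [hz]
      intro h0
      apply hv0
      simpa using congrArg (ρ f⁻¹) h0
    have h1 := congrArg (fun k => ρ k v) hf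
    simp only [map_mul, Module.End.mul_apply, hv] at h1
    rw [← hz, map_smul, map_smul, ← hz, hv, smul_comm z] at h1
    have h2 : θ t = θ t ^ p := by
      rw [← map_pow]
      exact Units.ext (smul_left_injective ℂ hz0 h1)
    have h3 : θ t ^ (p - 1) = 1 := by
      rw [← mul_left_inj (θ t), ← pow_succ, Nat.sub_add_cancel (by omega), one_mul, ← h2]
    have h4 : θ t ^ Nat.card (normOne p F) = 1 := by rw [← map_pow, pow_card_eq_one', map_one]
    refine hθ (orderOf_eq_one_iff.1 (Nat.dvd_one.1 ?_))
    rw [← (card_normOne_coprime_pred hF).gcd_eq_one]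
    exact Nat.dvd_gcd (orderOf_dvd_of_pow_eq_one h4) (orderOf_dvd_of_pow_eq_one h3)
  · rw [finrank_fin_fun] at h
    subst h
    exact ⟨ρ, hρ⟩

theorem cd_semilinear (hp2 : p ≠ 2) :
    cd (Irr (Heis p F ⋊[(semilinearGroup p F).subtype] semilinearGroup p F)) =
      {1, p, Nat.card (normOne p F), Nat.card (normOne p F) * p ^ ((p - 1) / 2)} := by
  ext n
  constructor
  · rw [mem_cd_Irr]
    rintro ⟨ρ, hρ⟩
    simpa using semilinear_finrank hF hp2 ρ hρ
  · have h1 : (1 : F) = algebraMap (ZMod p) F 1 := (map_one _).symm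
    rintro (rfl | rfl | rfl | rfl)
    · exact one_mem_cd
    · obtain ⟨ρ, hρ⟩ := exists_isIrreducible_semilinearGroup hF
      exact mem_cd_Irr.2 ⟨_, isIrreducible_comp ρ hρ rightHom rightHom_surjective⟩
    · obtain ⟨d, ρ, v, hρ, hv0, hv⟩ := exists_isIrreducible_linear_weight (semilinearGroup p F) 1
      rw [h1] at hv
      rw [← semilinear_finrank_of_linear_weight hF ρ hρ hv0 one_ne_zero hv]
      exact finrank_mem_cd ρ hρ
    · obtain ⟨d, ρ, v, hρ, hv0, hv⟩ := exists_isIrreducible_center_weight (semilinearGroup p F) 1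
      rw [h1] at hv
      rw [← semilinear_finrank_of_center_weight hF hp2 ρ hρ hv0 one_ne_zero hv]
      exact finrank_mem_cd ρ hρ

theorem exists_notMem_range_algebraMap : ∃ c : F, c ∉ Set.range (algebraMap (ZMod p) F) := by
  by_contra! h
  have h1 := Nat.card_le_card_of_surjective _ h
  rw [card_field hF, Nat.card_zmod] at h1
  have hp := (Fact.out : p.Prime).one_lt
  exact absurd h1 (not_le.2 (lt_self_pow₀ hp hp))

theorem cd_gal (hp2 : p ≠ 2) :
    cd (Irr (Heis p F ⋊[(galGroup p F).subtype] galGroup p F)) =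
      {1, p, p ^ ((p - 1) / 2), p * p ^ ((p - 1) / 2)} := by
  obtain ⟨c, hc⟩ := exists_notMem_range_algebraMap hF
  ext n
  constructor
  · rw [mem_cd_Irr]
    rintro ⟨ρ, hρ⟩
    simpa using gal_finrank hF hp2 ρ hρ
  · have h1 : (1 : F) = algebraMap (ZMod p) F 1 := (map_one _).symm
    rintro (rfl | h | rfl | rfl)
    · exact one_mem_cd
    · obtain ⟨d, ρ, v, hρ, hv0, hv⟩ := exists_isIrreducible_linear_weight (galGroup p F) c
      rw [h]
      have := finrank_mem_cd ρ hρ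
      rwa [gal_finrank_of_linear_weight' hF ρ hρ hv0 hc hv] at this
    · obtain ⟨d, ρ, v, hρ, hv0, hv⟩ := exists_isIrreducible_center_weight (galGroup p F) 1
      rw [h1] at hv
      rw [← gal_finrank_of_center_weight hF hp2 ρ hρ hv0 one_ne_zero hv]
      exact finrank_mem_cd ρ hρ
    · obtain ⟨d, ρ, v, hρ, hv0, hv⟩ := exists_isIrreducible_center_weight (galGroup p F) c
      rw [← gal_finrank_of_center_weight' hF hp2 ρ hρ hv0 hc hv]
      exact finrank_mem_cd ρ hρ

end Heis
end BlockDegrees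
end

/-! ### Solvability, Sylow subgroups and derived length -/

noncomputable section
set_option linter.unusedSectionVars false
namespace BlockDegrees

open Module SemidirectProduct
open scoped commutatorElement

theorem derivedLength_congr {K L : Type*} [Group K] [Group L] (e : K ≃* L) :
    derivedLength K = derivedLength L := by
  unfold derivedLength
  congr 1
  ext n
  rw [Set.mem_ofPred_eq, Set.mem_ofPred_eq, ← map_derivedSeries_eq (f := e.toMonoidHom) e.surjective,
    Subgroup.map_eq_bot_iff_of_injective _ e.injective]

theorem derivedLength_eq {K : Type*} [Group K] {n : ℕ} (h1 : derivedSeries K (n + 1) = ⊥)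
    (h2 : derivedSeries K n ≠ ⊥) : derivedLength K = n + 1 := by
  refine le_antisymm (Nat.sInf_le h1) (le_csInf ⟨_, h1⟩ fun m hm => ?_)
  by_contra! h
  exact h2 (le_bot_iff.1 ((derivedSeries_antitone _ (Nat.lt_succ_iff.1 h)).trans (le_of_eq hm)))

/-- A normal subgroup of order prime to p meets `G` trivially, hence centralizes it, hence lies in
`G`. -/
theorem pPrimeCore_eq_bot_of_centralizer_le {K : Type*} [Group K] [Finite K] {p : ℕ}
    [Fact p.Prime] (G : Subgroup K) [G.Normal] (hG : IsPGroup p G)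
    (hC : Subgroup.centralizer (G : Set K) ≤ G) : pPrimeCore p K = ⊥ := by
  refine le_bot_iff.1 (sSup_le fun N ⟨hN, hcop⟩ => ?_)
  obtain ⟨n, hn⟩ := (IsPGroup.iff_card (p := p)).1 hG
  have hdis : Disjoint N G := Subgroup.disjoint_of_coprime_natCard (by
    rw [hn]
    exact hcop.pow_right n)
  refine fun k hk => hdis.le_bot ⟨hk, hC ?_⟩
  exact Subgroup.mem_centralizer_iff.2 fun g hg =>
    (Subgroup.commute_of_normal_of_disjoint N G hN inferInstance hdis k g hk hg).eq.symm

namespace Heis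

variable {p : ℕ} [Fact p.Prime] {F : Type*} [Field F] [CharP F p] [Algebra (ZMod p) F] [Finite F]

theorem eq_inl_of_commute {R : Subgroup (MulAut (Heis p F))} (hR : R ≤ semilinearGroup p F)
    {k : Heis p F ⋊[R.subtype] R} (hk : ∀ g, k * inl g = inl g * k) : k = inl k.left := by
  have h1 : ∀ g, ((k.right : MulAut (Heis p F)) g).x = g.x := fun g => by
    have e := conj_inl k g
    rw [hk, mul_inv_cancel_right, inl_inj, Subgroup.subtype_apply, conj_eq] at e
    exact (congrArg Heis.x e).symm
  obtain ⟨t, -, τ, h⟩ := hR k.right.2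
  have h2 : act t τ = act (p := p) 1 1 := by
    have h3 : ∀ x : F, t * τ x = x := fun x => by
      have := h1 ⟨x, 0⟩
      rwa [← h] at this
    obtain rfl : t = 1 := Units.ext (by simpa using h3 1)
    congr 1
    ext x
    simpa using h3 x
  ext1
  · simp
  · exact Subtype.ext (h.symm.trans (h2.trans act_one_one))

theorem centralizer_range_inl_le {R : Subgroup (MulAut (Heis p F))} (hR : R ≤ semilinearGroup p F) :
    Subgroup.centralizer ((inl : Heis p F →* Heis p F ⋊[R.subtype] R).range : Set _) ≤
      (inl : Heis p F →* Heis p F ⋊[R.subtype] R).range := fun k hk =>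
  ⟨k.left, (eq_inl_of_commute hR fun g => (Subgroup.mem_centralizer_iff.1 hk _ ⟨g, rfl⟩).symm).symm⟩

instance normal_range_inl {N G : Type*} [Group N] [Group G] {φ : G →* MulAut N} :
    (inl : N →* N ⋊[φ] G).range.Normal := by
  rw [range_inl_eq_ker_rightHom]
  infer_instance

theorem isPGroup_range_inl (R : Subgroup (MulAut (Heis p F))) :
    IsPGroup p (inl : Heis p F →* Heis p F ⋊[R.subtype] R).range :=
  isPGroup.of_surjective _ (MonoidHom.rangeRestrict_surjective _)

section Solvable

variable (hF : finrank (ZMod p) F = p)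
include hF

theorem isSolvable_semilinear :
    Group.IsSolvable (Heis p F ⋊[(semilinearGroup p F).subtype] semilinearGroup p F) := by
  let N := (normOneGroup p F).subgroupOf (semilinearGroup p F)
  have h1 : Group.IsSolvable N := Group.isSolvable_of_comm fun a b =>
    Subtype.ext (Subtype.ext (mul_comm_of_mem_normOneGroup a.2 b.2))
  have h2 : IsPGroup p (semilinearGroup p F ⧸ N) :=
    IsPGroup.of_card (n := 1) (by rw [pow_one]; exact index_normOneGroup hF)
  have := h2.isNilpotent
  have h3 : Group.IsSolvable (semilinearGroup p F) :=
    (Group.isSolvable_iff_subgroup_quotient N).2 ⟨h1, inferInstance⟩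
  have := (isPGroup (p := p) (F := F)).isNilpotent
  exact Group.isSolvable_of_ker_le_range inl rightHom (range_inl_eq_ker_rightHom).ge

/-- The Sylow `p`-subgroups of the group with all semilinear maps. -/
def sylowEquiv (P : Sylow p (Heis p F ⋊[(semilinearGroup p F).subtype] semilinearGroup p F)) :
    P ≃* Heis p F ⋊[(galGroup p F).subtype] galGroup p F := by
  let f : Heis p F ⋊[(galGroup p F).subtype] galGroup p F →*
      Heis p F ⋊[(semilinearGroup p F).subtype] semilinearGroup p F :=
    SemidirectProduct.map (MonoidHom.id _) (Subgroup.inclusion galGroup_le) fun g => rfl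
  have hf : Function.Injective f := fun x y h => by
    have h1 : (f x).left = (f y).left := congrArg _ h
    have h2 : (f x).right = (f y).right := congrArg _ h
    exact SemidirectProduct.ext h1 (Subgroup.inclusion_injective _ h2)
  have hcard : Nat.card f.range = p ^ (Nat.card (Heis p F ⋊[(semilinearGroup p F).subtype]
      semilinearGroup p F)).factorization p := by
    rw [← Nat.card_congr (f.ofInjective hf).toEquiv, SemidirectProduct.card,
      SemidirectProduct.card, card_heis hF, card_galGroup hF, card_semilinearGroup hF, ← pow_succ,
      mul_comm (Nat.card _), ← mul_assoc, ← pow_succ, Nat.factorization_mul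
      (pow_ne_zero _ (Fact.out : p.Prime).ne_zero) Nat.card_pos.ne']
    have h0 : (Nat.card (normOne p F)).factorization p = 0 :=
      Nat.factorization_eq_zero_of_not_dvd fun h => (Fact.out : p.Prime).one_lt.ne'
        (Nat.dvd_one.1 ((card_normOne_coprime_self hF).gcd_eq_one ▸ Nat.dvd_gcd h dvd_rfl))
    simp [h0, (Fact.out : p.Prime).factorization_self]
  exact (P.equiv (Sylow.ofCard f.range hcard)).trans (f.ofInjective hf).symm

/-- Equality for all v would give a polynomial of degree at most p^2, with coefficient -x at p^2,
that vanishes on all p^p elements of `F`; but p > 2. -/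
theorem exists_pow_mul_ne (hp2 : p ≠ 2) {x : F} (hx : x ≠ 0) :
    ∃ v : F, x ^ p * (v ^ p - v) ≠ x * (v ^ p - v) ^ p := by
  have := Fintype.ofFinite F
  by_contra! h
  have hp := (Fact.out : p.Prime).two_le
  open Polynomial in
  let P : F[X] := C (-x) * X ^ p ^ 2 + (C (x ^ p + x) * X ^ p + C (-x ^ p) * X)
  have hcoeff : P.coeff (p ^ 2) = -x := by
    have h1 : p ^ 2 ≠ 1 := by nlinarith
    have h2 : p ^ 2 ≠ p := by nlinarith
    simp only [P, Polynomial.coeff_add, Polynomial.coeff_C_mul, Polynomial.coeff_X_pow,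
      Polynomial.coeff_X, if_true, if_neg h1.symm, if_neg h2, mul_one, mul_zero, add_zero]
  have hdeg : P.natDegree ≤ p ^ 2 := by
    have h1 : 1 ≤ p ^ 2 := by nlinarith
    have h2 : p ≤ p ^ 2 := by nlinarith
    simp only [P]
    compute_degree
    all_goals omega
  have hP : P = 0 := Polynomial.eq_zero_of_natDegree_lt_card_of_eval_eq_zero' P Finset.univ
    (fun v _ => by
      have := h v
      rw [sub_pow_char, ← pow_mul, ← sq] at this
      simp only [P, Polynomial.eval_add, Polynomial.eval_mul, Polynomial.eval_C,
        Polynomial.eval_pow, Polynomial.eval_X]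
      linear_combination this)
    (by
      rw [Finset.card_univ, ← Nat.card_eq_fintype_card, card_field hF]
      have hp3 : 2 < p := by omega
      exact hdeg.trans_lt (Nat.pow_lt_pow_right (by omega) hp3))
  rw [hP, Polynomial.coeff_zero] at hcoeff
  exact hx (neg_eq_zero.1 hcoeff.symm)

theorem derivedLength_gal (hp2 : p ≠ 2) :
    derivedLength (Heis p F ⋊[(galGroup p F).subtype] galGroup p F) = 3 := by
  set H := Heis p F ⋊[(galGroup p F).subtype] galGroup p F
  let xHom : Heis p F →* Multiplicative F :=
    { toFun := fun g => Multiplicative.ofAdd g.x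
      map_one' := rfl
      map_mul' := fun _ _ => rfl }
  have hcomm : ∀ a b : galGroup p F, a * b = b * a := by
    have : IsCyclic (galGroup p F) := isCyclic_of_prime_card (card_galGroup hF)
    exact IsCyclic.commGroup.mul_comm
  have h1 : derivedSeries H 1 ≤ (⊤ : Subgroup (Heis p F)).map inl := by
    rw [derivedSeries_succ, derivedSeries_zero, Subgroup.commutator_le, ← MonoidHom.range_eq_map,
      range_inl_eq_ker_rightHom]
    intro a _ b _
    rw [MonoidHom.mem_ker, map_commutatorElement, commutatorElement_eq_one_iff_mul_comm, hcomm]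
  have h2 : derivedSeries H 2 ≤ xHom.ker.map inl := by
    rw [derivedSeries_succ]
    refine (Subgroup.commutator_mono h1 h1).trans ?_
    rw [← Subgroup.map_commutator]
    exact Subgroup.map_mono (Abelianization.commutator_subset_ker xHom)
  have h3 : derivedSeries H 3 = ⊥ := by
    rw [derivedSeries_succ, ← le_bot_iff]
    refine (Subgroup.commutator_mono h2 h2).trans ?_
    rw [← Subgroup.map_commutator, ← Subgroup.map_bot inl]
    refine Subgroup.map_mono (Subgroup.commutator_le.2 fun a ha b hb => ?_)
    have ha' : a.x = 0 := ha
    have hb' : b.x = 0 := hb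
    rw [Subgroup.mem_bot, commutatorElement_eq_one_iff_mul_comm]
    ext <;> simp [ha', hb', add_comm]
  refine derivedLength_eq h3 fun h => ?_
  let f : galGroup p F := ⟨_, FiniteField.frobeniusAlgEquivOfAlgebraic (ZMod p) F, rfl⟩
  -- Commutators of Frobenius with `Heis p F` have first coordinates u^p - u. Two of them can be
  -- chosen not to commute, so the second derived subgroup is nontrivial.
  have key : ∀ u : F, ∃ g : Heis p F, g.x = u ^ p - u ∧ (inl g : H) ∈ derivedSeries H 1 :=
    fun u => by
      have h4 : ⁅(inr f : H), (inl ⟨u, 0⟩ : H)⁆ ∈ derivedSeries H 1 := by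
        rw [derivedSeries_succ, derivedSeries_zero]
        exact Subgroup.commutator_mem_commutator (Subgroup.mem_top _) (Subgroup.mem_top _)
      rw [commutatorElement_def, ← map_inv inr, ← inl_aut, ← map_inv, ← map_mul] at h4
      refine ⟨_, ?_, h4⟩
      simp [f, FiniteField.frobeniusAlgEquivOfAlgebraic_apply, act, sub_eq_add_neg]
  obtain ⟨u, hu⟩ := exists_notMem_range_algebraMap hF
  have hx : u ^ p - u ≠ 0 := fun h0 => hu ((pow_sq_eq_self_iff hF hp2).1 (by
    rw [sq, pow_mul, sub_eq_zero.1 h0, sub_eq_zero.1 h0]))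
  obtain ⟨v, hv⟩ := exists_pow_mul_ne hF hp2 hx
  obtain ⟨g, hg, hg1⟩ := key u
  obtain ⟨k, hk, hk1⟩ := key v
  have h5 := Subgroup.commutator_mem_commutator hg1 hk1
  rw [← derivedSeries_succ, h, Subgroup.mem_bot, ← map_commutatorElement,
    map_eq_one_iff _ inl_injective, commutatorElement_def, mul_inv_eq_one, conj_eq, hg, hk] at h5
  have h6 := congrArg Heis.a h5
  simp only [add_eq_left, mul_eq_zero, two_ne_zero_of_charP (F := F) hp2, false_or] at h6
  exact hv (sub_eq_zero.1 h6)

end Solvable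

end Heis
end BlockDegrees
end

/-! ### Transport along isomorphisms and the refutations -/

noncomputable section
set_option linter.unusedSectionVars false
namespace BlockDegrees

open Module SemidirectProduct

namespace Heis

variable {p : ℕ} [Fact p.Prime] {F : Type*} [Field F] [CharP F p] [Algebra (ZMod p) F] [Finite F]
  (hF : finrank (ZMod p) F = p) {K : Type*} [Group K] [Finite K]
  (e : K ≃* Heis p F ⋊[(semilinearGroup p F).subtype] semilinearGroup p F)
include hF e

theorem card_of_equiv : Nat.card K = p ^ (2 * p + 1) * Nat.card (normOne p F) := by
  rw [Nat.card_congr e.toEquiv, SemidirectProduct.card, card_heis hF, card_semilinearGroup hF,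
    pow_succ, mul_assoc, mul_comm p]

theorem isSolvable_of_equiv : Group.IsSolvable K := by
  have := isSolvable_semilinear hF
  exact Group.isSolvable_of_isSolvable_injective (f := e.toMonoidHom) e.injective

omit hF in
theorem exists_normal_of_equiv : ∃ N : Subgroup K, N.Normal ∧ IsPGroup p N ∧
    Subgroup.centralizer (N : Set K) ≤ N := by
  let G := (inl : Heis p F →* Heis p F ⋊[(semilinearGroup p F).subtype] semilinearGroup p F).range
  refine ⟨G.comap e.toMonoidHom, inferInstance, ?_, fun k hk => ?_⟩
  · exact (isPGroup_range_inl _).comap_of_injective _ e.injective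
  · refine centralizer_range_inl_le le_rfl (Subgroup.mem_centralizer_iff.2 fun g hg => ?_)
    have := Subgroup.mem_centralizer_iff.1 hk (e.symm g) (by
      change e (e.symm g) ∈ G
      rwa [e.apply_symm_apply])
    simpa using congrArg e this

omit hF in
theorem pPrimeCore_of_equiv : pPrimeCore p K = ⊥ := by
  obtain ⟨N, hN, hp, hC⟩ := exists_normal_of_equiv e
  exact pPrimeCore_eq_bot_of_centralizer_le N hp hC

omit hF in
theorem Irr_of_equiv {M : Ideal (integralClosure ℤ ℂ)} (hM : M.IsMaximal)
    (hp : (p : integralClosure ℤ ℂ) ∈ M) : Irr K = principalBlock K M := by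
  obtain ⟨N, hN, hp', hC⟩ := exists_normal_of_equiv e
  exact Irr_eq_principalBlock_of_centralizer_le N hp' hC hM hp

theorem cd_of_equiv (hp2 : p ≠ 2) : cd (Irr K) =
    {1, p, Nat.card (normOne p F), Nat.card (normOne p F) * p ^ ((p - 1) / 2)} := by
  rw [cd_Irr_congr e, cd_semilinear hF hp2]

theorem heights_of_equiv (hp2 : p ≠ 2) : heights p (Irr K) = {0, 1, (p - 1) / 2} := by
  have h0 : padicValNat p (Nat.card (normOne p F)) = 0 :=
    padicValNat.eq_zero_of_not_dvd fun h => (Fact.out : p.Prime).one_lt.ne'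
      (Nat.dvd_one.1 ((card_normOne_coprime_self hF).gcd_eq_one ▸ Nat.dvd_gcd h dvd_rfl))
  have h1 : padicValNat p (Nat.card (normOne p F) * p ^ ((p - 1) / 2)) = (p - 1) / 2 := by
    rw [padicValNat.mul Nat.card_pos.ne' (pow_ne_zero _ (Fact.out : p.Prime).ne_zero), h0,
      padicValNat.prime_pow, zero_add]
  rw [heights_eq_image one_mem_cd, cd_of_equiv hF e hp2]
  ext n
  simp [Set.image_insert_eq, h0, h1]
  tauto

theorem nonempty_sylow_equiv (P : Sylow p K) :
    Nonempty (P ≃* Heis p F ⋊[(galGroup p F).subtype] galGroup p F) := by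
  have e' := (P : Subgroup K).equivMapOfInjective e.toMonoidHom e.injective
  have hcard : Nat.card ((P : Subgroup K).map e.toMonoidHom) = p ^ (Nat.card (Heis p F
      ⋊[(semilinearGroup p F).subtype] semilinearGroup p F)).factorization p := by
    rw [← Nat.card_congr e'.toEquiv, ← Nat.card_congr e.toEquiv]
    exact P.card_eq_multiplicity
  exact ⟨e'.trans (sylowEquiv hF (Sylow.ofCard _ hcard))⟩

theorem cd_sylow (hp2 : p ≠ 2) (P : Sylow p K) :
    cd (Irr P) = {1, p, p ^ ((p - 1) / 2), p * p ^ ((p - 1) / 2)} := by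
  obtain ⟨f⟩ := nonempty_sylow_equiv hF e P
  rw [cd_Irr_congr f, cd_gal hF hp2]

theorem derivedLength_sylow (hp2 : p ≠ 2) (P : Sylow p K) : derivedLength P = 3 := by
  obtain ⟨f⟩ := nonempty_sylow_equiv hF e P
  rw [derivedLength_congr f, derivedLength_gal hF hp2]

end Heis

theorem not_fengLiuZhang {p : ℕ} (hp : p.Prime) (hp2 : p ≠ 2) {M : Ideal (integralClosure ℤ ℂ)}
    (hM : M.IsMaximal) (hpM : (p : integralClosure ℤ ℂ) ∈ M) : ¬ FengLiuZhang p M := by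
  have := Fact.mk hp
  intro h
  have hF : finrank (ZMod p) (GaloisField p p) = p := GaloisField.finrank p hp.ne_zero
  let K := Heis p (GaloisField p p) ⋊[(Heis.semilinearGroup p (GaloisField p p)).subtype]
    Heis.semilinearGroup p (GaloisField p p)
  let e : K ≃* K := MulEquiv.refl K
  obtain ⟨P⟩ := (inferInstance : Nonempty (Sylow p K))
  have h3 : 3 ≤ p := by have := hp.two_le; omega
  have h4 := h K (principalBlock K M) (isBlock_principalBlock K M) P
    (by rw [← Heis.Irr_of_equiv e hM hpM]; exact isDefectGroup_Irr M P)
    -- The largest degree of the defect group is p · p^((p-1)/2), while the heights are 0, 1 and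
    -- (p-1)/2. The hypothesis p ≥ 3 makes (p-1)/2 at least 1, hence the largest.
    ((p - 1) / 2 + 1) ((p - 1) / 2)
    (by
      rw [Heis.cd_sylow hF e hp2]
      refine ⟨by simp [pow_succ, mul_comm], ?_⟩
      have h5 : ∀ k ≤ (p - 1) / 2 + 1, p ^ k ≤ p ^ ((p - 1) / 2 + 1) := fun k hk =>
        Nat.pow_le_pow_right hp.pos hk
      rintro n (rfl | rfl | rfl | rfl)
      · simpa using h5 0 (by omega)
      · simpa using h5 1 (by omega)
      · exact h5 _ (by omega)
      · rw [pow_succ, mul_comm])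
    (by
      rw [← Heis.Irr_of_equiv e hM hpM, Heis.heights_of_equiv hF e hp2]
      refine ⟨by simp, ?_⟩
      rintro n (rfl | rfl | rfl) <;> omega)
  omega

theorem not_derivedLengthLeHeights {M : Ideal (integralClosure ℤ ℂ)}
    (hM : M.IsMaximal) (hpM : (3 : integralClosure ℤ ℂ) ∈ M) : ¬ DerivedLengthLeHeights 3 M := by
  have := Fact.mk Nat.prime_three
  intro h
  have hF : finrank (ZMod 3) (GaloisField 3 3) = 3 := GaloisField.finrank 3 three_ne_zero
  let K := Heis 3 (GaloisField 3 3) ⋊[(Heis.semilinearGroup 3 (GaloisField 3 3)).subtype]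
    Heis.semilinearGroup 3 (GaloisField 3 3)
  let e : K ≃* K := MulEquiv.refl K
  obtain ⟨P⟩ := (inferInstance : Nonempty (Sylow 3 K))
  have h4 := h K (Heis.isSolvable_of_equiv hF e) (principalBlock K M) (isBlock_principalBlock K M) P
    (by rw [← Heis.Irr_of_equiv e hM (by exact_mod_cast hpM)]; exact isDefectGroup_Irr M P)
  rw [Heis.derivedLength_sylow hF e (by norm_num), ← Heis.Irr_of_equiv e hM (by exact_mod_cast hpM),
    Heis.heights_of_equiv hF e (by norm_num)] at h4
  have : ({0, 1, (3 - 1) / 2} : Set ℕ) = {0, 1} := by ext; simp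
  rw [this, Set.ncard_pair zero_ne_one] at h4
  omega

end BlockDegrees
end

/-! ### Additive maps compatible with the norm-one elements -/

noncomputable section
set_option linter.unusedSectionVars false
namespace BlockDegrees

open Module

section Additive

variable {p : ℕ} [Fact p.Prime] {F : Type*} [Field F] [Algebra (ZMod p) F] [Finite F]
  (hF : finrank (ZMod p) F = p)
include hF

theorem exists_eq_algebraMap_mul {y : F} (hy : y ≠ 0) :
    ∃ n : ZMod p, n ≠ 0 ∧ ∃ t ∈ normOne p F, y = algebraMap (ZMod p) F n * t := by
  obtain ⟨t, ht, n, hn, h⟩ := exists_mul_eq_algebraMap hF hy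
  refine ⟨n, hn, t⁻¹, inv_mem ht, ?_⟩
  rw [← h, mul_assoc, ← Units.val_mul, mul_inv_cancel, Units.val_one, mul_one]

omit [Finite F] hF in
theorem map_algebraMap_mul (g : F →+ F) (n : ZMod p) (x : F) :
    g (algebraMap (ZMod p) F n * x) = algebraMap (ZMod p) F n * g x := by
  rw [← Algebra.smul_def, ← Algebra.smul_def, ZMod.map_smul]

/-- An additive map that is equivariant for the elements of norm one is linear. -/
theorem map_mul_of_forall_normOne {g : F →+ F} (h : ∀ t ∈ normOne p F, ∀ x, g (t * x) = t * g x)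
    (x y : F) : g (y * x) = y * g x := by
  rcases eq_or_ne y 0 with rfl | hy
  · simp
  · obtain ⟨n, -, t, ht, rfl⟩ := exists_eq_algebraMap_mul hF hy
    rw [mul_assoc, map_algebraMap_mul, h t ht, mul_assoc]

/-- An additive map that normalizes the elements of norm one is semilinear. -/
theorem exists_eq_mul_algEquiv {g : F →+ F} (hg : Function.Injective g)
    (h : ∀ t ∈ normOne p F, ∃ s : F, ∀ x, g (t * x) = s * g x) :
    ∃ (c : Fˣ) (τ : F ≃ₐ[ZMod p] F), ∀ x, g x = c * τ x := by
  have hc : g 1 ≠ 0 := fun h0 => one_ne_zero (hg (h0.trans (map_zero g).symm))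
  -- Normalized so that 1 goes to 1, the map is multiplicative on norm-one factors; since these and
  -- the prime-field scalars give all nonzero elements, it is a field automorphism.
  let k : F →ₗ[ZMod p] F :=
    { toFun := fun x => (g 1)⁻¹ * g x
      map_add' := fun x y => by rw [map_add, mul_add]
      map_smul' := fun n x => by rw [ZMod.map_smul, mul_smul_comm, RingHom.id_apply] }
  have hk1 : k 1 = 1 := inv_mul_cancel₀ hc
  have hkt : ∀ t ∈ normOne p F, ∀ x, k (t * x) = k t * k x := fun t ht x => by
    obtain ⟨s, hs⟩ := h t ht
    have h1 := hs 1
    rw [mul_one] at h1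
    change (g 1)⁻¹ * g (t * x) = (g 1)⁻¹ * g t * ((g 1)⁻¹ * g x)
    rw [hs, h1]
    field_simp
  have hkmul : ∀ y x, k (y * x) = k y * k x := fun y x => by
    rcases eq_or_ne y 0 with rfl | hy
    · simp
    · obtain ⟨n, -, t, ht, rfl⟩ := exists_eq_algebraMap_mul hF hy
      rw [mul_assoc, ← Algebra.smul_def, ← Algebra.smul_def, map_smul, map_smul, hkt t ht,
        smul_mul_assoc]
  let τ := AlgEquiv.ofBijective (AlgHom.ofLinearMap k hk1 hkmul)
    (Finite.injective_iff_bijective.1 (RingHom.injective (AlgHom.ofLinearMap k hk1 hkmul).toRingHom))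
  refine ⟨Units.mk0 _ hc, τ, fun x => ?_⟩
  change g x = g 1 * ((g 1)⁻¹ * g x)
  rw [mul_inv_cancel_left₀ hc]

end Additive

/-- Choose t ≠ 1 of norm one and write 1 + t = ±s with s of norm one. Computing g(1 + t) in two ways
gives ±s^4 = 1 + t^4 unless g(1) = 0, and both signs are impossible in characteristic 3. Once g(1) =
0, equivariance gives g = 0. This rules out automorphisms that shear the quotient into the centre
and commute with the norm-one group. -/
theorem eq_zero_of_map_mul_eq_pow_mul {F : Type*} [Field F] [Algebra (ZMod 3) F] [Finite F]
    (hF : finrank (ZMod 3) F = 3) {g : F →+ F}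
    (h : ∀ t ∈ normOne 3 F, ∀ x, g (t * x) = (t : F) ^ 4 * g x) (x : F) : g x = 0 := by
  have hdec : ∀ n : ZMod 3, n ≠ 0 → n = 1 ∨ n = -1 := by decide
  have := Fact.mk Nat.prime_three
  have hchar : CharP F 3 := charP_of_injective_algebraMap (algebraMap (ZMod 3) F).injective 3
  have h3 : (3 : F) = 0 := by exact_mod_cast CharP.cast_eq_zero F 3
  have hcard : Nat.card (normOne 3 F) = 13 := by rw [card_normOne hF]; decide
  suffices h1 : g 1 = 0 by
    rcases eq_or_ne x 0 with rfl | hx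
    · exact map_zero g
    · obtain ⟨n, -, t, ht, rfl⟩ := exists_eq_algebraMap_mul hF hx
      rw [map_algebraMap_mul, ← mul_one (t : F), h t ht, h1, mul_zero, mul_zero]
  have := Finite.one_lt_card_iff_nontrivial.1 (by rw [hcard]; norm_num :
    1 < Nat.card (normOne 3 F))
  obtain ⟨⟨t, ht⟩, ht1⟩ := exists_ne (1 : normOne 3 F)
  replace ht1 : t ≠ 1 := fun e => ht1 (Subtype.ext e)
  have ht4 : (t : F) ^ 4 ≠ 1 := fun e => ht1 (eq_one_of_pow_succ_eq_one hF (by norm_num) ht e)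
  have ht1' : (t : F) ≠ 1 := fun e => ht1 (Units.ext e)
  have hne : 1 + (t : F) ≠ 0 := fun e => ht4 (by
    rw [eq_neg_of_add_eq_zero_right e]; norm_num)
  obtain ⟨n, hn, s, hs, hns⟩ := exists_eq_algebraMap_mul hF hne
  have hn2 : n = 1 ∨ n = -1 := hdec n hn
  have h5 : g (1 + t) = (1 + (t : F) ^ 4) * g 1 := by
    rw [map_add, ← mul_one (t : F), h t ht, mul_one]; ring
  rw [hns, map_algebraMap_mul, ← mul_one (s : F), h s hs] at h5
  by_contra h0
  have h6 : algebraMap (ZMod 3) F n * (s : F) ^ 4 = 1 + (t : F) ^ 4 :=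
    mul_right_cancel₀ h0 ((mul_assoc _ _ _).trans h5)
  rcases hn2 with rfl | rfl
  · rw [map_one, one_mul] at hns h6
    rw [← hns] at h6
    -- For the sign + the relation (1 + t)^4 = 1 + t^4 leaves t + t^3 = 0, so t^2 = -1 and t^4 = 1.
    have h7 : (t : F) * (1 + t ^ 2) = 0 := by
      linear_combination h6 - (t + 2 * t ^ 2 + t ^ 3) * h3
    have h8 := (mul_eq_zero.1 h7).resolve_left t.ne_zero
    exact ht4 (by linear_combination (t ^ 2 - 1) * h8)
  · rw [map_neg, map_one] at hns h6
    have h9 : (s : F) = -(1 + t) := by linear_combination hns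
    rw [h9] at h6
    -- For the sign - the relation (1 + t)^4 + 1 + t^4 = 0 is, in characteristic 3, this fourth
    -- power up to sign.
    have h7 : ((t : F) - 1) ^ 4 = 0 := by
      linear_combination h6 + (1 + 4 * t ^ 2 + t ^ 4) * h3
    exact ht1' (sub_eq_zero.1 (pow_eq_zero_iff (by norm_num) |>.1 h7))

end BlockDegrees
end

/-! ### Automorphisms of `Heis` that normalize the norm-one group -/

noncomputable section
set_option linter.unusedSectionVars false
namespace BlockDegrees

open Module
open scoped commutatorElement

namespace Heis

section

variable {p : ℕ} [Fact p.Prime] {F : Type*} [Field F] [CharP F p] [Algebra (ZMod p) F] [Finite F]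
  (hF : finrank (ZMod p) F = p) (hp2 : p ≠ 2)
include hF hp2

theorem mem_center_iff {h : Heis p F} : h ∈ Subgroup.center (Heis p F) ↔ h.x = 0 := by
  have h2 := two_ne_zero_of_charP (F := F) hp2
  rw [Subgroup.mem_center_iff]
  constructor
  · intro hh
    have key : ∀ y : F, y ^ p * h.x = y * h.x ^ p := fun y => by
      have e := conj_eq ⟨y, 0⟩ h
      rw [hh, mul_inv_cancel_right] at e
      have e2 := congrArg Heis.a e
      simp only [left_eq_add, mul_eq_zero, h2, false_or] at e2
      exact sub_eq_zero.1 e2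
    have k1 := key 1
    rw [one_pow, one_mul, one_mul] at k1
    by_contra h0
    obtain ⟨y, hy⟩ := exists_notMem_range_algebraMap hF
    have k2 := key y
    rw [← k1] at k2
    have k3 := mul_right_cancel₀ h0 k2
    exact hy ((pow_sq_eq_self_iff hF hp2).1 (by rw [sq, pow_mul, k3, k3]))
  · intro h0 g
    ext <;> simp [h0, (Fact.out : p.Prime).ne_zero, add_comm]

theorem apply_mk_zero_x (f : MulAut (Heis p F)) (a : F) : (f ⟨0, a⟩).x = 0 := by
  rw [← mem_center_iff hF hp2]
  have h1 : (⟨0, a⟩ : Heis p F) ∈ (Subgroup.center (Heis p F)).comap f.toMonoidHom := by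
    rw [Subgroup.characteristic_iff_comap_eq.1 inferInstance f, mem_center_iff hF hp2]
  exact h1

theorem apply_x_eq (f : MulAut (Heis p F)) (g : Heis p F) : (f g).x = (f ⟨g.x, 0⟩).x := by
  conv_lhs => rw [eq_mul_mk_zero g]
  rw [map_mul, mul_x, apply_mk_zero_x hF hp2, add_zero]

/-- The additive map that an automorphism induces on the abelianization. -/
def xMap (f : MulAut (Heis p F)) : F →+ F where
  toFun x := (f ⟨x, 0⟩).x
  map_zero' := apply_mk_zero_x hF hp2 f 0
  map_add' x y := by
    rw [← mul_x, ← map_mul, apply_x_eq hF hp2 f (_ * _)]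
    rfl

theorem apply_x_eq_xMap (f : MulAut (Heis p F)) (g : Heis p F) : (f g).x = xMap hF hp2 f g.x :=
  apply_x_eq hF hp2 f g

theorem xMap_act (t : Fˣ) (τ : F ≃ₐ[ZMod p] F) (x : F) : xMap hF hp2 (act t τ) x = t * τ x := rfl

theorem xMap_injective (f : MulAut (Heis p F)) : Function.Injective (xMap hF hp2 f) := by
  rw [injective_iff_map_eq_zero]
  intro x hx
  have h1 := apply_mk_zero_x hF hp2 f⁻¹ (f ⟨x, 0⟩).a
  have h2 : (⟨0, (f ⟨x, 0⟩).a⟩ : Heis p F) = f ⟨x, 0⟩ := Heis.ext hx.symm rfl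
  rwa [h2, MulAut.inv_apply_self] at h1

/-- On the abelianization the automorphism is semilinear. Dividing by the corresponding `act c τ`
leaves one that is trivial there and commutes with the norm-one group. -/
theorem exists_eq_act_mul {f : MulAut (Heis p F)}
    (hf : ∀ t ∈ normOne p F, ∃ s ∈ normOne p F, f * act t 1 = act s 1 * f) :
    ∃ (c : Fˣ) (τ : F ≃ₐ[ZMod p] F), ∃ h : MulAut (Heis p F), f = act c τ * h ∧
      (∀ g, (h g).x = g.x) ∧ ∀ t ∈ normOne p F, h * act t 1 = act t 1 * h := by
  obtain ⟨c, τ, hcτ⟩ := exists_eq_mul_algEquiv hF (xMap_injective hF hp2 f) fun t ht => by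
    obtain ⟨s, hs, e⟩ := hf t ht
    refine ⟨s, fun x => ?_⟩
    have e1 := congrArg Heis.x (DFunLike.congr_fun e ⟨x, 0⟩)
    simp only [MulAut.mul_apply, apply_x_eq_xMap hF hp2] at e1
    exact e1
  have hx : ∀ g, (((act c τ)⁻¹ * f) g).x = g.x := fun g => by
    have h1 : (act c τ (((act c τ)⁻¹ * f) g)).x = c * τ g.x := by
      rw [MulAut.mul_apply, MulAut.apply_inv_self, apply_x_eq_xMap hF hp2, hcτ]
    rw [act_x] at h1
    exact τ.injective (mul_left_cancel₀ c.ne_zero h1)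
  refine ⟨c, τ, (act c τ)⁻¹ * f, (mul_inv_cancel_left _ _).symm, hx, fun t ht => ?_⟩
  obtain ⟨s, hs, e⟩ := hf t ht
  have h2 : s * c = c * Units.map (τ : F →* F) t := by
    ext
    have e1 := congrArg Heis.x (DFunLike.congr_fun e ⟨1, 0⟩)
    simp only [MulAut.mul_apply, apply_x_eq_xMap hF hp2, hcτ, xMap_act, AlgEquiv.one_apply,
      mul_one, map_one] at e1
    exact e1.symm
  have h3 : act (p := p) s 1 * act c τ = act c τ * act t 1 := by
    rw [act_mul_act, act_mul_act]
    congr 1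
  refine mul_left_cancel (a := act c τ) ?_
  rw [← mul_assoc, mul_inv_cancel_left, e, ← mul_assoc, ← h3, mul_assoc, mul_inv_cancel_left]

/-- Norm-one elements are (p+1)-th powers of norm-one elements, so commuting with their action makes
`h` linear over `F` on the centre. Commutators depend only on first coordinates, so `h` fixes a
nonzero central element and hence the whole centre. -/
theorem apply_mk_zero_eq {h : MulAut (Heis p F)} (hx : ∀ g, (h g).x = g.x)
    (ht : ∀ t ∈ normOne p F, h * act t 1 = act t 1 * h) (a : F) : h ⟨0, a⟩ = ⟨0, a⟩ := by
  let m : F →+ F :=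
    { toFun := fun a => (h ⟨0, a⟩).a
      map_zero' := by
        have := congrArg Heis.a (map_one h)
        exact this
      map_add' := fun a b => by
        rw [← mk_zero_mul, map_mul, mul_a, hx, hx]
        simp }
  have hm : ∀ t ∈ normOne p F, ∀ a, m (t * a) = t * m a := fun t ht' a => by
    obtain ⟨s, hs⟩ := (powCoprime (card_normOne_coprime_succ hF hp2)).surjective ⟨t, ht'⟩
    have hs' : ((s : Fˣ) : F) ^ (p + 1) = t := by
      rw [← Units.val_pow_eq_pow_val]
      exact congrArg Units.val (congrArg Subtype.val hs)
    have e := congrArg Heis.a (DFunLike.congr_fun (ht s s.2) ⟨0, a⟩)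
    simp only [MulAut.mul_apply, act_a, AlgEquiv.one_apply, hs'] at e
    refine Eq.trans ?_ e
    change (h ⟨0, _⟩).a = _
    congr 2
    ext
    · simp
    · simp [hs']
  obtain ⟨u, hu⟩ := exists_notMem_range_algebraMap hF
  have hb : 2 * (u ^ p - u) ≠ 0 := mul_ne_zero (two_ne_zero_of_charP hp2) fun h0 =>
    hu ((pow_sq_eq_self_iff hF hp2).1 (by rw [sq, pow_mul, sub_eq_zero.1 h0, sub_eq_zero.1 h0]))
  have hmb : m (2 * (u ^ p - u)) = 2 * (u ^ p - u) := by
    have e1 := conj_eq (h ⟨u, 0⟩) (h ⟨1, 0⟩)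
    have e2 := conj_eq (⟨u, 0⟩ : Heis p F) ⟨1, 0⟩
    rw [← map_inv, ← map_mul, ← map_mul, e2, eq_mul_mk_zero ⟨1, _⟩, map_mul] at e1
    have e3 := congrArg Heis.a e1
    simp only [mul_a, hx] at e3
    change (h ⟨0, _⟩).a = _
    simpa [(Fact.out : p.Prime).ne_zero] using e3
  have hm1 : m 1 = 1 := by
    have := map_mul_of_forall_normOne hF hm 1 (2 * (u ^ p - u))
    rw [mul_one, hmb] at this
    exact mul_left_cancel₀ hb (this.symm.trans (mul_one _).symm)
  refine Heis.ext (hx _) ?_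
  have := map_mul_of_forall_normOne hF hm 1 a
  rwa [hm1, mul_one] at this

end

variable {F : Type*} [Field F] [CharP F 3] [Algebra (ZMod 3) F] [Finite F]
  (hF : finrank (ZMod 3) F = 3)
include hF

/-- The remaining factor `h` is trivial on quotient and centre, so it is given by an additive map
`l` from the quotient to the centre. Commuting with the norm-one group means l(t x) = t^4 l(x),
which forces `l` to vanish. -/
theorem exists_eq_act {f : MulAut (Heis 3 F)}
    (hf : ∀ t ∈ normOne 3 F, ∃ s ∈ normOne 3 F, f * act t 1 = act s 1 * f) :
    ∃ (c : Fˣ) (τ : F ≃ₐ[ZMod 3] F), f = act c τ := by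
  obtain ⟨c, τ, h, rfl, hx, ht⟩ := exists_eq_act_mul hF (by norm_num) hf
  refine ⟨c, τ, mul_eq_left.2 (MulEquiv.ext fun g => ?_)⟩
  have hz := apply_mk_zero_eq hF (by norm_num) hx ht
  let l : F →+ F :=
    { toFun := fun x => (h ⟨x, 0⟩).a
      map_zero' := congrArg Heis.a (hz 0)
      map_add' := fun x y => by
        have e : (⟨x, 0⟩ * ⟨y, 0⟩ : Heis 3 F) = ⟨x + y, 0⟩ * ⟨0, x ^ 3 * y - x * y ^ 3⟩ := by
          ext <;> simp
        have e2 := congrArg Heis.a (congrArg h e)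
        rw [map_mul, map_mul, hz] at e2
        simp only [mul_a, hx] at e2
        simpa using e2.symm }
  have hl := eq_zero_of_map_mul_eq_pow_mul hF (g := l) fun t ht' x => by
    have e := congrArg Heis.a (DFunLike.congr_fun (ht t ht') ⟨x, 0⟩)
    simp only [MulAut.mul_apply, act_a, AlgEquiv.one_apply] at e
    rw [show l x = (h ⟨x, 0⟩).a from rfl, ← e]
    change (h ⟨_, 0⟩).a = _
    congr 2
    ext <;> simp
  rw [eq_mul_mk_zero g, map_mul, hz]
  congr 1
  exact Heis.ext (hx _) (hl _)

end Heis
end BlockDegrees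
end

/-! ### Sylow conjugacy and the normalizer of the norm-one group -/

noncomputable section
set_option linter.unusedSectionVars false
namespace BlockDegrees

open Module

section Sylow

variable {A : Type*} [Group A] [Finite A] {p : ℕ} [Fact p.Prime]

theorem exists_map_conj_eq {P Q : Subgroup A} (hP : Nat.card P = p ^ (Nat.card A).factorization p)
    (hQ : Nat.card Q = p ^ (Nat.card A).factorization p) :
    ∃ g : A, P.map (MulAut.conj g).toMonoidHom = Q := by
  obtain ⟨g, hg⟩ := MulAction.exists_smul_eq A (Sylow.ofCard P hP) (Sylow.ofCard Q hQ)
  exact ⟨g, congrArg Sylow.toSubgroup hg⟩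

theorem exists_mem_map_conj_eq {N P Q : Subgroup A} (hPN : P ≤ N) (hQN : Q ≤ N)
    (hP : Nat.card P = p ^ (Nat.card N).factorization p)
    (hQ : Nat.card Q = p ^ (Nat.card N).factorization p) :
    ∃ g ∈ N, P.map (MulAut.conj g).toMonoidHom = Q := by
  obtain ⟨g, hg⟩ := exists_map_conj_eq (p := p)
    ((Nat.card_congr (Subgroup.subgroupOfEquivOfLe hPN).toEquiv).trans hP)
    ((Nat.card_congr (Subgroup.subgroupOfEquivOfLe hQN).toEquiv).trans hQ)
  refine ⟨g, g.2, ?_⟩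
  have h1 := congrArg (Subgroup.map N.subtype) hg
  rw [Subgroup.map_map, Subgroup.subgroupOf_map_subtype, inf_eq_left.2 hQN] at h1
  rw [← h1]
  conv_lhs => rw [← inf_eq_left.2 hPN, ← Subgroup.subgroupOf_map_subtype, Subgroup.map_map]
  rfl

/-- Sylow's theorem is used twice: first to carry `Q` to `T`, then inside the normalizer of `T` to
carry the image of `D` to `S`. The second conjugation does not disturb `T`. -/
theorem exists_map_sylow_sup_eq {A' : Type*} [Group A'] [Finite A'] (e : A' ≃* A) {q : ℕ}
    [Fact q.Prime] {T S : Subgroup A} (hT : Nat.card T = q ^ (Nat.card A).factorization q)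
    (hS : S ≤ Subgroup.normalizer T)
    (hS' : Nat.card S = p ^ (Nat.card (Subgroup.normalizer (T : Set A))).factorization p)
    (Q : Sylow q A') (D : Sylow p (Subgroup.normalizer (Q : Set A'))) :
    ∃ g : A, ((D : Subgroup (Subgroup.normalizer (Q : Set A'))).map (Subgroup.subtype _) ⊔
      (Q : Subgroup A')).map (e.trans (MulAut.conj g)).toMonoidHom = S ⊔ T := by
  obtain ⟨g₁, h₁⟩ := exists_map_conj_eq (p := q)
    (P := (Q : Subgroup A').map e.toMonoidHom) (Q := T)
    (by rw [← Nat.card_congr ((Q : Subgroup A').equivMapOfInjective e.toMonoidHom e.injective).toEquiv,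
      ← Nat.card_congr e.toEquiv]; exact Q.card_eq_multiplicity) hT
  set D₀ := (D : Subgroup (Subgroup.normalizer (Q : Set A'))).map (Subgroup.subtype _)
  let f := e.trans (MulAut.conj g₁)
  have hQ : (Q : Subgroup A').map f.toMonoidHom = T := by
    rw [← h₁, Subgroup.map_map]
    rfl
  have hN : (Subgroup.normalizer (Q : Set A')).map f.toMonoidHom = Subgroup.normalizer T := by
    rw [← hQ]
    exact Subgroup.map_equiv_normalizer_eq (Q : Subgroup A') f
  have hD : D₀.map f.toMonoidHom ≤ Subgroup.normalizer T := by
    rw [← hN]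
    exact Subgroup.map_mono (Subgroup.map_subtype_le _)
  obtain ⟨g₂, hg₂, h₂⟩ := exists_mem_map_conj_eq (p := p) hD hS (by
    rw [← hN, ← Nat.card_congr (Subgroup.equivMapOfInjective _ f.toMonoidHom f.injective).toEquiv,
      ← Nat.card_congr (Subgroup.equivMapOfInjective _ f.toMonoidHom f.injective).toEquiv,
      ← Nat.card_congr (Subgroup.equivMapOfInjective _ (Subgroup.subtype _)
        (Subgroup.subtype_injective _)).toEquiv]
    exact D.card_eq_multiplicity) hS'
  have h₃ : T.map (MulAut.conj g₂).toMonoidHom = T := Subgroup.mem_normalizer_iff_map_conj_eq.1 hg₂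
  refine ⟨g₂ * g₁, ?_⟩
  have hcomp : (e.trans (MulAut.conj (g₂ * g₁))).toMonoidHom =
      (MulAut.conj g₂).toMonoidHom.comp f.toMonoidHom := by
    ext a
    simp [f, mul_assoc]
  rw [hcomp, ← Subgroup.map_map, Subgroup.map_sup, Subgroup.map_sup, h₂, hQ, h₃]

end Sylow

namespace Heis

variable {F : Type*} [Field F] [Algebra (ZMod 3) F] [Finite F]

theorem galGroup_sup_normOneGroup {p : ℕ} [Fact p.Prime] [CharP F p] [Algebra (ZMod p) F] :
    galGroup p F ⊔ normOneGroup p F = semilinearGroup p F := by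
  refine le_antisymm (sup_le galGroup_le normOneGroup_le) ?_
  rintro _ ⟨t, ht, τ, rfl⟩
  have h : act t τ = act (p := p) t 1 * act 1 τ := by rw [act_mul_act]; simp
  rw [h]
  exact mul_mem (Subgroup.mem_sup_right ⟨t, ht, rfl⟩) (Subgroup.mem_sup_left ⟨τ, rfl⟩)

variable [CharP F 3]

theorem mem_normalizer_iff (hF : finrank (ZMod 3) F = 3) {f : MulAut (Heis 3 F)} :
    f ∈ Subgroup.normalizer (normOneGroup 3 F : Set (MulAut (Heis 3 F))) ↔
      ∃ (c : Fˣ) (τ : F ≃ₐ[ZMod 3] F), f = act c τ := by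
  constructor
  · intro hf
    refine exists_eq_act hF fun t ht => ?_
    obtain ⟨s, hs, h⟩ := (Subgroup.mem_normalizer_iff.1 hf _).1 ⟨t, ht, rfl⟩
    exact ⟨s, hs, (mul_inv_eq_iff_eq_mul.1 h.symm)⟩
  · rintro ⟨c, τ, rfl⟩
    refine Subgroup.mem_normalizer_iff_map_conj_eq.2 (Subgroup.eq_of_le_of_card_ge ?_ ?_)
    · rintro _ ⟨_, ⟨t, ht, rfl⟩, rfl⟩
      refine ⟨Units.map (τ : F →* F) t, norm_algEquiv_mem τ ht, ?_⟩
      refine eq_mul_inv_of_mul_eq ?_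
      refine (act_mul_act _ _ _ _).trans (Eq.trans ?_ (act_mul_act _ _ _ _).symm)
      congr 1
      rw [mul_comm]
      rfl
    · rw [← Nat.card_congr (Subgroup.equivMapOfInjective _ _ (MulAut.conj (act c τ)).injective).toEquiv]

variable (hF : finrank (ZMod 3) F = 3)
include hF

theorem card_normalizer :
    Nat.card (Subgroup.normalizer (normOneGroup 3 F : Set (MulAut (Heis 3 F)))) = 78 := by
  have h1 : Nat.card Fˣ = 26 := by
    rw [Nat.card_units, card_field hF]
    rfl
  refine Eq.trans ?_ (congrArg₂ (· * ·) h1 (card_algEquiv hF))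
  rw [← Nat.card_prod]
  refine (Nat.card_congr (Equiv.ofBijective
    (fun x : Fˣ × (F ≃ₐ[ZMod 3] F) => (⟨act x.1 x.2, (mem_normalizer_iff hF).2 ⟨_, _, rfl⟩⟩ :
      Subgroup.normalizer (normOneGroup 3 F : Set (MulAut (Heis 3 F))))) ⟨fun x y h => ?_, ?_⟩)).symm
  · obtain ⟨h1, h2⟩ := act_injective (congrArg Subtype.val h)
    exact Prod.ext h1 h2
  · rintro ⟨f, hf⟩
    obtain ⟨c, τ, rfl⟩ := (mem_normalizer_iff hF).1 hf
    exact ⟨(c, τ), rfl⟩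

theorem card_normOne_three : Nat.card (normOne 3 F) = 13 := by rw [card_normOne hF]; decide

/-- A subgroup of order 13 that is not Sylow has index divisible by 13 in its normalizer, but here
that index is 78 / 13 = 6. -/
theorem card_normOneGroup_eq [Fact (Nat.Prime 13)] : Nat.card (normOneGroup 3 F) =
    13 ^ (Nat.card (MulAut (Heis 3 F))).factorization 13 := by
  have h13 : Nat.card (normOneGroup 3 F) = 13 ^ 1 := by
    rw [card_normOneGroup hF, card_normOne_three hF, pow_one]
  rw [h13]
  congr 1
  have h13' : Nat.Prime 13 := Fact.out
  refine le_antisymm ((h13'.pow_dvd_iff_le_factorization Nat.card_pos.ne').1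
    (h13 ▸ Subgroup.card_subgroup_dvd_card _)) ?_
  by_contra! h
  have h1 := Sylow.prime_dvd_card_quotient_normalizer
    ((h13'.pow_dvd_iff_le_factorization Nat.card_pos.ne').2 h) h13
  have h2 := Subgroup.card_eq_card_quotient_mul_card_subgroup ((normOneGroup 3 F).subgroupOf
    (Subgroup.normalizer (normOneGroup 3 F : Set (MulAut (Heis 3 F)))))
  rw [card_normalizer hF, Nat.card_congr (Subgroup.subgroupOfEquivOfLe
    (Subgroup.le_normalizer (H := normOneGroup 3 F))).toEquiv, h13] at h2
  obtain ⟨k, hk⟩ := h1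
  change Nat.card (_ ⧸ (normOneGroup 3 F).subgroupOf _) = _ at hk
  omega

theorem card_galGroup_eq : Nat.card (galGroup 3 F) = 3 ^ (Nat.card (Subgroup.normalizer
    (normOneGroup 3 F : Set (MulAut (Heis 3 F))))).factorization 3 := by
  have h : Nat.factorization 78 3 = 1 := by
    rw [show 78 = 3 * 26 from rfl, Nat.factorization_mul (by norm_num) (by norm_num)]
    simp [Nat.prime_three.factorization_self, Nat.factorization_eq_zero_of_not_dvd]
  rw [card_galGroup hF, card_normalizer hF, h, pow_one]

theorem galGroup_le_normalizer :
    galGroup 3 F ≤ Subgroup.normalizer (normOneGroup 3 F : Set (MulAut (Heis 3 F))) := by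
  rintro _ ⟨τ, rfl⟩
  exact (mem_normalizer_iff hF).2 ⟨1, τ, rfl⟩

end Heis
end BlockDegrees
end

/-! ### Identification of `G729` and of the group H -/

noncomputable section
set_option linter.unusedSectionVars false
namespace BlockDegrees

open Module

instance : Finite G729 :=
  Finite.of_injective (fun g => (g.v, g.a)) fun _ _ e =>
    G729.ext (congrArg Prod.fst e) (congrArg Prod.snd e)

theorem card_G729 : Nat.card G729 = 729 := by
  have e : G729 ≃ (Fin 3 → ZMod 3) × (Fin 3 → ZMod 3) :=
    ⟨fun g => (g.v, g.a), fun z => ⟨z.1, z.2⟩, fun _ => rfl, fun _ => rfl⟩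
  rw [Nat.card_congr e]
  simp

section Iso

variable {F : Type*} [Field F] [CharP F 3] [Algebra (ZMod 3) F] [Finite F]
  (hF : finrank (ZMod 3) F = 3)
include hF

/-- For n in the prime field, the pair (n s u, s) has value n s^4 (u^3 - u). With u outside the
prime field, these products with s of norm one reach every nonzero z. -/
theorem exists_eq_pow_mul_sub (z : F) : ∃ x y : F, z = x ^ 3 * y - x * y ^ 3 := by
  have := Fact.mk Nat.prime_three
  rcases eq_or_ne z 0 with rfl | hz
  · exact ⟨0, 0, by simp⟩
  obtain ⟨u, hu⟩ := Heis.exists_notMem_range_algebraMap hF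
  have hb : u ^ 3 - u ≠ 0 := fun h0 =>
    hu ((Heis.pow_sq_eq_self_iff hF (by norm_num)).1 (by
      rw [sq, pow_mul, sub_eq_zero.1 h0, sub_eq_zero.1 h0]))
  obtain ⟨t, -, n, hn, h⟩ := exists_mul_pow_eq_algebraMap hF (by norm_num) (div_ne_zero hz hb)
  have hn3 : (algebraMap (ZMod 3) F n) ^ 3 = algebraMap (ZMod 3) F n := by
    rw [← map_pow, ZMod.pow_card]
  refine ⟨algebraMap (ZMod 3) F n * (t⁻¹ : Fˣ) * u, (t⁻¹ : Fˣ), ?_⟩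
  have ht : (t : F) * (t⁻¹ : Fˣ) = 1 := by rw [← Units.val_mul, mul_inv_cancel, Units.val_one]
  set s : F := ((t⁻¹ : Fˣ) : F)
  have h1 : z = algebraMap (ZMod 3) F n * s ^ 4 * (u ^ 3 - u) := by
    rw [← h, mul_assoc (z / _), ← mul_pow, ht, one_pow, mul_one, div_mul_cancel₀ _ hb]
  rw [h1]
  linear_combination (-s ^ 4 * u ^ 3) * hn3

/-- The group of order `3 ^ 6` in terms of the field with 27 elements. -/
theorem exists_equiv_heis : Nonempty (G729 ≃* Heis 3 F) := by
  have := Fact.mk Nat.prime_three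
  let b : Basis (Fin 3) (ZMod 3) F := finBasisOfFinrankEq (ZMod 3) F hF
  let φ : (Fin 3 → ZMod 3) ≃ₗ[ZMod 3] F := b.equivFun.symm
  have hφ : ∀ v, φ v = algebraMap _ F (v 0) * b 0 + algebraMap _ F (v 1) * b 1 +
      algebraMap _ F (v 2) * b 2 := fun v => by
    rw [Basis.equivFun_symm_apply, Fin.sum_univ_three]
    simp only [Algebra.smul_def]
  let β : F → F → F := fun x y => x ^ 3 * y - x * y ^ 3
  -- The map on centres through which the alternating bilinear form β factors by way of the cross
  -- product. It is onto because the values of β already exhaust `F`.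
  let ψ : (Fin 3 → ZMod 3) →+ F :=
    { toFun := fun a => algebraMap _ F (a 0) * β (b 1) (b 2) + algebraMap _ F (a 1) * β (b 2) (b 0) +
        algebraMap _ F (a 2) * β (b 0) (b 1)
      map_zero' := by simp
      map_add' := fun x y => by simp; ring }
  have hψ : ∀ v w, ψ (v ⨯₃ w) = φ v ^ 3 * φ w - φ v * φ w ^ 3 := fun v w => by
    have h3 : ∀ n : ZMod 3, (algebraMap (ZMod 3) F n) ^ 3 = algebraMap (ZMod 3) F n := fun n => by
      rw [← map_pow, ZMod.pow_card]
    rw [hφ, hφ]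
    simp only [add_pow_char, mul_pow, h3]
    simp only [ψ, β, cross_apply, AddMonoidHom.coe_mk, ZeroHom.coe_mk, Matrix.cons_val_zero,
      Matrix.cons_val_one, Matrix.cons_val, map_sub, map_mul]
    ring
  have hsurj : Function.Surjective ψ := fun z => by
    obtain ⟨x, y, rfl⟩ := exists_eq_pow_mul_sub hF z
    exact ⟨φ.symm x ⨯₃ φ.symm y, by rw [hψ, φ.apply_symm_apply, φ.apply_symm_apply]⟩
  let Φ : G729 →* Heis 3 F :=
    MonoidHom.mk' (fun g => ⟨φ g.v, ψ g.a⟩) fun g h => by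
      refine Heis.ext ?_ ?_
      · simp
      · simp [hψ]
  have hΦ : Function.Surjective Φ := fun h => by
    obtain ⟨a, ha⟩ := hsurj h.a
    exact ⟨⟨φ.symm h.x, a⟩, Heis.ext (φ.apply_symm_apply _) ha⟩
  refine ⟨MulEquiv.ofBijective Φ ((Nat.bijective_iff_surjective_and_card Φ).2 ⟨hΦ, ?_⟩)⟩
  rw [card_G729, Heis.card_heis hF]
  norm_num

theorem exists_groupH_equiv (Q : Sylow 13 (MulAut G729))
    (D : Sylow 3 (Subgroup.normalizer (Q : Set (MulAut G729)))) :
    Nonempty (GroupH Q D ≃*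
      Heis 3 F ⋊[(Heis.semilinearGroup 3 F).subtype] Heis.semilinearGroup 3 F) := by
  have := Fact.mk Nat.prime_three
  have : Fact (Nat.Prime 13) := ⟨by norm_num⟩
  obtain ⟨Φ⟩ := exists_equiv_heis hF
  obtain ⟨g, hg⟩ := exists_map_sylow_sup_eq (MulAut.congr Φ) (Heis.card_normOneGroup_eq hF)
    (Heis.galGroup_le_normalizer hF) (Heis.card_galGroup_eq hF) Q D
  rw [Heis.galGroup_sup_normOneGroup] at hg
  let f := (MulAut.congr Φ).trans (MulAut.conj g)
  let e : groupR Q D ≃* Heis.semilinearGroup 3 F :=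
    ((groupR Q D).equivMapOfInjective f.toMonoidHom f.injective).trans (MulEquiv.subgroupCongr hg)
  refine ⟨SemidirectProduct.congr (Φ.trans g) e fun r => MulEquiv.ext fun x => ?_⟩
  change g (Φ ((r : MulAut G729) x)) = f r (g (Φ x))
  simp [f, MulAut.congr]

end Iso

end BlockDegrees
end

/-! ### The main theorem -/

theorem mainTheorem8 :
    -- the group `H`
    (∀ (Q : Sylow 13 (MulAut BlockDegrees.G729))
      (D : Sylow 3 (Subgroup.normalizer (Q : Set (MulAut BlockDegrees.G729))))
      (M : Ideal (integralClosure ℤ ℂ)), M.IsMaximal → (3 : integralClosure ℤ ℂ) ∈ M →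
      Nat.card BlockDegrees.G729 = 729 ∧
      Nat.card (BlockDegrees.GroupH Q D) = 3 ^ 7 * 13 ∧
      Group.IsSolvable (BlockDegrees.GroupH Q D) ∧
      BlockDegrees.pPrimeCore 3 (BlockDegrees.GroupH Q D) = ⊥ ∧
      BlockDegrees.Irr (BlockDegrees.GroupH Q D) =
        BlockDegrees.principalBlock (BlockDegrees.GroupH Q D) M ∧
      BlockDegrees.cd (BlockDegrees.principalBlock (BlockDegrees.GroupH Q D) M) =
        {1, 3, 13, 39} ∧
      BlockDegrees.heights 3 (BlockDegrees.principalBlock (BlockDegrees.GroupH Q D) M) = {0, 1} ∧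
      ∀ P : Sylow 3 (BlockDegrees.GroupH Q D),
        BlockDegrees.IsDefectGroup 3 M (BlockDegrees.principalBlock (BlockDegrees.GroupH Q D) M)
          (P : Subgroup (BlockDegrees.GroupH Q D)) ∧
        BlockDegrees.cd (BlockDegrees.Irr P) = {1, 3, 9} ∧
        BlockDegrees.derivedLength P = 3) ∧
    -- the conjecture fails for every odd prime
    (∀ p : ℕ, p.Prime → p ≠ 2 → ∀ M : Ideal (integralClosure ℤ ℂ), M.IsMaximal →
      (p : integralClosure ℤ ℂ) ∈ M → ¬ BlockDegrees.FengLiuZhang p M) ∧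
    -- the derived length of a defect group is not bounded by the number of heights
    (∀ M : Ideal (integralClosure ℤ ℂ), M.IsMaximal → (3 : integralClosure ℤ ℂ) ∈ M →
      ¬ BlockDegrees.DerivedLengthLeHeights 3 M) := by
  have := Fact.mk Nat.prime_three
  refine ⟨fun Q D M hM h3 => ?_, fun p hp hp2 M hM h => BlockDegrees.not_fengLiuZhang hp hp2 hM h,
    fun M hM h3 => BlockDegrees.not_derivedLengthLeHeights hM h3⟩
  have hF : Module.finrank (ZMod 3) (GaloisField 3 3) = 3 := GaloisField.finrank 3 three_ne_zero
  obtain ⟨e⟩ := BlockDegrees.exists_groupH_equiv hF Q D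
  have hm := BlockDegrees.Heis.card_normOne_three hF
  have h32 : (3 : ℕ) ≠ 2 := by norm_num
  have hIrr := BlockDegrees.Heis.Irr_of_equiv e hM (by exact_mod_cast h3)
  refine ⟨BlockDegrees.card_G729, ?_, BlockDegrees.Heis.isSolvable_of_equiv hF e,
    BlockDegrees.Heis.pPrimeCore_of_equiv e, hIrr, ?_, ?_, fun P => ⟨?_, ?_, ?_⟩⟩
  · rw [BlockDegrees.Heis.card_of_equiv hF e, hm]
  · rw [← hIrr, BlockDegrees.Heis.cd_of_equiv hF e h32, hm]
    norm_num
  · rw [← hIrr, BlockDegrees.Heis.heights_of_equiv hF e h32]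
    norm_num
  · rw [← hIrr]
    exact BlockDegrees.isDefectGroup_Irr M P
  · rw [BlockDegrees.Heis.cd_sylow hF e h32]
    norm_num
  · exact BlockDegrees.Heis.derivedLength_sylow hF e h32 P
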